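/- Let $X=\mathbb{CP}^1$, let $0<\mu<1/6$, and let $q_1,q_2,q_3,p_1,\dots,p_n\in X$ ($n\ge 0$) be distinct points. Definitions. A Hecke modification $E\xleftarrow{\alpha}F$ of a rank $2$ holomorphic vector bundle $E$ on $X$ at a point $p$ is a holomorphic bundle map $\alpha:F\to E$ of rank $2$ bundles that is an isomorphism on the fibres over all $x\neq p$ and that in suitable local frames and a local coordinate $\xi$ near $p$ is the matrix $\mathrm{diag}(1,\xi-\xi(p))$. Let $\mathcal H^{tot}(X,E;p_1,\dots,p_n)$ be the set of sequences $E=E_0\xleftarrow{\alpha_1}E_1\leftarrow\cdots\xleftarrow{\alpha_n}E_n$, with $\alpha_i$ a Hecke modification of $E_{i-1}$ at $p_i$, modulo isomorphisms $\phi_i:E_i\to E_i'$ commuting with the $\alpha_i$ and with $\phi_0=\mathrm{id}_E$. It carries the topology and complex structure induced by the canonical map to $\prod_i\mathbb P(E_{p_i})$ which sends a sequence to the lines $\mathrm{im}\,(\alpha_1\circ\cdots\circ\alpha_i)_{p_i}\subset E_{p_i}$. A parabolic structure on $E$ with marked points $q_1,q_2,q_3$ is a triple of lines $\ell_{q_j}\subset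 E_{q_j}$; $(E,\ell_{q_1},\ell_{q_2},\ell_{q_3})$ is stable if $\deg L+\mu\sum_j\sigma_j<\tfrac12\deg E$ for every line subbundle $L\subset E$, where $\sigma_j=1$ if $L_{q_j}=\ell_{q_j}$ and $\sigma_j=-1$ otherwise. Let $\mathcal H_p^{tot}(X;q_1,q_2,q_3;p_1,\dots,p_n)$ be the set of sequences of Hecke modifications $(E,\ell_{q_1},\ell_{q_2},\ell_{q_3})\xleftarrow{\alpha_1}E_1\leftarrow\cdots\xleftarrow{\alpha_n}E_n$ at $p_1,\dots,p_n$ with $(E,\ell_{q_1},\ell_{q_2},\ell_{q_3})$ stable and $\det E$ trivial, modulo isomorphisms $\phi_i:E_i\to E_i'$ $(0\le i\le n)$ commuting with the $\alpha_i$ such that $\phi_0$ preserves the parabolic lines. It carries the quotient topology and the quotient complex structure from the spaces of pairs $(\ell,x)$, where $\ell$ is a stable parabolic structure on $E$ and $x\in\mathcal H^{tot}(X,E;p_1,\dots,p_n)$. The Hecke length of $\mathcal O(a)\oplus\mathcal O(b)$ is $|a-b|$. Let $\mathcal H(X;p_1,\dots,p_n)\subset\mathcal H^{tot}(X,\mathcal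 O\oplus\mathcal O;p_1,\dots,p_n)$ and $\mathcal H_p(X;q_1,q_2,q_3;p_1,\dots,p_n)\subset\mathcal H_p^{tot}(X;q_1,q_2,q_3;p_1,\dots,p_n)$ be the subspaces where $E_n$ has the minimum possible Hecke length ($0$ for $n$ even, $1$ for $n$ odd). Theorem. There are stable parabolic structures $\ell$ on $\mathcal O\oplus\mathcal O$ with marked points $q_1,q_2,q_3$, and for each of them the map $$[\mathcal O\oplus\mathcal O\leftarrow E_1\leftarrow\cdots\leftarrow E_n]\mapsto[(\mathcal O\oplus\mathcal O,\ell)\leftarrow E_1\leftarrow\cdots\leftarrow E_n]$$ is the inverse of an isomorphism (a homeomorphism that identifies the holomorphic functions) from $\mathcal H_p^{tot}(X;q_1,q_2,q_3;p_1,\dots,p_n)$ to $\mathcal H^{tot}(X,\mathcal O\oplus\mathcal O;p_1,\dots,p_n)$. This isomorphism restricts to an isomorphism from $\mathcal H_p(X;q_1,q_2,q_3;p_1,\dots,p_n)$ to $\mathcal H(X;p_1,\dots,p_n)$. Moreover, the map sending a sequence to the lines $\mathrm{im}\,(\alpha_1\circ\cdots\circ\alpha_i)_{p_i}\subset(\mathcal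 O\oplus\mathcal O)_{p_i}=\mathbb C^2$ is an isomorphism from $\mathcal H^{tot}(X,\mathcal O\oplus\mathcal O;p_1,\dots,p_n)$ to $(\mathbb{CP}^1)^n$, and hence $\mathcal H_p^{tot}(X;q_1,q_2,q_3;p_1,\dots,p_n)$ is isomorphic to $(\mathbb{CP}^1)^n$. -/

import Mathlib

open scoped Manifold ContDiff LinearAlgebra.Projectivization
open Bundle

noncomputable section

/-- The complex projective line, the set of lines in `ℂ²`. -/
abbrev CP1 : Type := ℙ ℂ (Fin 2 → ℂ)

namespace CP1

/-- `CP1` carries the quotient topology of `ℂ² ∖ {0}`. -/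
instance : TopologicalSpace CP1 :=
  TopologicalSpace.coinduced (Projectivization.mk' ℂ) inferInstance

/-- The open set of points `[v 0 : v 1]` with `v i ≠ 0`. -/
def chartSet (i : Fin 2) : Set CP1 :=
  {x | Projectivization.lift (fun v : {v : Fin 2 → ℂ // v ≠ 0} => v.1 i ≠ 0)
    (by
      rintro ⟨a, ha⟩ ⟨b, hb⟩ t (rfl : a = t • b)
      have ht : t ≠ 0 := by
        rintro rfl
        exact ha (zero_smul _ _)
      simp [ht]) x}

/-- The affine coordinate on `chartSet i`: `[1 : z] ↦ z` for `i = 0` and `[w : 1] ↦ w` for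
`i = 1`. -/
def coord (i : Fin 2) (x : CP1) : ℂ :=
  Projectivization.lift (fun v : {v : Fin 2 → ℂ // v ≠ 0} => v.1 (1 - i) / v.1 i)
    (by
      rintro ⟨a, ha⟩ ⟨b, hb⟩ t (rfl : a = t • b)
      have ht : t ≠ 0 := by
        rintro rfl
        exact ha (zero_smul _ _)
      simp [mul_div_mul_left _ _ ht]) x

/-- The vector with `i`-th entry `1` and other entry `z`. -/
def affineVec (i : Fin 2) (z : ℂ) : Fin 2 → ℂ := fun k => if k = i then 1 else z

lemma affineVec_ne_zero (i : Fin 2) (z : ℂ) : affineVec i z ≠ 0 := fun h => by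
  simpa [affineVec] using congrFun h i

/-- The inverse of `coord i`. -/
def ofCoord (i : Fin 2) (z : ℂ) : CP1 := Projectivization.mk ℂ (affineVec i z) (affineVec_ne_zero i z)

lemma mem_chartSet_mk (i : Fin 2) (v : Fin 2 → ℂ) (hv : v ≠ 0) :
    Projectivization.mk ℂ v hv ∈ chartSet i ↔ v i ≠ 0 := Iff.rfl

lemma coord_mk (i : Fin 2) (v : Fin 2 → ℂ) (hv : v ≠ 0) :
    coord i (Projectivization.mk ℂ v hv) = v (1 - i) / v i := rfl

lemma isQuotientMap_mk : Topology.IsQuotientMap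
    (Projectivization.mk' ℂ : {v : Fin 2 → ℂ // v ≠ 0} → CP1) :=
  ⟨⟨rfl⟩, Quotient.mk''_surjective⟩

lemma isOpen_chartSet (i : Fin 2) : IsOpen (chartSet i) := by
  rw [← isQuotientMap_mk.isOpen_preimage]
  exact isOpen_ne_fun ((continuous_apply i).comp continuous_subtype_val) continuous_const

lemma continuousOn_coord (i : Fin 2) : ContinuousOn (coord i) (chartSet i) := by
  rw [isQuotientMap_mk.continuousOn_isOpen_iff (isOpen_chartSet i)]
  exact ((continuous_apply (1 - i)).comp continuous_subtype_val).continuousOn.div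
    ((continuous_apply i).comp continuous_subtype_val).continuousOn (fun _ h => h)

lemma continuous_ofCoord (i : Fin 2) : Continuous (ofCoord i) := by
  have h : Continuous (fun z => (⟨affineVec i z, affineVec_ne_zero i z⟩ :
      {v : Fin 2 → ℂ // v ≠ 0})) := by
    refine Continuous.subtype_mk (continuous_pi fun k => ?_) _
    unfold affineVec
    split_ifs <;> fun_prop
  exact isQuotientMap_mk.continuous.comp h

lemma coord_ofCoord (i : Fin 2) (z : ℂ) : coord i (ofCoord i z) = z := by
  fin_cases i <;> simp [ofCoord, coord_mk, affineVec]

lemma ofCoord_coord (i : Fin 2) (x : CP1) (hx : x ∈ chartSet i) : ofCoord i (coord i x) = x := by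
  induction x using Projectivization.ind with
  | h v hv =>
    rw [mem_chartSet_mk] at hx
    rw [ofCoord, Projectivization.mk_eq_mk_iff']
    refine ⟨(v i)⁻¹, ?_⟩
    rw [coord_mk]
    ext k
    fin_cases i <;> fin_cases k <;> simp_all [affineVec, div_eq_inv_mul]

/-- The chart `coord i : chartSet i → ℂ`. -/
def chart (i : Fin 2) : OpenPartialHomeomorph CP1 ℂ where
  toFun := coord i
  invFun := ofCoord i
  source := chartSet i
  target := Set.univ
  map_source' := fun _ _ => Set.mem_univ _
  map_target' z _ := by
    change affineVec i z i ≠ 0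
    simp [affineVec]
  left_inv' := ofCoord_coord i
  right_inv' z _ := coord_ofCoord i z
  open_source := isOpen_chartSet i
  open_target := isOpen_univ
  continuousOn_toFun := continuousOn_coord i
  continuousOn_invFun := (continuous_ofCoord i).continuousOn

open scoped Classical in
/-- A chart whose domain contains `x`. -/
def chartIndex (x : CP1) : Fin 2 := if x ∈ chartSet 0 then 0 else 1

lemma mem_chartSet_chartIndex (x : CP1) : x ∈ chartSet (chartIndex x) := by
  unfold chartIndex
  split_ifs with h
  · exact h
  · induction x using Projectivization.ind with
    | h v hv =>
      rw [mem_chartSet_mk] at h ⊢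
      intro h1
      apply hv
      ext k
      fin_cases k
      · simpa using h
      · simpa using h1

instance : ChartedSpace ℂ CP1 where
  atlas := Set.range chart
  chartAt x := chart (chartIndex x)
  mem_chart_source := mem_chartSet_chartIndex
  chart_mem_atlas _ := ⟨_, rfl⟩

lemma coord_mul_coord {i j : Fin 2} (hij : i ≠ j) (x : CP1) (hi : x ∈ chartSet i)
    (hj : x ∈ chartSet j) : coord i x * coord j x = 1 := by
  induction x using Projectivization.ind with
  | h v hv =>
    rw [mem_chartSet_mk] at hi hj
    rw [coord_mk, coord_mk]
    fin_cases i <;> fin_cases j <;> simp_all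

instance : IsManifold 𝓘(ℂ) ω CP1 := by
  apply isManifold_of_contDiffOn
  rintro _ _ ⟨i, rfl⟩ ⟨j, rfl⟩
  have hsub : ∀ z ∈ 𝓘(ℂ).symm ⁻¹' ((chart i).symm.trans (chart j)).source ∩ Set.range 𝓘(ℂ),
      ofCoord i z ∈ chartSet j := by
    rintro z ⟨hz, -⟩
    exact hz.2
  by_cases hij : i = j
  · subst hij
    refine contDiffOn_id.congr fun z hz => ?_
    exact coord_ofCoord i z
  · have key : ∀ z ∈ 𝓘(ℂ).symm ⁻¹' ((chart i).symm.trans (chart j)).source ∩ Set.range 𝓘(ℂ),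
        z * coord j (ofCoord i z) = 1 := by
      intro z hz
      have := coord_mul_coord hij (ofCoord i z) ((chart i).map_target (Set.mem_univ z)) (hsub z hz)
      rwa [coord_ofCoord] at this
    have hne : ∀ z ∈ 𝓘(ℂ).symm ⁻¹' ((chart i).symm.trans (chart j)).source ∩ Set.range 𝓘(ℂ),
        z ≠ 0 := by
      rintro z hz rfl
      simpa using key 0 hz
    refine (contDiffOn_id.inv hne).congr fun z hz => ?_
    exact eq_inv_of_mul_eq_one_right (key z hz)

end CP1

/-! ### Holomorphic vector bundles on the projective line -/

/-- A holomorphic vector bundle of rank `r` on `CP1`, given by an open cover and a holomorphic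
cocycle; the total space, fibres and sections are those of the bundle glued from the cocycle. -/
structure HolBundle (r : ℕ) where
  /-- the index set of the cover -/
  ι : Type
  /-- the cover and the cocycle -/
  core : VectorBundleCore ℂ CP1 (Fin r → ℂ) ι
  /-- the cocycle is holomorphic -/
  hol : core.IsContMDiff 𝓘(ℂ) ω

namespace HolBundle

/-- The fibre of a holomorphic vector bundle. -/
abbrev Fiber {r : ℕ} (E : HolBundle r) (x : CP1) : Type := E.core.Fiber x

instance {r : ℕ} (E : HolBundle r) : E.core.IsContMDiff 𝓘(ℂ) ω := E.hol

/-- A holomorphic bundle map over the identity of `CP1`. -/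
structure Hom {r s : ℕ} (E : HolBundle r) (F : HolBundle s) where
  /-- the linear maps on fibres -/
  app : ∀ x : CP1, E.Fiber x →ₗ[ℂ] F.Fiber x
  /-- the map of total spaces is holomorphic -/
  hol : ContMDiff (𝓘(ℂ).prod 𝓘(ℂ, Fin r → ℂ)) (𝓘(ℂ).prod 𝓘(ℂ, Fin s → ℂ)) ω
    (fun v : TotalSpace (Fin r → ℂ) E.core.Fiber =>
      (⟨v.1, app v.1 v.2⟩ : TotalSpace (Fin s → ℂ) F.core.Fiber))

namespace Hom

variable {r s t : ℕ} {E : HolBundle r} {F : HolBundle s} {G : HolBundle t}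

@[ext]
lemma ext {f g : Hom E F} (h : ∀ x, f.app x = g.app x) : f = g := by
  cases f
  cases g
  congr
  exact funext h

/-- The identity bundle map. -/
def id (E : HolBundle r) : Hom E E := ⟨fun _ => LinearMap.id, contMDiff_id⟩

/-- The composition `g ∘ f`. -/
def comp (g : Hom F G) (f : Hom E F) : Hom E G :=
  ⟨fun x => (g.app x).comp (f.app x), g.hol.comp f.hol⟩

end Hom

/-- An isomorphism of holomorphic vector bundles. -/
structure Iso {r : ℕ} (E F : HolBundle r) where
  /-- the isomorphism -/
  hom : Hom E F
  /-- its inverse -/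
  inv : Hom F E
  hom_inv : hom.comp inv = Hom.id F
  inv_hom : inv.comp hom = Hom.id E

namespace Iso

variable {r : ℕ} {E F G : HolBundle r}

/-- The identity isomorphism. -/
def refl (E : HolBundle r) : Iso E E := ⟨Hom.id E, Hom.id E, rfl, rfl⟩

/-- The inverse isomorphism. -/
def symm (φ : Iso E F) : Iso F E := ⟨φ.inv, φ.hom, φ.inv_hom, φ.hom_inv⟩

/-- The composition of isomorphisms. -/
def trans (φ : Iso E F) (ψ : Iso F G) : Iso E G where
  hom := ψ.hom.comp φ.hom
  inv := φ.inv.comp ψ.inv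
  hom_inv := by
    change (ψ.hom.comp ((φ.hom.comp φ.inv).comp ψ.inv)) = _
    rw [φ.hom_inv]
    exact ψ.hom_inv
  inv_hom := by
    change (φ.inv.comp ((ψ.inv.comp ψ.hom).comp φ.hom)) = _
    rw [ψ.inv_hom]
    exact φ.inv_hom

lemma inv_hom_apply (φ : Iso E F) (x : CP1) (v : E.Fiber x) :
    φ.inv.app x (φ.hom.app x v) = v :=
  LinearMap.congr_fun (congrArg (fun f : Hom E E => f.app x) φ.inv_hom) v

lemma hom_inv_apply (φ : Iso E F) (x : CP1) (v : F.Fiber x) :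
    φ.hom.app x (φ.inv.app x v) = v :=
  LinearMap.congr_fun (congrArg (fun f : Hom F F => f.app x) φ.hom_inv) v

end Iso

/-- `s` is a holomorphic frame of `E` over `U`, that is, a local trivialization of `E` over `U`. -/
abbrev IsFrame {r : ℕ} (E : HolBundle r) (s : Fin r → ∀ x : CP1, E.Fiber x) (U : Set CP1) : Prop :=
  IsLocalFrameOn 𝓘(ℂ) (Fin r → ℂ) ω s U

/-- `ξ` is a local holomorphic coordinate of `CP1`, defined on `ξ.source`. -/
abbrev IsCoordinate (ξ : OpenPartialHomeomorph CP1 ℂ) : Prop :=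
  ξ ∈ IsManifold.maximalAtlas 𝓘(ℂ) ω CP1

lemma contDiff_det (r : ℕ) : ContDiff ℂ ω
    (fun A : (Fin r → ℂ) →L[ℂ] (Fin r → ℂ) => LinearMap.det (A : (Fin r → ℂ) →ₗ[ℂ] (Fin r → ℂ))) := by
  have h : (fun A : (Fin r → ℂ) →L[ℂ] (Fin r → ℂ) =>
      LinearMap.det (A : (Fin r → ℂ) →ₗ[ℂ] (Fin r → ℂ))) = fun A =>
      ∑ σ : Equiv.Perm (Fin r), ((Equiv.Perm.sign σ : ℤ) : ℂ) *
        ∏ i, A (Pi.single i 1) (σ i) := by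
    ext A
    rw [← LinearMap.det_toMatrix', Matrix.det_apply']
    simp [LinearMap.toMatrix'_apply]
  rw [h]
  refine ContDiff.sum fun σ _ => contDiff_const.mul (contDiff_prod fun i _ => ?_)
  have h1 : ContDiff ℂ ω (fun A : (Fin r → ℂ) →L[ℂ] (Fin r → ℂ) => A (Pi.single i 1)) :=
    contDiff_id.clm_apply contDiff_const
  exact (contDiff_apply ℂ ℂ (σ i)).comp h1

/-- The determinant line bundle. -/
def det {r : ℕ} (E : HolBundle r) : HolBundle 1 where
  ι := E.ι
  core :=
    { baseSet := E.core.baseSet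
      isOpen_baseSet := E.core.isOpen_baseSet
      indexAt := E.core.indexAt
      mem_baseSet_at := E.core.mem_baseSet_at
      coordChange := fun i j x =>
        LinearMap.det (E.core.coordChange i j x : (Fin r → ℂ) →ₗ[ℂ] (Fin r → ℂ)) •
          ContinuousLinearMap.id ℂ (Fin 1 → ℂ)
      coordChange_self := fun i x hx v => by
        have : (E.core.coordChange i i x : (Fin r → ℂ) →ₗ[ℂ] (Fin r → ℂ)) = LinearMap.id :=
          LinearMap.ext fun v => E.core.coordChange_self i x hx v
        simp [this]
      continuousOn_coordChange := fun i j =>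
        (((contDiff_det r).continuous.comp_continuousOn
          (E.core.continuousOn_coordChange i j)).smul continuousOn_const)
      coordChange_comp := fun i j k x hx v => by
        have : (E.core.coordChange i k x : (Fin r → ℂ) →ₗ[ℂ] (Fin r → ℂ)) =
            (E.core.coordChange j k x : (Fin r → ℂ) →ₗ[ℂ] (Fin r → ℂ)) *
            (E.core.coordChange i j x : (Fin r → ℂ) →ₗ[ℂ] (Fin r → ℂ)) :=
          LinearMap.ext fun v => (E.core.coordChange_comp i j k x hx v).symm
        simp [this, mul_smul, smul_comm (LinearMap.det
          (E.core.coordChange i j x : (Fin r → ℂ) →ₗ[ℂ] (Fin r → ℂ)))] }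
  hol := ⟨fun i j => by
    have h1 := (contDiff_det r).contMDiff.comp_contMDiffOn
      (E.core.contMDiffOn_coordChange (n := ω) 𝓘(ℂ) i j)
    have h2 : ContDiff ℂ ω (fun c : ℂ => c • ContinuousLinearMap.id ℂ (Fin 1 → ℂ)) :=
      contDiff_id.smul contDiff_const
    exact h2.contMDiff.comp_contMDiffOn h1⟩

/-- The coordinate `w` at infinity, `[w : 1] ↦ w`, raised to an integral power, is holomorphic away
from `0 = [1 : 0]` and `∞ = [0 : 1]`. -/
lemma contMDiffOn_coord_zpow (m : ℤ) : ContMDiffOn 𝓘(ℂ) 𝓘(ℂ) ω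
    (fun x => CP1.coord 1 x ^ m) (CP1.chartSet 0 ∩ CP1.chartSet 1) := by
  have h1 : ContMDiffOn 𝓘(ℂ) 𝓘(ℂ) ω (CP1.coord 1) (CP1.chartSet 1) :=
    contMDiffOn_of_mem_maximalAtlas (e := CP1.chart 1)
      (IsManifold.subset_maximalAtlas ⟨1, rfl⟩)
  intro x hx
  have hne : CP1.coord 1 x ≠ 0 := fun h0 => by
    have := CP1.coord_mul_coord (i := 0) (j := 1) (by decide) x hx.1 hx.2
    simp [h0] at this
  have h2 : ContDiffAt ℂ ω (fun z : ℂ => z ^ m) (CP1.coord 1 x) := by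
    have : AnalyticAt ℂ (fun z : ℂ => z ^ m) (CP1.coord 1 x) := analyticAt_id.zpow hne
    exact this.contDiffAt
  exact (h2.contMDiffAt.comp_contMDiffWithinAt x ((h1 x hx.2).mono Set.inter_subset_right))

lemma contMDiffOn_coord_zpow' (m : ℤ) (i j : Fin 2) : ContMDiffOn 𝓘(ℂ) 𝓘(ℂ) ω
    (fun x => CP1.coord 1 x ^ (m * ((j : ℤ) - (i : ℤ)))) (CP1.chartSet i ∩ CP1.chartSet j) := by
  by_cases hij : i = j
  · subst hij
    simpa using contMDiffOn_const
  · refine (contMDiffOn_coord_zpow _).mono ?_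
    fin_cases i <;> fin_cases j <;> simp_all [Set.inter_comm]

/-- The diagonal endomorphism of `ℂʳ` with entries `c`. -/
def diag {r : ℕ} (c : Fin r → ℂ) : (Fin r → ℂ) →L[ℂ] (Fin r → ℂ) :=
  ContinuousLinearMap.pi fun k => c k • ContinuousLinearMap.proj k

lemma diag_apply {r : ℕ} (c v : Fin r → ℂ) (k : Fin r) : diag c v k = c k * v k := rfl

lemma contDiff_diag (r : ℕ) : ContDiff ℂ ω (diag (r := r)) := by
  let L : (Fin r → ℂ) →ₗ[ℂ] ((Fin r → ℂ) →L[ℂ] (Fin r → ℂ)) :=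
    { toFun := diag
      map_add' := fun c d => by
        ext v k
        simp [diag_apply, add_mul]
      map_smul' := fun c d => by
        ext v k
        simp [diag_apply, mul_assoc] }
  exact (LinearMap.toContinuousLinearMap L).contDiff

lemma contMDiffOn_diag {r : ℕ} (a : Fin r → ℤ) (i j : Fin 2) :
    ContMDiffOn 𝓘(ℂ) 𝓘(ℂ, (Fin r → ℂ) →L[ℂ] (Fin r → ℂ)) ω
      (fun x => diag fun k => CP1.coord 1 x ^ (a k * ((j : ℤ) - (i : ℤ))))
      (CP1.chartSet i ∩ CP1.chartSet j) :=
  (contDiff_diag r).contMDiff.comp_contMDiffOn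
    (contMDiffOn_pi_space.2 fun k => contMDiffOn_coord_zpow' (a k) i j)

/-- The bundle `O(a 0) ⊕ ⋯ ⊕ O(a (r - 1))`, glued from the trivial bundles over
`U₀ = {[1 : z]}` and `U₁ = {[w : 1]}` by `(x, v)₀ ∼ (x, (w ^ a k * v k)ₖ)₁`. -/
def split {r : ℕ} (a : Fin r → ℤ) : HolBundle r where
  ι := Fin 2
  core :=
    { baseSet := CP1.chartSet
      isOpen_baseSet := CP1.isOpen_chartSet
      indexAt := CP1.chartIndex
      mem_baseSet_at := CP1.mem_chartSet_chartIndex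
      coordChange := fun i j x => diag fun k => CP1.coord 1 x ^ (a k * ((j : ℤ) - (i : ℤ)))
      coordChange_self := fun i x hx v => by
        ext k
        simp [diag_apply]
      continuousOn_coordChange := fun i j => (contMDiffOn_diag a i j).continuousOn
      coordChange_comp := fun i j k x hx v => by
        ext l
        simp only [diag_apply]
        rw [← mul_assoc]
        congr 1
        by_cases h : i = j ∧ j = k
        · obtain ⟨rfl, rfl⟩ := h
          simp
        · have hne : CP1.coord 1 x ≠ 0 := fun h0 => by
            have h01 : x ∈ CP1.chartSet 0 ∧ x ∈ CP1.chartSet 1 := by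
              obtain ⟨⟨hi, hj⟩, hk⟩ := hx
              fin_cases i <;> fin_cases j <;> fin_cases k <;> simp_all
            have := CP1.coord_mul_coord (i := 0) (j := 1) (by decide) x h01.1 h01.2
            simp [h0] at this
          rw [← zpow_add₀ hne]
          congr 1
          ring }
  hol := ⟨fun i j => contMDiffOn_diag a i j⟩

/-- The line bundle `O(d)`. -/
abbrev O (d : ℤ) : HolBundle 1 := split ![d]

/-- The rank two bundle `O(a) ⊕ O(b)`. -/
abbrev OO (a b : ℤ) : HolBundle 2 := split ![a, b]

/-- `E` has trivial determinant line bundle. -/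
def HasTrivialDet {r : ℕ} (E : HolBundle r) : Prop := Nonempty (Iso E.det (O 0))

lemma det_OO_zero : (OO 0 0).det = O 0 := by
  have h : ∀ x : CP1, ∀ i j : Fin 2,
      LinearMap.det (((OO 0 0).core.coordChange i j x : (Fin 2 → ℂ) →L[ℂ] (Fin 2 → ℂ)) :
        (Fin 2 → ℂ) →ₗ[ℂ] (Fin 2 → ℂ)) • ContinuousLinearMap.id ℂ (Fin 1 → ℂ) =
      diag fun k => CP1.coord 1 x ^ ((![0] : Fin 1 → ℤ) k * ((j : ℤ) - (i : ℤ))) := by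
    intro x i j
    have h1 : (((OO 0 0).core.coordChange i j x : (Fin 2 → ℂ) →L[ℂ] (Fin 2 → ℂ)) :
        (Fin 2 → ℂ) →ₗ[ℂ] (Fin 2 → ℂ)) = LinearMap.id := by
      refine LinearMap.ext fun v => funext fun k => ?_
      change CP1.coord 1 x ^ ((![0, 0] : Fin 2 → ℤ) k * ((j : ℤ) - (i : ℤ))) * v k = v k
      fin_cases k <;> simp
    rw [h1, LinearMap.det_id, one_smul]
    ext v k
    simp [diag_apply]
  unfold det O split
  congr 1
  congr 1
  funext i j x
  exact h x i j

lemma hasTrivialDet_OO_zero : (OO 0 0).HasTrivialDet := by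
  unfold HasTrivialDet
  rw [det_OO_zero]
  exact ⟨Iso.refl _⟩

/-- The line bundle `L` has degree `d`: it has a nonzero meromorphic section whose divisor `D` has
degree `d`. Near every point `x`, such a section is `(ξ - ξ x) ^ D x` times a nowhere vanishing
holomorphic section, where `ξ` is a local coordinate. -/
def IsLineDegree (L : HolBundle 1) (d : ℤ) : Prop :=
  ∃ (D : CP1 →₀ ℤ) (s : ∀ x, L.Fiber x),
    (∀ x : CP1, ∃ (U : Set CP1) (ξ : OpenPartialHomeomorph CP1 ℂ) (e : ∀ y, L.Fiber y),
      IsOpen U ∧ x ∈ U ∧ IsCoordinate ξ ∧ U ⊆ ξ.source ∧ L.IsFrame (fun _ => e) U ∧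
        ∀ y ∈ U, y ≠ x → s y = (ξ y - ξ x) ^ D x • e y) ∧
    D.sum (fun _ m => m) = d

/-- The bundle `E` has degree `d`, the degree of its determinant line bundle. -/
def IsDegree {r : ℕ} (E : HolBundle r) (d : ℤ) : Prop := E.det.IsLineDegree d

/-- The rank two bundle `E` has Hecke length `k`: it is isomorphic to `O(a) ⊕ O(b)` with
`|a - b| = k`. -/
def IsHeckeLength (E : HolBundle 2) (k : ℕ) : Prop :=
  ∃ a b : ℤ, Nonempty (Iso E (OO a b)) ∧ (a - b).natAbs = k

/-! ### Parabolic bundles -/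

/-- A parabolic structure on `E` with marked points `q`: a line in each fibre `E_{q j}`. -/
abbrev Parabolic (E : HolBundle 2) {m : ℕ} (q : Fin m ↪ CP1) : Type :=
  ∀ j, ℙ ℂ (E.Fiber (q j))

open scoped Classical in
/-- `(E, ℓ)` is parabolically stable for the weight `μ`: the parabolic slope
`deg L + μ * ∑ j, ±1` of every line subbundle `L` of `E` is less than the slope `deg E / 2`, where
the sign at `q j` is `+` if and only if `L_{q j} = ℓ j`. -/
def IsStable (μ : ℝ) (E : HolBundle 2) {m : ℕ} (q : Fin m ↪ CP1) (ℓ : E.Parabolic q) : Prop :=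
  ∀ (L : HolBundle 1) (ι : Hom L E), (∀ x, Function.Injective (ι.app x)) →
    ∀ dL dE : ℤ, L.IsDegree dL → E.IsDegree dE →
      (dL : ℝ) + μ * ∑ j, (if LinearMap.range (ι.app (q j)) = (ℓ j).submodule then (1 : ℝ) else -1)
        < (dE : ℝ) / 2

/-! ### Hecke modifications -/

/-- The bundle map `α : F → E` is a Hecke modification of `E` at `p`. -/
structure IsHecke {E F : HolBundle 2} (α : Hom F E) (p : CP1) : Prop where
  bijective : ∀ x, x ≠ p → Function.Bijective (α.app x)
  local_form : ∃ (U : Set CP1) (ξ : OpenPartialHomeomorph CP1 ℂ)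
    (e : Fin 2 → ∀ x, E.Fiber x) (f : Fin 2 → ∀ x, F.Fiber x),
    IsOpen U ∧ p ∈ U ∧ IsCoordinate ξ ∧ U ⊆ ξ.source ∧ E.IsFrame e U ∧ F.IsFrame f U ∧
      ∀ x ∈ U, α.app x (f 0 x) = e 0 x ∧ α.app x (f 1 x) = (ξ x - ξ p) • e 1 x

/-- A sequence of Hecke modifications `E ← E₁ ← ⋯ ← Eₙ` of `E` at the points `p 0, …, p (n - 1)`. -/
structure HeckeSeq (E : HolBundle 2) {n : ℕ} (p : Fin n ↪ CP1) where
  /-- the bundles `E₁, …, Eₙ` -/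
  tail : Fin n → HolBundle 2
  /-- the maps `α₁, …, αₙ` -/
  map : ∀ i : Fin n, Hom (Fin.cons (α := fun _ => HolBundle 2) E tail i.succ)
    (Fin.cons (α := fun _ => HolBundle 2) E tail i.castSucc)
  isHecke : ∀ i, IsHecke (map i) (p i)

namespace HeckeSeq

variable {E E' E'' : HolBundle 2} {n : ℕ} {p : Fin n ↪ CP1}

/-- The bundles `E₀ = E, E₁, …, Eₙ` of a sequence. -/
abbrev bundle (s : HeckeSeq E p) : Fin (n + 1) → HolBundle 2 := Fin.cons E s.tail

/-- The last bundle `Eₙ` of a sequence. -/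
def terminal (s : HeckeSeq E p) : HolBundle 2 := s.bundle (Fin.last n)

/-- The composition `α₁ ∘ ⋯ ∘ αₖ : Eₖ → E`. -/
def comp (s : HeckeSeq E p) (k : Fin (n + 1)) : Hom (s.bundle k) E :=
  Fin.induction (motive := fun k => Hom (s.bundle k) E) (Hom.id E) (fun i f => f.comp (s.map i)) k

/-- `φ : E ≅ E'` extends to an isomorphism between two sequences of Hecke modifications: there are
isomorphisms `φₖ : Eₖ ≅ E'ₖ` with `φ₀ = φ` that commute with the maps of the sequences. -/
def Extends (φ : Iso E E') (s : HeckeSeq E p) (s' : HeckeSeq E' p) : Prop :=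
  ∃ ψ : ∀ k, Iso (s.bundle k) (s'.bundle k), ψ 0 = φ ∧
    ∀ i : Fin n, (ψ i.castSucc).hom.comp (s.map i) = (s'.map i).comp (ψ i.succ).hom

lemma Extends.refl (s : HeckeSeq E p) : Extends (Iso.refl E) s s :=
  ⟨fun k => Iso.refl (s.bundle k), rfl, fun _ => rfl⟩

lemma Extends.symm {φ : Iso E E'} {s : HeckeSeq E p} {s' : HeckeSeq E' p} (h : Extends φ s s') :
    Extends φ.symm s' s := by
  obtain ⟨ψ, rfl, hψ⟩ := h
  refine ⟨fun k => (ψ k).symm, rfl, fun i => Hom.ext fun x => LinearMap.ext fun v => ?_⟩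
  have h1 := LinearMap.congr_fun (congrArg (fun f => Hom.app f x) (hψ i)) ((ψ i.succ).inv.app x v)
  change (ψ i.castSucc).hom.app x ((s.map i).app x ((ψ i.succ).inv.app x v)) =
    (s'.map i).app x ((ψ i.succ).hom.app x ((ψ i.succ).inv.app x v)) at h1
  rw [(ψ i.succ).hom_inv_apply] at h1
  change (ψ i.castSucc).inv.app x ((s'.map i).app x v) =
    (s.map i).app x ((ψ i.succ).inv.app x v)
  rw [← h1, (ψ i.castSucc).inv_hom_apply]

lemma Extends.trans {φ : Iso E E'} {φ' : Iso E' E''} {s : HeckeSeq E p} {s' : HeckeSeq E' p}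
    {s'' : HeckeSeq E'' p} (h : Extends φ s s') (h' : Extends φ' s' s'') :
    Extends (φ.trans φ') s s'' := by
  obtain ⟨ψ, rfl, hψ⟩ := h
  obtain ⟨ψ', rfl, hψ'⟩ := h'
  refine ⟨fun k => (ψ k).trans (ψ' k), rfl, fun i => ?_⟩
  change (ψ' i.castSucc).hom.comp ((ψ i.castSucc).hom.comp (s.map i)) =
    ((s''.map i).comp (ψ' i.succ).hom).comp (ψ i.succ).hom
  rw [hψ, ← hψ']
  rfl

lemma Extends.comp_range {φ : Iso E E'} {s : HeckeSeq E p} {s' : HeckeSeq E' p}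
    (h : Extends φ s s') (k : Fin (n + 1)) (x : CP1) :
    LinearMap.range ((s'.comp k).app x) =
      (LinearMap.range ((s.comp k).app x)).map (φ.hom.app x) := by
  obtain ⟨ψ, hφ, hψ⟩ := h
  have key : ∀ k, (s'.comp k).comp (ψ k).hom = φ.hom.comp (s.comp k) := by
    intro k
    induction k using Fin.induction with
    | zero => exact congrArg Iso.hom hφ
    | succ i ih =>
      change (s'.comp i.castSucc).comp ((s'.map i).comp (ψ i.succ).hom) =
        (φ.hom.comp (s.comp i.castSucc)).comp (s.map i)
      rw [← hψ i, ← ih]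
      rfl
  have h1 : ((s'.comp k).app x).comp ((ψ k).hom.app x) =
      (φ.hom.app x).comp ((s.comp k).app x) := congrArg (fun f => Hom.app f x) (key k)
  rw [← LinearMap.range_comp, ← h1, LinearMap.range_comp_of_range_eq_top]
  exact LinearMap.range_eq_top.2 fun v => ⟨_, (ψ k).hom_inv_apply x v⟩

lemma comp_bijective (s : HeckeSeq E p) (k : Fin (n + 1)) (x : CP1)
    (hx : ∀ j : Fin n, j.castSucc < k → x ≠ p j) : Function.Bijective ((s.comp k).app x) := by
  induction k using Fin.induction with
  | zero => exact Function.bijective_id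
  | succ i ih =>
    change Function.Bijective ((s.comp i.castSucc).app x ∘ (s.map i).app x)
    exact (ih fun j hj => hx j (hj.trans i.castSucc_lt_succ)).comp
      ((s.isHecke i).bijective x (hx i i.castSucc_lt_succ))

end HeckeSeq

lemma IsHecke.finrank_range {E F : HolBundle 2} {α : Hom F E} {p : CP1} (h : IsHecke α p) :
    Module.finrank ℂ (LinearMap.range (α.app p)) = 1 := by
  obtain ⟨U, ξ, e, f, -, hp, -, -, he, hf, H⟩ := h.local_form
  have h0 := (H p hp).1
  have h1 : α.app p (f 1 p) = 0 := by simpa using (H p hp).2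
  have hr : LinearMap.range (α.app p) = Submodule.span ℂ {e 0 p} := by
    rw [LinearMap.range_eq_map, ← top_le_iff.1 (hf.generating hp), Submodule.map_span]
    apply le_antisymm
    · rw [Submodule.span_le]
      rintro _ ⟨_, ⟨i, rfl⟩, rfl⟩
      fin_cases i
      · exact Submodule.subset_span h0
      · exact h1.symm ▸ Submodule.zero_mem _
    · rw [Submodule.span_singleton_le_iff_mem]
      exact Submodule.subset_span ⟨f 0 p, ⟨0, rfl⟩, h0⟩
  rw [hr]
  exact finrank_span_singleton ((he.linearIndependent hp).ne_zero 0)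

namespace HeckeSeq

variable {E : HolBundle 2} {n : ℕ} {p : Fin n ↪ CP1}

lemma finrank_range_comp (s : HeckeSeq E p) (i : Fin n) :
    Module.finrank ℂ (LinearMap.range ((s.comp i.succ).app (p i))) = 1 := by
  have hb := s.comp_bijective i.castSucc (p i) fun j hj h => by
    have : i = j := p.injective h
    subst this
    exact lt_irrefl _ hj
  change Module.finrank ℂ (LinearMap.range
    (((s.comp i.castSucc).app (p i)).comp ((s.map i).app (p i)))) = 1
  rw [LinearMap.range_comp]
  exact (Submodule.equivMapOfInjective _ hb.1 _).finrank_eq.symm.trans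
    (s.isHecke i).finrank_range

/-- The `i`-th line of a sequence of Hecke modifications at distinct points: the image in
`E_{p i}` of the fibre of `Eᵢ` at `p i` under the composition of the first `i` maps. -/
def direction (s : HeckeSeq E p) : E.Parabolic p := fun i =>
  Projectivization.mk'' (LinearMap.range ((s.comp i.succ).app (p i))) (s.finrank_range_comp i)

lemma submodule_direction (s : HeckeSeq E p) (i : Fin n) :
    (s.direction i).submodule = LinearMap.range ((s.comp i.succ).app (p i)) :=
  Projectivization.submodule_mk'' _ _

/-- Two sequences of Hecke modifications of `E` are equivalent if they are isomorphic by
isomorphisms `φᵢ : Eᵢ ≅ E'ᵢ` together with the identity of `E`. -/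
instance setoid (E : HolBundle 2) {n : ℕ} (p : Fin n ↪ CP1) : Setoid (HeckeSeq E p) where
  r s s' := Extends (Iso.refl E) s s'
  iseqv := ⟨Extends.refl, fun h => h.symm, fun h h' => h.trans h'⟩

end HeckeSeq

/-- The set of equivalence classes of sequences of Hecke modifications of `E` at the points `p`. -/
def Htot (E : HolBundle 2) {n : ℕ} (p : Fin n ↪ CP1) : Type 1 := Quotient (HeckeSeq.setoid E p)

/-- The lines of an equivalence class of sequences of Hecke modifications. -/
def Htot.direction {E : HolBundle 2} {n : ℕ} {p : Fin n ↪ CP1} 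
    (x : Htot E p) : E.Parabolic p :=
  Quotient.lift HeckeSeq.direction (fun s s' (h : HeckeSeq.Extends (Iso.refl E) s s') => by
    funext i
    apply Projectivization.submodule_injective
    rw [HeckeSeq.submodule_direction, HeckeSeq.submodule_direction, h.comp_range]
    exact (Submodule.map_id _).symm) x

/-- The space `H(S², n)`: the classes in `H^tot(S², O ⊕ O, n)` whose last bundle has the minimum
possible Hecke length, `0` for `n` even and `1` for `n` odd. -/
def Hmin {n : ℕ} (p : Fin n ↪ CP1) : Set (Htot (OO 0 0) p) :=
  {x | ∃ s : HeckeSeq (OO 0 0) p, Quotient.mk _ s = x ∧ IsHeckeLength s.terminal (n % 2)}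

/-- A sequence of Hecke modifications at `p` of a stable parabolic bundle `(E, ℓ)` with marked
points `q` such that `E` has trivial determinant bundle. -/
structure StableHeckeSeq (μ : ℝ) {m n : ℕ} (q : Fin m ↪ CP1) (p : Fin n ↪ CP1) where
  /-- the underlying bundle -/
  E : HolBundle 2
  det_trivial : E.HasTrivialDet
  /-- the parabolic lines -/
  ℓ : E.Parabolic q
  stable : IsStable μ E q ℓ
  /-- the sequence of Hecke modifications -/
  seq : HeckeSeq E p

/-- `φ` is an isomorphism of parabolic bundles `(E, ℓ) ≅ (E', ℓ')`. -/
def Iso.IsParabolic {E E' : HolBundle 2} (φ : Iso E E') {m : ℕ} {q : Fin m ↪ CP1}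
    (ℓ : E.Parabolic q) (ℓ' : E'.Parabolic q) : Prop :=
  ∀ j, (ℓ j).submodule.map (φ.hom.app (q j)) = (ℓ' j).submodule

/-- Isomorphism of sequences of Hecke modifications of parabolic bundles. -/
instance StableHeckeSeq.setoid (μ : ℝ) {m n : ℕ} (q : Fin m ↪ CP1) (p : Fin n ↪ CP1) :
    Setoid (StableHeckeSeq μ q p) where
  r s s' := ∃ φ : Iso s.E s'.E, φ.IsParabolic s.ℓ s'.ℓ ∧ HeckeSeq.Extends φ s.seq s'.seq
  iseqv :=
    { refl := fun s => ⟨Iso.refl s.E, fun _ => Submodule.map_id _, HeckeSeq.Extends.refl s.seq⟩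
      symm := by
        rintro s s' ⟨φ, h, h'⟩
        refine ⟨φ.symm, fun j => ?_, h'.symm⟩
        rw [← h j, ← Submodule.map_comp]
        have : (φ.symm.hom.app (q j)).comp (φ.hom.app (q j)) = LinearMap.id :=
          LinearMap.ext (φ.inv_hom_apply (q j))
        rw [this, Submodule.map_id]
      trans := by
        rintro s s' s'' ⟨φ, h, h'⟩ ⟨ψ, k, k'⟩
        refine ⟨φ.trans ψ, fun j => ?_, h'.trans k'⟩
        rw [← k j, ← h j, ← Submodule.map_comp]
        rfl }

/-- The set `H_p^tot` of isomorphism classes of sequences of Hecke modifications at `p` of stable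
parabolic bundles with marked points `q` and trivial determinant. -/
def Hptot (μ : ℝ) {m n : ℕ} (q : Fin m ↪ CP1) (p : Fin n ↪ CP1) : Type 1 :=
  Quotient (StableHeckeSeq.setoid μ q p)

/-- The subset `H_p` of `H_p^tot`: the classes whose last bundle has the minimum possible Hecke
length. -/
def Hpmin (μ : ℝ) {m n : ℕ} (q : Fin m ↪ CP1) (p : Fin n ↪ CP1) : Set (Hptot μ q p) :=
  {x | ∃ s : StableHeckeSeq μ q p, Quotient.mk _ s = x ∧ IsHeckeLength s.seq.terminal (n % 2)}

/-- The pairs of a stable parabolic structure on `E` and an equivalence class of sequences of Hecke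
modifications of `E`. -/
abbrev StablePairs (μ : ℝ) {m n : ℕ} (E : HolBundle 2) (q : Fin m ↪ CP1) (p : Fin n ↪ CP1) :
    Type 1 :=
  {ℓ : E.Parabolic q // IsStable μ E q ℓ} × Htot E p

/-- The map `(ℓ, [E ← E₁ ← ⋯ ← Eₙ]) ↦ [(E, ℓ) ← E₁ ← ⋯ ← Eₙ]`. -/
def Hptot.mk (μ : ℝ) {m n : ℕ} (E : HolBundle 2) (hE : E.HasTrivialDet) (q : Fin m ↪ CP1)
    (p : Fin n ↪ CP1) (y : StablePairs μ E q p) : Hptot μ q p :=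
  Quotient.lift (fun s : HeckeSeq E p =>
      (Quotient.mk _ ⟨E, hE, y.1.1, y.1.2, s⟩ : Hptot μ q p))
    (fun _ _ h => Quotient.sound ⟨Iso.refl E, fun _ => Submodule.map_id _, h⟩) y.2

end HolBundle

/-! ### Spaces with holomorphic functions -/

/-- A structure of space with holomorphic functions on `M`: `IsHolOn U f` says that `f` is
holomorphic on the open set `U`; the values of `f` outside `U` play no role. -/
class HolSpace (M : Type*) where
  /-- holomorphic functions on open sets -/
  IsHolOn : Set M → (M → ℂ) → Prop

/-- An isomorphism of spaces with holomorphic functions: a homeomorphism that identifies the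
holomorphic functions on open sets. -/
structure HolIso (M N : Type*) [TopologicalSpace M] [HolSpace M] [TopologicalSpace N] [HolSpace N]
    extends M ≃ₜ N where
  isHolOn_iff : ∀ (U : Set N) (f : N → ℂ), IsOpen U →
    (HolSpace.IsHolOn U f ↔ HolSpace.IsHolOn (toFun ⁻¹' U) (f ∘ toFun))

/-- The structure induced by a map `χ : M → N`: its holomorphic functions are those that are
locally of the form `g ∘ χ` with `g` holomorphic. -/
@[reducible]
def HolSpace.induced {M N : Type*} [TopologicalSpace N] [HolSpace N] (χ : M → N) : HolSpace M where
  IsHolOn U f := ∀ x ∈ U, ∃ (V : Set N) (g : N → ℂ), IsOpen V ∧ χ x ∈ V ∧ HolSpace.IsHolOn V g ∧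
    ∀ y ∈ U, χ y ∈ V → f y = g (χ y)

/-- A subset carries the subspace structure: its holomorphic functions are locally restrictions of
holomorphic functions. -/
instance HolSpace.subtype {M : Type*} [TopologicalSpace M] [HolSpace M] (S : Set M) : HolSpace S :=
  HolSpace.induced Subtype.val

/-- The complex structure of a finite power of `CP1`: a function is holomorphic on an open set `U`
if it is a holomorphic function of the homogeneous coordinates. -/
instance CP1.holSpacePi (κ : Type) [Fintype κ] : HolSpace (κ → CP1) where
  IsHolOn U f := ∃ g : (κ → Fin 2 → ℂ) → ℂ,
    ∀ (v : κ → Fin 2 → ℂ) (hv : ∀ k, v k ≠ 0),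
      (fun k => Projectivization.mk ℂ (v k) (hv k)) ∈ U →
        DifferentiableAt ℂ g v ∧ g v = f fun k => Projectivization.mk ℂ (v k) (hv k)

namespace HolBundle

/-- A line in the fibre `E_x`, as a point of `CP1` in the linear coordinates of that fibre. -/
def linePoint {E : HolBundle 2} {x : CP1} (l : ℙ ℂ (E.Fiber x)) : CP1 := l

/-- The map from `H^tot(S², E, n)` to the product of the projective lines `ℙ(E_{p i})`. -/
def Htot.lines {E : HolBundle 2} {n : ℕ} {p : Fin n ↪ CP1} (x : Htot E p) (i : Fin n) : CP1 :=
  linePoint (x.direction i)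

/-- `H^tot(S², E, n)` has the topology of the product of the projective lines `ℙ(E_{p i})`. -/
instance Htot.topologicalSpace (E : HolBundle 2) {n : ℕ} (p : Fin n ↪ CP1) :
    TopologicalSpace (Htot E p) :=
  TopologicalSpace.induced Htot.lines inferInstance

/-- `H^tot(S², E, n)` has the complex structure of the product of the projective lines
`ℙ(E_{p i})`. -/
instance Htot.holSpace (E : HolBundle 2) {n : ℕ} (p : Fin n ↪ CP1) : HolSpace (Htot E p) :=
  HolSpace.induced Htot.lines

/-- The map `(ℓ, x) ↦ (ℓ, lines of x)` from pairs to the product of the projective lines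
`ℙ(E_{q j})` and `ℙ(E_{p i})`, which induces the structure of the set of pairs. -/
def StablePairs.lines {μ : ℝ} {m n : ℕ} {E : HolBundle 2} {q : Fin m ↪ CP1} {p : Fin n ↪ CP1}
    (y : StablePairs μ E q p) : Fin m ⊕ Fin n → CP1 :=
  Sum.elim (fun j => linePoint (y.1.1 j)) y.2.lines

/-- `H_p^tot` has the quotient topology: a set is open if and only if its preimages in the sets of
pairs `(ℓ, [E ← E₁ ← ⋯ ← Eₙ])` are open for all `E`. -/
instance Hptot.topologicalSpace (μ : ℝ) {m n : ℕ} (q : Fin m ↪ CP1) (p : Fin n ↪ CP1) :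
    TopologicalSpace (Hptot μ q p) :=
  ⨆ (E : HolBundle 2) (hE : E.HasTrivialDet),
    TopologicalSpace.coinduced (Hptot.mk μ E hE q p)
      (TopologicalSpace.induced StablePairs.lines inferInstance)

/-- `H_p^tot` has the complex structure of a quotient: a function is holomorphic if and only if it
is holomorphic as a function of `(ℓ, [E ← E₁ ← ⋯ ← Eₙ])` for all `E`. -/
instance Hptot.holSpace (μ : ℝ) {m n : ℕ} (q : Fin m ↪ CP1) (p : Fin n ↪ CP1) :
    HolSpace (Hptot μ q p) where
  IsHolOn U f := ∀ (E : HolBundle 2) (hE : E.HasTrivialDet),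
    (HolSpace.induced (StablePairs.lines (μ := μ) (E := E) (q := q) (p := p))).IsHolOn
      (Hptot.mk μ E hE q p ⁻¹' U) (f ∘ Hptot.mk μ E hE q p)

end HolBundle

end

/-! The weight `μ` is so small that stability leaves no freedom. By the Birkhoff–Grothendieck
theorem a rank two bundle with trivial determinant is `O(a) ⊕ O(-a)`. If `a ≥ 1`, the summand `O(a)`
has parabolic slope at least `1 - 3μ > 0` and destabilizes, so the bundle is `O ⊕ O`
(`exists_iso_OO_zero`). If two of the three parabolic lines agree in `ℂ²`, the constant line
subbundle through them has slope at least `μ > 0` (`IsStable.det₂_ne_zero`). Conversely, for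
distinct lines a subbundle of degree zero is constant and passes through at most one of them, which
gives slope at most `-μ`, and one of negative degree has slope at most `-1 + 3μ < 0`
(`isStable_of_det₂_ne_zero`). So stable parabolic structures on `O ⊕ O` are exactly triples of
distinct points of the projective line.

`PGL₂` acts simply transitively on such triples. Hence every class has a representative on `O ⊕ O`
with the fixed structure `ℓ` (`exists_normal_form`). It is unique: automorphisms of `O ⊕ O` are
constant, and those preserving three distinct lines are scalars, which act trivially on all lines
(`Hptot.mk_injective`). The transformation to the normal form is polynomial in homogeneous
coordinates of the parabolic lines and of the Hecke lines (`Hptot.exists_isLift`), which makes the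
bijection continuous and compatible with holomorphic functions.

Since the points are distinct, a sequence of Hecke modifications is the same as a free choice of one
line at each point. A modification with a given line is constructed by gluing (`exists_isHecke`),
and a bundle map whose image lies in that line factors through it (`IsHecke.exists_lift`); induction
on the length gives `Htot.lines_bijective`.

The analytic core is Birkhoff–Grothendieck. A meromorphic section with prescribed direction at
infinity is sought as a smooth section corrected by Cauchy transforms. The correction satisfies an
integral equation `y + K y = T p` with `K` compact, and as the polynomial `p` ranges over an
infinite dimensional space the equation is solvable for some `p ≠ 0`
(`PlaneCocycle.exists_opLin_eq`). Two such sections, independent at infinity, have a determinant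
that is an entire function of polynomial growth. As long as it has a zero, a combination of the
sections can be divided by a linear function there; when no zero is left, they split the bundle
(`exists_iso_split`). Degrees of subbundles are controlled by Liouville's theorem
(`degree_nonpos_of_local`). -/

noncomputable section

open Filter Topology

/-! ### Holomorphic functions on the projective line -/

/-- A vector-valued function on `CP1` is holomorphic at `x`. -/
abbrev HolAt {V : Type*} [NormedAddCommGroup V] [NormedSpace ℂ V] (f : CP1 → V) (x : CP1) : Prop :=
  ContMDiffAt 𝓘(ℂ) 𝓘(ℂ, V) ω f x

namespace CP1

variable {V : Type*} [NormedAddCommGroup V] [NormedSpace ℂ V]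

/-- The point at infinity `[0 : 1]`. -/
def infty : CP1 := ofCoord 1 0

lemma ofCoord_mem (i : Fin 2) (z : ℂ) : ofCoord i z ∈ chartSet i := by
  change affineVec i z i ≠ 0
  simp [affineVec]

lemma chart_mem_maximalAtlas (i : Fin 2) :
    chart i ∈ IsManifold.maximalAtlas 𝓘(ℂ) ω CP1 :=
  IsManifold.subset_maximalAtlas ⟨i, rfl⟩

lemma holAt_iff_of_coordinate [CompleteSpace V] {f : CP1 → V} {x : CP1}
    {ξ : OpenPartialHomeomorph CP1 ℂ} (hξ : ξ ∈ IsManifold.maximalAtlas 𝓘(ℂ) ω CP1)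
    (hx : x ∈ ξ.source) :
    HolAt f x ↔ AnalyticAt ℂ (f ∘ ξ.symm) (ξ x) := by
  unfold HolAt
  rw [← contMDiffWithinAt_univ, contMDiffWithinAt_iff_source_of_mem_maximalAtlas hξ hx]
  simp only [Set.preimage_univ, modelWithCornersSelf_coe, Set.range_id, Set.inter_self,
    contMDiffWithinAt_univ]
  rw [contMDiffAt_iff_contDiffAt]
  exact ⟨fun h => h.analyticAt, fun h => h.contDiffAt⟩

lemma holAt_iff [CompleteSpace V] {f : CP1 → V} {x : CP1} (i : Fin 2) (hx : x ∈ chartSet i) :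
    HolAt f x ↔ AnalyticAt ℂ (f ∘ ofCoord i) (coord i x) :=
  holAt_iff_of_coordinate (chart_mem_maximalAtlas i) hx

lemma holAt_ofCoord_iff [CompleteSpace V] {f : CP1 → V} (i : Fin 2) (z : ℂ) :
    HolAt f (ofCoord i z) ↔ AnalyticAt ℂ (f ∘ ofCoord i) z := by
  rw [holAt_iff i (ofCoord_mem i z), coord_ofCoord]

lemma ofCoord_one_eq {w : ℂ} (hw : w ≠ 0) : ofCoord 1 w = ofCoord 0 w⁻¹ := by
  unfold ofCoord
  rw [Projectivization.mk_eq_mk_iff']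
  refine ⟨w, ?_⟩
  ext k
  fin_cases k <;> simp [affineVec, hw]

lemma infty_notMem : infty ∉ chartSet 0 := by
  intro h
  change affineVec 1 0 0 ≠ 0 at h
  simp [affineVec] at h

lemma eq_infty_of_notMem {x : CP1} (hx : x ∉ chartSet 0) : x = infty := by
  have h1 : x ∈ chartSet 1 := by
    have := mem_chartSet_chartIndex x
    rw [chartIndex, if_neg hx] at this
    exact this
  rw [← ofCoord_coord 1 x h1, infty]
  congr 1
  induction x using Projectivization.ind with
  | h v hv =>
    rw [mem_chartSet_mk] at hx
    rw [coord_mk]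
    simp at hx
    simp [hx]

lemma mem_chartSet_zero_iff {x : CP1} : x ∈ chartSet 0 ↔ x ≠ infty :=
  ⟨fun h h' => infty_notMem (h' ▸ h), fun h => by_contra fun h' => h (eq_infty_of_notMem h')⟩

lemma infty_mem : infty ∈ chartSet 1 := ofCoord_mem 1 0

lemma coord_infty : coord 1 infty = 0 := coord_ofCoord 1 0

lemma chartIndex_infty : chartIndex infty = 1 := if_neg infty_notMem

/-- Every point of `CP1` is a finite point or the point at infinity. -/
lemma cases_point (x : CP1) : x = infty ∨ ∃ z : ℂ, x = ofCoord 0 z := by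
  by_cases h : x ∈ chartSet 0
  · exact Or.inr ⟨_, (ofCoord_coord 0 x h).symm⟩
  · exact Or.inl (eq_infty_of_notMem h)

lemma ofCoord_ne_infty (z : ℂ) : ofCoord 0 z ≠ infty :=
  mem_chartSet_zero_iff.1 (ofCoord_mem 0 z)

/-- There are no isolated points, so identities between continuous data extend from a punctured
neighbourhood to its centre. -/
instance (x : CP1) : NeBot (𝓝[≠] x) := by
  set i := chartIndex x
  have hx := mem_chartSet_chartIndex x
  have h : Tendsto (ofCoord i) (𝓝[≠] (coord i x)) (𝓝[≠] x) := by
    refine tendsto_nhdsWithin_iff.2 ⟨?_, ?_⟩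
    · have := (continuous_ofCoord i).tendsto (coord i x)
      rw [ofCoord_coord i x hx] at this
      exact this.mono_left nhdsWithin_le_nhds
    · filter_upwards [self_mem_nhdsWithin] with z hz hz'
      exact hz (by rw [← (hz' : ofCoord i z = x), coord_ofCoord]; rfl)
  exact h.neBot

lemma isClosed_singleton (x : CP1) : IsClosed ({x} : Set CP1) := by
  rw [← isOpen_compl_iff, isOpen_iff_mem_nhds]
  intro y hy
  by_cases h : ∃ i, x ∈ chartSet i ∧ y ∈ chartSet i
  · obtain ⟨i, hx, hyi⟩ := h
    have hne : coord i y ≠ coord i x := fun h => hy (by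
      rw [Set.mem_singleton_iff, ← ofCoord_coord i x hx, ← h, ofCoord_coord i y hyi])
    have := (continuousOn_coord i).continuousAt ((isOpen_chartSet i).mem_nhds hyi)
    filter_upwards [this.eventually_ne hne] with z hz hz'
    exact hz (by rw [(hz' : z = x)])
  · push Not at h
    have hx := mem_chartSet_chartIndex x
    have hy' := mem_chartSet_chartIndex y
    filter_upwards [(isOpen_chartSet _).mem_nhds hy'] with z hz hz'
    exact h _ ((hz' : z = x) ▸ hz) hy'

instance : T1Space CP1 := ⟨isClosed_singleton⟩

lemma ofCoord_eventually {x : CP1} (i : Fin 2) (hx : x ∈ chartSet i) {P : CP1 → Prop} :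
    (∀ᶠ y in 𝓝 x, P y) ↔ ∀ᶠ z in 𝓝 (coord i x), P (ofCoord i z) := by
  have := (chart i).symm.map_nhds_eq (x := coord i x) (Set.mem_univ _)
  change map (ofCoord i) _ = 𝓝 (ofCoord i (coord i x)) at this
  rw [ofCoord_coord i x hx] at this
  rw [← this]
  rfl

end CP1

section HolAt

variable {V W : Type*} [NormedAddCommGroup V] [NormedSpace ℂ V] [NormedAddCommGroup W]
  [NormedSpace ℂ W] {x : CP1}

lemma HolAt.clm_comp {f : CP1 → V} (L : V →L[ℂ] W) (hf : HolAt f x) :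
    HolAt (fun y => L (f y)) x :=
  L.contDiff.contMDiff.contMDiffAt.comp x hf

lemma HolAt.eventually_eq {f g : CP1 → V} (hf : HolAt f x) (h : ∀ᶠ y in 𝓝 x, g y = f y) :
    HolAt g x := hf.congr_of_eventuallyEq h

/-- A function with values in the linear maps on `ℂʳ` is holomorphic if all its columns are. -/
lemma holAt_clm_of_columns {r : ℕ} {M : CP1 → (Fin r → ℂ) →L[ℂ] W}
    (h : ∀ k, HolAt (fun y => M y (Pi.single k 1)) x) : HolAt M x := by
  have : M = fun y => ∑ k, ((ContinuousLinearMap.smulRightL ℂ (Fin r → ℂ) W)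
      (ContinuousLinearMap.proj k)) (M y (Pi.single k 1)) := by
    ext y v
    conv_lhs => rw [pi_eq_sum_univ' v]
    simp [map_sum]
  rw [this]
  exact ContMDiffAt.sum fun k _ => (h k).clm_comp _

end HolAt

/-- The inverse of a holomorphic family of invertible matrices is holomorphic. -/
lemma holAt_of_inverse {r : ℕ} {x : CP1} {M N : CP1 → (Fin r → ℂ) →L[ℂ] (Fin r → ℂ)}
    (hM : HolAt M x) (h : ∀ᶠ y in 𝓝 x, (M y).comp (N y) = ContinuousLinearMap.id ℂ _ ∧
      (N y).comp (M y) = ContinuousLinearMap.id ℂ _) : HolAt N x := by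
  have hx := h.self_of_nhds
  have h2 : ContDiffAt ℂ ω (ContinuousLinearMap.inverse : ((Fin r → ℂ) →L[ℂ] (Fin r → ℂ)) → _)
      (M x) :=
    contDiffAt_map_inverse (ContinuousLinearEquiv.equivOfInverse (M x) (N x)
      (fun v => DFunLike.congr_fun hx.2 v) (fun v => DFunLike.congr_fun hx.1 v))
  refine HolAt.eventually_eq (f := fun y => ContinuousLinearMap.inverse (M y))
    (ContMDiffAt.comp (x := x) (g := ContinuousLinearMap.inverse) h2.contMDiffAt hM) ?_
  filter_upwards [h] with y hy
  exact (ContinuousLinearMap.inverse_eq hy.1 hy.2).symm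

/-! ### Fibre coordinates, local matrices of bundle maps and frames -/

namespace HolBundle

variable {r s : ℕ}

/-- The linear coordinates of the fibre at `x` in the `i`-th trivialization. -/
def toC (E : HolBundle r) (i : E.ι) (x : CP1) : E.Fiber x →ₗ[ℂ] (Fin r → ℂ) :=
  (E.core.coordChange (E.core.indexAt x) i x : (Fin r → ℂ) →ₗ[ℂ] (Fin r → ℂ))

/-- The vector in the fibre at `x` with given coordinates in the `i`-th trivialization. -/
def ofC (E : HolBundle r) (i : E.ι) (x : CP1) : (Fin r → ℂ) →ₗ[ℂ] E.Fiber x :=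
  (E.core.coordChange i (E.core.indexAt x) x : (Fin r → ℂ) →ₗ[ℂ] (Fin r → ℂ))

/-- The domain of the `i`-th trivialization. -/
abbrev base (E : HolBundle r) (i : E.ι) : Set CP1 := E.core.baseSet i

lemma isOpen_base (E : HolBundle r) (i : E.ι) : IsOpen (E.base i) := E.core.isOpen_baseSet i

/-- A trivialization over a neighbourhood of `x`. -/
abbrev idx (E : HolBundle r) (x : CP1) : E.ι := E.core.indexAt x

lemma mem_base_idx (E : HolBundle r) (x : CP1) : x ∈ E.base (E.idx x) := E.core.mem_baseSet_at x

lemma toC_ofC (E : HolBundle r) {i : E.ι} {x : CP1} (hx : x ∈ E.base i) (v : Fin r → ℂ) :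
    E.toC i x (E.ofC i x v) = v := by
  change E.core.coordChange _ i x (E.core.coordChange i _ x v) = v
  rw [E.core.coordChange_comp i _ i x ⟨⟨hx, E.mem_base_idx x⟩, hx⟩, E.core.coordChange_self i x hx]

lemma ofC_toC (E : HolBundle r) {i : E.ι} {x : CP1} (hx : x ∈ E.base i) (v : E.Fiber x) :
    E.ofC i x (E.toC i x v) = v := by
  change E.core.coordChange i _ x (E.core.coordChange _ i x v) = v
  exact (E.core.coordChange_comp _ i _ x ⟨⟨E.mem_base_idx x, hx⟩, E.mem_base_idx x⟩ v).trans
    (E.core.coordChange_self _ x (E.mem_base_idx x) v)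

lemma toC_ofC' (E : HolBundle r) {i j : E.ι} {x : CP1} (hi : x ∈ E.base i) (hj : x ∈ E.base j)
    (v : Fin r → ℂ) : E.toC j x (E.ofC i x v) = E.core.coordChange i j x v :=
  E.core.coordChange_comp i _ j x ⟨⟨hi, E.mem_base_idx x⟩, hj⟩ v

lemma toC_injective (E : HolBundle r) {i : E.ι} {x : CP1} (hx : x ∈ E.base i) :
    Function.Injective (E.toC i x) := fun v w h => by
  rw [← E.ofC_toC hx v, h, E.ofC_toC hx]

lemma holAt_coordChange (E : HolBundle r) {i j : E.ι} {x : CP1} (hi : x ∈ E.base i)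
    (hj : x ∈ E.base j) : HolAt (E.core.coordChange i j) x :=
  (E.core.contMDiffOn_coordChange (n := ω) 𝓘(ℂ) i j).contMDiffAt
    (((E.isOpen_base i).inter (E.isOpen_base j)).mem_nhds ⟨hi, hj⟩)

/-- The section `s` of `E` is holomorphic at `x`. -/
abbrev SecAt (E : HolBundle r) (s : ∀ x, E.Fiber x) (x : CP1) : Prop :=
  ContMDiffAt 𝓘(ℂ) (𝓘(ℂ).prod 𝓘(ℂ, Fin r → ℂ)) ω
    (fun y => TotalSpace.mk' (Fin r → ℂ) y (s y)) x

instance (E : HolBundle r) (i : E.ι) : MemTrivializationAtlas (E.core.localTriv i) :=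
  ⟨⟨i, rfl⟩⟩

lemma secAt_iff (E : HolBundle r) {σ : ∀ x, E.Fiber x} {x : CP1} {i : E.ι} (hx : x ∈ E.base i) :
    E.SecAt σ x ↔ HolAt (fun y => E.toC i y (σ y)) x :=
  Trivialization.contMDiffAt_section_iff (E.core.localTriv i) hx

lemma secAt_ofC (E : HolBundle r) {x : CP1} {i : E.ι} (hx : x ∈ E.base i) {f : CP1 → Fin r → ℂ}
    (hf : HolAt f x) : E.SecAt (fun y => E.ofC i y (f y)) x := by
  rw [E.secAt_iff hx]
  refine hf.eventually_eq ?_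
  filter_upwards [(E.isOpen_base i).mem_nhds hx] with y hy
  exact E.toC_ofC hy _

lemma Hom.secAt {E : HolBundle r} {F : HolBundle s} (f : Hom E F) {σ : ∀ x, E.Fiber x} {x : CP1}
    (h : E.SecAt σ x) : F.SecAt (fun y => f.app y (σ y)) x :=
  f.hol.contMDiffAt.comp x h

/-- The matrix of a family of linear maps of fibres in local trivializations. -/
def locMat {E : HolBundle r} {F : HolBundle s} (A : ∀ x, E.Fiber x →ₗ[ℂ] F.Fiber x) (i : E.ι)
    (j : F.ι) (x : CP1) : (Fin r → ℂ) →L[ℂ] (Fin s → ℂ) :=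
  LinearMap.toContinuousLinearMap ((F.toC j x) ∘ₗ (A x) ∘ₗ (E.ofC i x))

lemma locMat_apply {E : HolBundle r} {F : HolBundle s} (A : ∀ x, E.Fiber x →ₗ[ℂ] F.Fiber x)
    (i : E.ι) (j : F.ι) (x : CP1) (v : Fin r → ℂ) :
    locMat A i j x v = F.toC j x (A x (E.ofC i x v)) := rfl

lemma Hom.holAt_locMat {E : HolBundle r} {F : HolBundle s} (f : Hom E F) {i : E.ι} {j : F.ι}
    {x : CP1} (hi : x ∈ E.base i) (hj : x ∈ F.base j) : HolAt (locMat f.app i j) x := by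
  refine holAt_clm_of_columns fun k => ?_
  have h := f.secAt (E.secAt_ofC hi (f := fun _ => Pi.single k 1) contMDiffAt_const)
  rw [F.secAt_iff hj] at h
  exact h

/-- A family of linear maps of fibres is a holomorphic bundle map if its local matrices are
holomorphic. -/
def Hom.ofLocal {E : HolBundle r} {F : HolBundle s} (A : ∀ x, E.Fiber x →ₗ[ℂ] F.Fiber x)
    (h : ∀ x, ∃ i j, x ∈ E.base i ∧ x ∈ F.base j ∧ HolAt (locMat A i j) x) : Hom E F where
  app := A
  hol := by
    intro v
    obtain ⟨i, j, hi, hj, hA⟩ := h v.1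
    refine (Trivialization.contMDiffAt_iff (e := F.core.localTriv j) (by exact hj)).2 ?_
    have hπ : ContMDiffAt (𝓘(ℂ).prod 𝓘(ℂ, Fin r → ℂ)) 𝓘(ℂ) ω
        (fun w : TotalSpace (Fin r → ℂ) E.core.Fiber => w.1) v := contMDiffAt_proj _
    refine ⟨hπ, ?_⟩
    have h2 : ContMDiffAt (𝓘(ℂ).prod 𝓘(ℂ, Fin r → ℂ)) 𝓘(ℂ, Fin r → ℂ) ω
        (fun w : TotalSpace (Fin r → ℂ) E.core.Fiber => E.toC i w.1 w.2) v :=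
      ((Trivialization.contMDiffAt_iff (n := ω) (IB := 𝓘(ℂ)) (e := E.core.localTriv i)
        (f := fun w => w) (x₀ := v) hi).1 contMDiffAt_id).2
    have h3 : ContMDiffAt (𝓘(ℂ).prod 𝓘(ℂ, Fin r → ℂ)) 𝓘(ℂ, (Fin r → ℂ) →L[ℂ] (Fin s → ℂ)) ω
        (fun w : TotalSpace (Fin r → ℂ) E.core.Fiber => locMat A i j w.1) v :=
      ContMDiffAt.comp (x := v) (g := locMat A i j) hA hπ
    refine (h3.clm_apply h2).congr_of_eventuallyEq ?_
    filter_upwards [hπ.continuousAt.preimage_mem_nhds ((E.isOpen_base i).mem_nhds hi)] with w hw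
    rw [locMat_apply, E.ofC_toC hw]
    rfl

/-- Bundle maps that agree away from a point are equal. -/
lemma Hom.ext_of_ne {E : HolBundle r} {F : HolBundle s} {f g : Hom E F} (p : CP1)
    (h : ∀ x, x ≠ p → f.app x = g.app x) : f = g := by
  refine Hom.ext fun x => ?_
  by_cases hx : x = p
  swap
  · exact h x hx
  subst hx
  have hi := E.mem_base_idx x
  have hj := F.mem_base_idx x
  have h1 := (f.holAt_locMat hi hj).continuousAt
  have h2 := (g.holAt_locMat hi hj).continuousAt
  -- Both matrices are continuous at `x` and agree on a punctured neighbourhood of it, so they have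
  -- the same limit.
  have h3 : locMat f.app (E.idx x) (F.idx x) x = locMat g.app (E.idx x) (F.idx x) x := by
    refine tendsto_nhds_unique (h1.mono_left (nhdsWithin_le_nhds (s := {x}ᶜ)))
      ((h2.mono_left nhdsWithin_le_nhds).congr' ?_)
    filter_upwards [self_mem_nhdsWithin] with y hy
    unfold locMat
    rw [h y hy]
  ext1 v
  have h4 := DFunLike.congr_fun h3 (E.toC (E.idx x) x v)
  rw [locMat_apply, locMat_apply, E.ofC_toC hi] at h4
  exact F.toC_injective hj h4

/-- A fibrewise bijective bundle map is an isomorphism. -/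
lemma Hom.exists_iso {E F : HolBundle r} (f : Hom E F) (hf : ∀ x, Function.Bijective (f.app x)) :
    ∃ φ : Iso E F, φ.hom = f := by
  let A : ∀ x, E.Fiber x ≃ₗ[ℂ] F.Fiber x := fun x => LinearEquiv.ofBijective (f.app x) (hf x)
  refine ⟨⟨f, Hom.ofLocal (fun x => ((A x).symm : F.Fiber x →ₗ[ℂ] E.Fiber x)) fun x => ?_,
    Hom.ext fun x => LinearMap.ext fun v => (A x).apply_symm_apply v,
    Hom.ext fun x => LinearMap.ext fun v => (A x).symm_apply_apply v⟩, rfl⟩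
  refine ⟨F.idx x, E.idx x, F.mem_base_idx x, E.mem_base_idx x, ?_⟩
  set i := E.idx x
  set j := F.idx x
  have hi : x ∈ E.base i := E.mem_base_idx x
  have hj : x ∈ F.base j := F.mem_base_idx x
  have key : ∀ y ∈ E.base i ∩ F.base j,
      (locMat f.app i j y).comp (locMat (fun x => ((A x).symm : F.Fiber x →ₗ[ℂ] E.Fiber x)) j i y) =
        ContinuousLinearMap.id ℂ _ ∧
      (locMat (fun x => ((A x).symm : F.Fiber x →ₗ[ℂ] E.Fiber x)) j i y).comp (locMat f.app i j y) =
        ContinuousLinearMap.id ℂ _ := by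
    intro y hy
    constructor <;> ext1 v <;>
      simp only [ContinuousLinearMap.comp_apply, locMat_apply, ContinuousLinearMap.id_apply]
    · rw [E.ofC_toC hy.1]
      exact (congrArg _ ((A y).apply_symm_apply _)).trans (F.toC_ofC hy.2 v)
    · rw [F.ofC_toC hy.2]
      exact (congrArg _ ((A y).symm_apply_apply _)).trans (E.toC_ofC hy.1 v)
  exact holAt_of_inverse (f.holAt_locMat hi hj) (Filter.mem_of_superset
    (((E.isOpen_base i).inter (F.isOpen_base j)).mem_nhds ⟨hi, hj⟩) key)

/-- Coordinates of a frame: over a frame, a section is a combination with holomorphic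
coefficients. -/
lemma IsFrame.exists_coeff {E : HolBundle r} {e : Fin r → ∀ x, E.Fiber x} {U : Set CP1}
    (he : E.IsFrame e U) (hU : IsOpen U) :
    ∃ c : ∀ x, E.Fiber x →ₗ[ℂ] (Fin r → ℂ),
      (∀ x ∈ U, ∀ v, v = ∑ k, c x v k • e k x) ∧
      (∀ x ∈ U, ∀ a : Fin r → ℂ, c x (∑ k, a k • e k x) = a) ∧
      ∀ σ : ∀ x, E.Fiber x, ∀ x ∈ U, E.SecAt σ x → HolAt (fun y => c y (σ y)) x := by
  classical
  let B : ∀ x, (Fin r → ℂ) →ₗ[ℂ] E.Fiber x := fun x => Fintype.linearCombination ℂ (e · x)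
  have hB : ∀ x (hx : x ∈ U) a, B x a = (he.toBasisAt hx).equivFun.symm a := by
    intro x hx a
    simp [B, Fintype.linearCombination_apply, Module.Basis.equivFun_symm_apply]
  let c : ∀ x, E.Fiber x →ₗ[ℂ] (Fin r → ℂ) := fun x =>
    if hx : x ∈ U then ((he.toBasisAt hx).equivFun : E.Fiber x →ₗ[ℂ] (Fin r → ℂ)) else 0
  have hc : ∀ x (hx : x ∈ U) v, c x v = (he.toBasisAt hx).equivFun v := by
    intro x hx v
    simp only [c, dif_pos hx]
    rfl
  have hc1 : ∀ x ∈ U, ∀ v, B x (c x v) = v := by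
    intro x hx v
    rw [hB x hx, hc x hx, LinearEquiv.symm_apply_apply]
  have hc2 : ∀ x ∈ U, ∀ a, c x (B x a) = a := by
    intro x hx a
    rw [hB x hx, hc x hx, LinearEquiv.apply_symm_apply]
  refine ⟨c, fun x hx v => (hc1 x hx v).symm, fun x hx a => hc2 x hx a, fun σ x hx hσ => ?_⟩
  have hi := E.mem_base_idx x
  set i := E.idx x
  let M : CP1 → (Fin r → ℂ) →L[ℂ] (Fin r → ℂ) := fun y =>
    LinearMap.toContinuousLinearMap ((E.toC i y) ∘ₗ B y)
  let N : CP1 → (Fin r → ℂ) →L[ℂ] (Fin r → ℂ) := fun y =>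
    LinearMap.toContinuousLinearMap (c y ∘ₗ (E.ofC i y))
  have hM : HolAt M x := by
    refine holAt_clm_of_columns fun k => ?_
    have h1 := (E.secAt_iff hi).1 (he.contMDiffAt hU hx k)
    refine h1.eventually_eq (Filter.Eventually.of_forall fun y => ?_)
    change E.toC i y (B y (Pi.single k 1)) = _
    congr 1
    simp [B, Fintype.linearCombination_apply, Pi.single_apply]
  have key : ∀ y ∈ U ∩ E.base i, (M y).comp (N y) = ContinuousLinearMap.id ℂ _ ∧
      (N y).comp (M y) = ContinuousLinearMap.id ℂ _ := by
    intro y hy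
    constructor <;> ext1 v
    · change E.toC i y (B y (c y (E.ofC i y v))) = v
      rw [hc1 y hy.1, E.toC_ofC hy.2]
    · change c y (E.ofC i y (E.toC i y (B y v))) = v
      rw [E.ofC_toC hy.2, hc2 y hy.1]
  have h3 : HolAt N x := holAt_of_inverse hM (Filter.mem_of_superset
    ((hU.inter (E.isOpen_base i)).mem_nhds ⟨hx, hi⟩) key)
  refine HolAt.eventually_eq (h3.clm_apply ((E.secAt_iff hi).1 hσ)) ?_
  filter_upwards [(hU.inter (E.isOpen_base i)).mem_nhds ⟨hx, hi⟩] with y hy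
  change c y (σ y) = c y (E.ofC i y (E.toC i y (σ y)))
  rw [E.ofC_toC hy.2]

/-- A family of sections given by an invertible matrix in a trivialization is a frame. -/
lemma isFrame_of_toC {E : HolBundle r} {e : Fin r → ∀ x, E.Fiber x} {U : Set CP1} (i : E.ι)
    (hU : U ⊆ E.base i) (hol : ∀ k, ∀ x ∈ U, HolAt (fun y => E.toC i y (e k y)) x)
    (li : ∀ x ∈ U, LinearIndependent ℂ fun k => E.toC i x (e k x)) : E.IsFrame e U where
  linearIndependent {x} hx := LinearIndependent.of_comp (E.toC i x) (li x hx)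
  generating {x} hx := by
    have h1 : LinearIndependent ℂ fun k => e k x := LinearIndependent.of_comp (E.toC i x) (li x hx)
    have : Module.finrank ℂ (E.Fiber x) = r := Module.finrank_fin_fun ℂ
    have : FiniteDimensional ℂ (E.Fiber x) :=
      inferInstanceAs (FiniteDimensional ℂ (Fin r → ℂ))
    exact (h1.span_eq_top_of_card_eq_finrank' (by simp [*])).ge
  contMDiffOn k x hx := ((E.secAt_iff (hU hx)).2 (hol k x hx)).contMDiffWithinAt

end HolBundle

/-! ### Factorization of bundle maps through Hecke modifications -/

namespace HolBundle

variable {r s : ℕ}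

/-- A holomorphic function that vanishes at `p` is divisible by a local coordinate. -/
lemma exists_holAt_smul {V : Type*} [NormedAddCommGroup V] [NormedSpace ℂ V] [CompleteSpace V]
    {ξ : OpenPartialHomeomorph CP1 ℂ} (hξ : IsCoordinate ξ) {p : CP1} (hp : p ∈ ξ.source)
    {f : CP1 → V} (hf : HolAt f p) (h0 : f p = 0) :
    ∃ κ : CP1 → V, HolAt κ p ∧ ∀ᶠ x in 𝓝 p, f x = (ξ x - ξ p) • κ x := by
  have ha := (CP1.holAt_iff_of_coordinate hξ hp).1 hf
  -- `dslope` is the difference quotient completed by the derivative, so it stays analytic at `ξ p`.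
  refine ⟨fun x => dslope (f ∘ ξ.symm) (ξ p) (ξ x), ?_, ?_⟩
  · rw [CP1.holAt_iff_of_coordinate hξ hp]
    obtain ⟨P, hP⟩ := ha
    have h1 : AnalyticAt ℂ (dslope (f ∘ ξ.symm) (ξ p)) (ξ p) :=
      ⟨_, hP.has_fpower_series_dslope_fslope⟩
    refine h1.congr ?_
    filter_upwards [ξ.open_target.mem_nhds (ξ.map_source hp)] with z hz
    simp [ξ.right_inv hz]
  · filter_upwards [ξ.open_source.mem_nhds hp] with x hx
    rw [sub_smul_dslope]
    simp [ξ.left_inv hx, ξ.left_inv hp, h0]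

/-- A bundle map whose image at `p` lies in the line of a Hecke modification at `p` factors through
the Hecke modification. -/
lemma IsHecke.exists_lift {E F : HolBundle 2} {G : HolBundle r} {α : Hom F E} {p : CP1}
    (hα : IsHecke α p) (β : Hom G E)
    (h : LinearMap.range (β.app p) ≤ LinearMap.range (α.app p)) :
    ∃ ψ : Hom G F, α.comp ψ = β := by
  obtain ⟨U, ξ, e, f, hU, hpU, hξ, hUξ, he, hf, H⟩ := hα.local_form
  obtain ⟨c, hc1, hc2, hc3⟩ := he.exists_coeff hU
  set i := G.idx p with hi_def
  have hi : p ∈ G.base i := G.mem_base_idx p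
  let C : CP1 → (Fin r → ℂ) →L[ℂ] (Fin 2 → ℂ) := fun x =>
    LinearMap.toContinuousLinearMap (c x ∘ₗ β.app x ∘ₗ G.ofC i x)
  have hC_apply : ∀ x v, C x v = c x (β.app x (G.ofC i x v)) := fun _ _ => rfl
  have hC : HolAt C p := holAt_clm_of_columns fun k =>
    hc3 _ p hpU (β.secAt (G.secAt_ofC hi (f := fun _ => Pi.single k 1) contMDiffAt_const))
  -- `L` is the component of `β` along `e 1`. In the frames `e`, `f` the map `α` is `diag(1, ξ - ξ
  -- p)`, so `α⁻¹ β` extends over `p` exactly when `L` is divisible by `ξ - ξ p`. The hypothesis on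
  -- ranges gives `L p = 0`, and `κ` is the quotient.
  let L : CP1 → (Fin r → ℂ) →L[ℂ] ℂ := fun x =>
    (ContinuousLinearMap.proj (R := ℂ) (φ := fun _ : Fin 2 => ℂ) 1).comp (C x)
  have hL : HolAt L p := hC.clm_comp ((ContinuousLinearMap.compL ℂ (Fin r → ℂ) (Fin 2 → ℂ) ℂ)
    (ContinuousLinearMap.proj (R := ℂ) (φ := fun _ : Fin 2 => ℂ) 1))
  have hα0 : ∀ x ∈ U, ∀ a b : ℂ, α.app x (a • f 0 x + b • f 1 x) =
      ∑ k, (![a, b * (ξ x - ξ p)] : Fin 2 → ℂ) k • e k x := by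
    intro x hx a b
    rw [map_add, map_smul, map_smul, (H x hx).1, (H x hx).2]
    simp [mul_smul]
  have hL0 : L p = 0 := by
    ext1 v
    change C p v 1 = 0
    rw [hC_apply]
    obtain ⟨w, hw⟩ := h ⟨G.ofC i p v, rfl⟩
    have hw2 : w = ∑ k, (hf.toBasisAt hpU).repr w k • f k p := by
      simpa using ((hf.toBasisAt hpU).sum_repr w).symm
    rw [Fin.sum_univ_two] at hw2
    rw [← hw, hw2, hα0 p hpU, hc2 p hpU]
    simp
  obtain ⟨κ, hκ, hκL⟩ := exists_holAt_smul hξ (hUξ hpU) hL hL0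
  classical
  -- Away from `p` the lift is forced to be `α⁻¹ β`; at `p` it is defined by the frame formula. By
  -- injectivity of `α` off `p` the frame formula is valid on a whole neighbourhood (`hA`), which
  -- gives holomorphy at `p`.
  let A : ∀ x, G.Fiber x →ₗ[ℂ] F.Fiber x := fun x =>
    if hx : x = p then
      ((LinearMap.proj 0 ∘ₗ c x ∘ₗ β.app x).smulRight (f 0 x) +
        ((κ x : (Fin r → ℂ) →ₗ[ℂ] ℂ) ∘ₗ G.toC i x).smulRight (f 1 x))
    else ((LinearEquiv.ofBijective (α.app x) (hα.bijective x hx)).symm : E.Fiber x →ₗ[ℂ] F.Fiber x)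
      ∘ₗ β.app x
  have hAne : ∀ x, x ≠ p → ∀ v, α.app x (A x v) = β.app x v := by
    intro x hx v
    simp only [A, dif_neg hx]
    exact (LinearEquiv.ofBijective (α.app x) (hα.bijective x hx)).apply_symm_apply _
  have hAp : ∀ v, A p v = C p (G.toC i p v) 0 • f 0 p + κ p (G.toC i p v) • f 1 p := by
    intro v
    rw [hC_apply, G.ofC_toC hi]
    simp only [A, dif_pos]
    rfl
  have hβ : ∀ᶠ x in 𝓝 p, ∀ v, β.app x v = α.app x
      (C x (G.toC i x v) 0 • f 0 x + κ x (G.toC i x v) • f 1 x) := by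
    filter_upwards [hκL, hU.mem_nhds hpU, (G.isOpen_base i).mem_nhds hi] with x hx hxU hxi v
    rw [hα0 x hxU]
    conv_lhs => rw [hc1 x hxU (β.app x v)]
    have h1 : c x (β.app x v) = C x (G.toC i x v) := by
      rw [hC_apply, G.ofC_toC hxi]
    have h2 : C x (G.toC i x v) 1 = κ x (G.toC i x v) * (ξ x - ξ p) := by
      have := DFunLike.congr_fun hx (G.toC i x v)
      rw [mul_comm]
      exact this
    rw [h1]
    simp [h2]
  have hA : ∀ᶠ x in 𝓝 p, ∀ v, A x v =
      C x (G.toC i x v) 0 • f 0 x + κ x (G.toC i x v) • f 1 x := by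
    filter_upwards [hβ] with x hx v
    by_cases hxp : x = p
    · subst hxp
      exact hAp v
    · exact (hα.bijective x hxp).1 ((hAne x hxp v).trans (hx v))
  have hAα : ∀ x v, α.app x (A x v) = β.app x v := by
    intro x v
    by_cases hxp : x = p
    · subst hxp
      rw [hAp, ← hβ.self_of_nhds]
    · exact hAne x hxp v
  refine ⟨Hom.ofLocal A fun x => ?_, Hom.ext fun x => LinearMap.ext fun v => hAα x v⟩
  by_cases hxp : x = p
  · subst hxp
    refine ⟨i, F.idx x, hi, F.mem_base_idx x, holAt_clm_of_columns fun k => ?_⟩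
    have hfs : ∀ k, HolAt (fun y => F.toC (F.idx x) y (f k y)) x := fun k =>
      (F.secAt_iff (F.mem_base_idx x)).1 (hf.contMDiffAt hU hpU k)
    have hC0 : HolAt (fun y => C y (Pi.single k 1) 0) x :=
      HolAt.clm_comp (ContinuousLinearMap.proj (R := ℂ) (φ := fun _ : Fin 2 => ℂ) 0)
        (hC.clm_apply (contMDiffAt_const (c := Pi.single k 1)))
    have hκ0 : HolAt (fun y => κ y (Pi.single k 1)) x := hκ.clm_apply contMDiffAt_const
    refine HolAt.eventually_eq ((hC0.smul (hfs 0)).add (hκ0.smul (hfs 1))) ?_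
    filter_upwards [hA, (G.isOpen_base i).mem_nhds hi] with y hy hyi
    rw [locMat_apply, hy, G.toC_ofC hyi, map_add, map_smul, map_smul]
    rfl
  · refine ⟨G.idx x, F.idx x, G.mem_base_idx x, F.mem_base_idx x, ?_⟩
    set j := F.idx x
    have hj : x ∈ F.base j := F.mem_base_idx x
    -- The value `0` at `p` is irrelevant, since `N` is used only near a point `x ≠ p`.
    let N : ∀ x, E.Fiber x →ₗ[ℂ] F.Fiber x := fun x => if hx : x = p then 0 else
      ((LinearEquiv.ofBijective (α.app x) (hα.bijective x hx)).symm : E.Fiber x →ₗ[ℂ] F.Fiber x)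
    have hN : HolAt (locMat N (E.idx x) j) x := by
      refine holAt_of_inverse (α.holAt_locMat hj (E.mem_base_idx x)) ?_
      filter_upwards [(E.isOpen_base _).mem_nhds (E.mem_base_idx x),
        (F.isOpen_base _).mem_nhds hj, isOpen_ne.mem_nhds hxp] with y hyE hyF hyp
      have hNy : N y = ((LinearEquiv.ofBijective (α.app y) (hα.bijective y hyp)).symm :
        E.Fiber y →ₗ[ℂ] F.Fiber y) := dif_neg hyp
      constructor <;> ext1 v <;>
        simp only [ContinuousLinearMap.comp_apply, locMat_apply, ContinuousLinearMap.id_apply, hNy]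
      · rw [F.ofC_toC hyF]
        exact (congrArg _ ((LinearEquiv.ofBijective (α.app y)
          (hα.bijective y hyp)).apply_symm_apply _)).trans (E.toC_ofC hyE v)
      · rw [E.ofC_toC hyE]
        exact (congrArg _ ((LinearEquiv.ofBijective (α.app y)
          (hα.bijective y hyp)).symm_apply_apply _)).trans (F.toC_ofC hyF v)
    refine HolAt.eventually_eq (ContMDiffAt.clm_comp hN (β.holAt_locMat (G.mem_base_idx x)
      (E.mem_base_idx x))) ?_
    filter_upwards [(E.isOpen_base _).mem_nhds (E.mem_base_idx x), isOpen_ne.mem_nhds hxp]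
      with y hyE hyp
    ext1 v
    simp only [ContinuousLinearMap.comp_apply, locMat_apply]
    rw [E.ofC_toC hyE]
    simp [N, A, hyp]

/-- Isomorphisms lift to Hecke modifications along corresponding lines. -/
lemma IsHecke.exists_iso {E E' F F' : HolBundle 2} {α : Hom F E} {α' : Hom F' E'} {p : CP1}
    (hα : IsHecke α p) (hα' : IsHecke α' p) (φ : Iso E E')
    (h : (LinearMap.range (α.app p)).map (φ.hom.app p) = LinearMap.range (α'.app p)) :
    ∃ ψ : Iso F F', φ.hom.comp α = α'.comp ψ.hom := by
  obtain ⟨ψ, hψ⟩ := hα'.exists_lift (φ.hom.comp α) (by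
    rw [← h, ← LinearMap.range_comp]
    rfl)
  obtain ⟨χ, hχ⟩ := hα.exists_lift (φ.symm.hom.comp α') (by
    have : LinearMap.range ((φ.symm.hom.comp α').app p) =
        (LinearMap.range (α'.app p)).map (φ.symm.hom.app p) := by
      rw [← LinearMap.range_comp]
      rfl
    rw [this, ← h, ← Submodule.map_comp]
    have h2 : (φ.symm.hom.app p).comp (φ.hom.app p) = LinearMap.id :=
      LinearMap.ext (φ.inv_hom_apply p)
    rw [h2, Submodule.map_id])
  have hψ' : ∀ x v, α'.app x (ψ.app x v) = φ.hom.app x (α.app x v) := fun x v =>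
    LinearMap.congr_fun (congrArg (fun f : Hom F E' => f.app x) hψ) v
  have hχ' : ∀ x v, α.app x (χ.app x v) = φ.inv.app x (α'.app x v) := fun x v =>
    LinearMap.congr_fun (congrArg (fun f : Hom F' E => f.app x) hχ) v
  -- The lifts of `φ` and of its inverse are mutually inverse off `p`, because `α` and `α'` are
  -- injective there; two bundle maps that agree off `p` agree.
  refine ⟨⟨ψ, χ, Hom.ext_of_ne p fun x hx => LinearMap.ext fun v => ?_,
    Hom.ext_of_ne p fun x hx => LinearMap.ext fun v => ?_⟩, hψ.symm⟩
  · apply (hα'.bijective x hx).1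
    change α'.app x (ψ.app x (χ.app x v)) = α'.app x v
    rw [hψ', hχ', φ.hom_inv_apply]
  · apply (hα.bijective x hx).1
    change α.app x (χ.app x (ψ.app x v)) = α.app x v
    rw [hχ', hψ', φ.inv_hom_apply]


/-! ### Construction of the Hecke modification with a given line -/

/-- The endomorphism that is the identity on the range of the projection `P` and multiplication by
`c` on its kernel. -/
def stretch (P : (Fin 2 → ℂ) →L[ℂ] (Fin 2 → ℂ)) (c : ℂ) : (Fin 2 → ℂ) →L[ℂ] (Fin 2 → ℂ) :=
  P + c • (ContinuousLinearMap.id ℂ _ - P)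

lemma stretch_apply (P : (Fin 2 → ℂ) →L[ℂ] (Fin 2 → ℂ)) (c : ℂ) (v : Fin 2 → ℂ) :
    stretch P c v = P v + c • (v - P v) := rfl

lemma stretch_one (P : (Fin 2 → ℂ) →L[ℂ] (Fin 2 → ℂ)) (v : Fin 2 → ℂ) : stretch P 1 v = v := by
  simp [stretch_apply]

lemma stretch_stretch {P : (Fin 2 → ℂ) →L[ℂ] (Fin 2 → ℂ)} (hP : ∀ v, P (P v) = P v) (c d : ℂ)
    (v : Fin 2 → ℂ) : stretch P c (stretch P d v) = stretch P (c * d) v := by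
  simp [stretch_apply, hP, mul_smul]

lemma holAt_stretch (P : (Fin 2 → ℂ) →L[ℂ] (Fin 2 → ℂ)) {c : CP1 → ℂ} {x : CP1}
    (hc : HolAt c x) : HolAt (fun y => stretch P (c y)) x :=
  contMDiffAt_const.add (hc.smul contMDiffAt_const)

section Hecke

variable (E : HolBundle 2) (p : CP1) (P : (Fin 2 → ℂ) →L[ℂ] (Fin 2 → ℂ))

/-- The local coordinate at `p` that vanishes at `p`. -/
def localParam (x : CP1) : ℂ := CP1.coord (CP1.chartIndex p) x - CP1.coord (CP1.chartIndex p) p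

lemma localParam_self : localParam p p = 0 := sub_self _

variable {p} in
lemma localParam_ne_zero {x : CP1} (hx : x ∈ CP1.chartSet (CP1.chartIndex p)) (hxp : x ≠ p) :
    localParam p x ≠ 0 := by
  intro h
  apply hxp
  rw [← CP1.ofCoord_coord _ x hx, sub_eq_zero.1 h,
    CP1.ofCoord_coord _ p (CP1.mem_chartSet_chartIndex p)]

variable {p} in
lemma holAt_localParam {x : CP1} (hx : x ∈ CP1.chartSet (CP1.chartIndex p)) :
    HolAt (localParam p) x := by
  rw [CP1.holAt_iff _ hx]
  refine (analyticAt_id.sub (analyticAt_const (v := CP1.coord (CP1.chartIndex p) p))).congr ?_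
  exact Filter.Eventually.of_forall fun z => by simp [localParam, CP1.coord_ofCoord]

/-- The domains of the trivializations of a Hecke modification: a neighbourhood of `p`, and the
domains of `E` without `p`. -/
def heckeBase : Option E.ι → Set CP1
  | none => E.base (E.idx p) ∩ CP1.chartSet (CP1.chartIndex p)
  | some i => E.base i \ {p}

/-- The trivialization of `E` that corresponds to a trivialization of a Hecke modification. -/
def heckeIdx : Option E.ι → E.ι
  | none => E.idx p
  | some i => i

/-- The factor by which a trivialization of a Hecke modification is stretched. -/
def heckeScale : Option E.ι → CP1 → ℂ
  | none => localParam p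
  | some _ => fun _ => 1

variable {E p} in
lemma heckeBase_subset {a : Option E.ι} {x : CP1} (hx : x ∈ heckeBase E p a) :
    x ∈ E.base (heckeIdx E p a) := by
  cases a
  · exact hx.1
  · exact hx.1

variable {E p} in
lemma heckeScale_ne_zero {a : Option E.ι} {x : CP1} (hx : x ∈ heckeBase E p a) (hxp : x ≠ p) :
    heckeScale E p a x ≠ 0 := by
  cases a
  · exact localParam_ne_zero hx.2 hxp
  · exact one_ne_zero

variable {E p} in
lemma holAt_heckeScale {a : Option E.ι} {x : CP1} (hx : x ∈ heckeBase E p a) :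
    HolAt (heckeScale E p a) x := by
  cases a
  · exact holAt_localParam hx.2
  · exact contMDiffAt_const

lemma isOpen_heckeBase (a : Option E.ι) : IsOpen (heckeBase E p a) := by
  cases a
  · exact (E.isOpen_base _).inter (CP1.isOpen_chartSet _)
  · exact (E.isOpen_base _).sdiff isClosed_singleton

open scoped Classical in
/-- The coordinate changes of a Hecke modification. -/
def heckeChange (a b : Option E.ι) (x : CP1) : (Fin 2 → ℂ) →L[ℂ] (Fin 2 → ℂ) :=
  -- The charts of the modification are those of `E` rescaled by `stretch`, and a coordinate change
  -- is the one of `E` conjugated accordingly. At `p` the scale of the chart `none` vanishes and the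
  -- conjugation has no meaning, but `none` is the only chart there and its self-change is the
  -- identity.
  if x = p then ContinuousLinearMap.id ℂ _ else
    (stretch P (heckeScale E p b x)⁻¹).comp
      ((E.core.coordChange (heckeIdx E p a) (heckeIdx E p b) x).comp
        (stretch P (heckeScale E p a x)))

variable {p} in
lemma heckeChange_of_ne {x : CP1} (hx : x ≠ p) (a b : Option E.ι) :
    heckeChange E p P a b x = (stretch P (heckeScale E p b x)⁻¹).comp
      ((E.core.coordChange (heckeIdx E p a) (heckeIdx E p b) x).comp
        (stretch P (heckeScale E p a x))) := if_neg hx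

lemma heckeChange_self_point (a b : Option E.ι) :
    heckeChange E p P a b p = ContinuousLinearMap.id ℂ _ := if_pos rfl

variable {P}

variable {E p} in
lemma heckeChange_self (hP : ∀ v, P (P v) = P v) {a : Option E.ι} {x : CP1}
    (hx : x ∈ heckeBase E p a) (v : Fin 2 → ℂ) : heckeChange E p P a a x v = v := by
  by_cases hxp : x = p
  · subst hxp
    rw [heckeChange_self_point]
    rfl
  · rw [heckeChange_of_ne E P hxp, ContinuousLinearMap.comp_apply, ContinuousLinearMap.comp_apply,
      E.core.coordChange_self _ x (heckeBase_subset hx), stretch_stretch hP,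
      inv_mul_cancel₀ (heckeScale_ne_zero hx hxp), stretch_one]

lemma contMDiffOn_heckeChange (hP : ∀ v, P (P v) = P v) (a b : Option E.ι) :
    ContMDiffOn 𝓘(ℂ) 𝓘(ℂ, (Fin 2 → ℂ) →L[ℂ] (Fin 2 → ℂ)) ω (heckeChange E p P a b)
      (heckeBase E p a ∩ heckeBase E p b) := by
  rintro x ⟨hxa, hxb⟩
  refine ContMDiffAt.contMDiffWithinAt ?_
  by_cases hxp : x = p
  · subst hxp
    cases a
    swap
    · exact absurd rfl hxa.2
    cases b
    swap
    · exact absurd rfl hxb.2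
    refine HolAt.eventually_eq (f := fun _ => ContinuousLinearMap.id ℂ _) contMDiffAt_const ?_
    filter_upwards [(isOpen_heckeBase E x none).mem_nhds hxa] with y hy
    ext1 v
    exact heckeChange_self hP hy v
  · have h1 := E.holAt_coordChange (heckeBase_subset hxa) (heckeBase_subset hxb)
    have h2 : HolAt (fun y => (heckeScale E p b y)⁻¹) x := by
      have h4 := holAt_heckeScale hxb
      rw [CP1.holAt_iff _ (CP1.mem_chartSet_chartIndex x)] at h4 ⊢
      refine h4.inv ?_
      rw [Function.comp_apply, CP1.ofCoord_coord _ _ (CP1.mem_chartSet_chartIndex x)]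
      exact heckeScale_ne_zero hxb hxp
    refine HolAt.eventually_eq (ContMDiffAt.clm_comp (holAt_stretch P h2)
      (ContMDiffAt.clm_comp h1 (holAt_stretch P (holAt_heckeScale hxa)))) ?_
    filter_upwards [isOpen_ne.mem_nhds hxp] with y hy
    exact heckeChange_of_ne E P hy a b

open scoped Classical in
/-- The Hecke modification of `E` at `p` along the range of the projection `P`. -/
def hecke (hP : ∀ v, P (P v) = P v) : HolBundle 2 where
  ι := Option E.ι
  core :=
    { baseSet := heckeBase E p
      isOpen_baseSet := isOpen_heckeBase E p
      indexAt := fun x => if x = p then none else some (E.idx x)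
      mem_baseSet_at := fun x => by
        split_ifs with h
        · subst h
          exact ⟨E.mem_base_idx x, CP1.mem_chartSet_chartIndex x⟩
        · exact ⟨E.mem_base_idx x, h⟩
      coordChange := heckeChange E p P
      coordChange_self := fun a x hx v => heckeChange_self hP hx v
      continuousOn_coordChange := fun a b => (contMDiffOn_heckeChange E p hP a b).continuousOn
      coordChange_comp := by
        rintro a b c x ⟨⟨ha, hb⟩, hc⟩ v
        by_cases hxp : x = p
        · subst hxp
          simp [heckeChange_self_point]
        · simp only [heckeChange_of_ne E P hxp, ContinuousLinearMap.comp_apply]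
          rw [stretch_stretch hP, mul_inv_cancel₀ (heckeScale_ne_zero hb hxp), stretch_one,
            E.core.coordChange_comp _ _ _ x
              ⟨⟨heckeBase_subset ha, heckeBase_subset hb⟩, heckeBase_subset hc⟩] }
  hol := ⟨contMDiffOn_heckeChange E p hP⟩

variable (P) in
open scoped Classical in
/-- The linear maps of the bundle map of a Hecke modification, in coordinates. -/
def heckeLin (x : CP1) : (Fin 2 → ℂ) →ₗ[ℂ] (Fin 2 → ℂ) :=
  -- Away from `p` the preferred chart is the one of `E`, so the map is the identity. At `p` the
  -- preferred chart is `none`, whose scale is zero there, and `stretch P 0 = P`.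
  if x = p then (P : (Fin 2 → ℂ) →ₗ[ℂ] (Fin 2 → ℂ)) else LinearMap.id

lemma heckeLin_self : heckeLin p P p = (P : (Fin 2 → ℂ) →ₗ[ℂ] (Fin 2 → ℂ)) := if_pos rfl

variable {p} in
lemma heckeLin_of_ne {x : CP1} (hx : x ≠ p) : heckeLin p P x = LinearMap.id := if_neg hx

/-- The linear maps of the bundle map of a Hecke modification. -/
def heckeApp (hP : ∀ v, P (P v) = P v) (x : CP1) : (hecke E p hP).Fiber x →ₗ[ℂ] E.Fiber x :=
  heckeLin p P x

variable {p} in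
lemma hecke_idx_ne (hP : ∀ v, P (P v) = P v) {x : CP1} (hx : x ≠ p) :
    (hecke E p hP).idx x = some (E.idx x) := if_neg hx

variable {E p} in
-- One matrix, holomorphic in `x`, describes the map at `p` and around it. Both the holomorphy of
-- the map and its local form are read off from it.
lemma toC_heckeApp (hP : ∀ v, P (P v) = P v) {a : Option E.ι} {x : CP1}
    (hx : x ∈ heckeBase E p a) (v : Fin 2 → ℂ) :
    heckeApp E p hP x ((hecke E p hP).ofC a x v) =
      E.ofC (heckeIdx E p a) x (stretch P (heckeScale E p a x) v) := by
  by_cases hxp : x = p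
  · subst hxp
    cases a
    swap
    · exact absurd rfl hx.2
    have h1 : (hecke E x hP).ofC none x v = v :=
      DFunLike.congr_fun (heckeChange_self_point E x P none _) v
    rw [h1]
    have h2 : heckeApp E x hP x v = P v := LinearMap.congr_fun (heckeLin_self x) v
    rw [h2]
    change P v = E.core.coordChange (E.idx x) (E.idx x) x (stretch P (localParam x x) v)
    rw [E.core.coordChange_self _ x (E.mem_base_idx x), localParam_self]
    simp [stretch_apply]
  · have h1 : (hecke E p hP).ofC a x v =
        E.ofC (heckeIdx E p a) x (stretch P (heckeScale E p a x) v) := by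
      have h0 : (hecke E p hP).ofC a x v = heckeChange E p P a (some (E.idx x)) x v :=
        congrArg (fun b => heckeChange E p P a b x v) (hecke_idx_ne E hP hxp)
      rw [h0, heckeChange_of_ne E P hxp]
      simp only [ContinuousLinearMap.comp_apply]
      have : (heckeScale E p (some (E.idx x)) x)⁻¹ = 1 := inv_one
      rw [this, stretch_one]
      rfl
    rw [h1]
    exact LinearMap.congr_fun (heckeLin_of_ne hxp) _

/-- The bundle map of a Hecke modification. -/
def heckeHom (hP : ∀ v, P (P v) = P v) : Hom (hecke E p hP) E :=
  Hom.ofLocal (heckeApp E p hP) fun x => by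
    have hx := (hecke E p hP).mem_base_idx x
    refine ⟨_, _, hx, heckeBase_subset hx, ?_⟩
    refine HolAt.eventually_eq (holAt_stretch P (holAt_heckeScale hx)) ?_
    filter_upwards [((hecke E p hP).isOpen_base _).mem_nhds hx] with y hy
    ext1 v
    rw [locMat_apply]
    rw [toC_heckeApp hP hy, E.toC_ofC (heckeBase_subset hy)]

lemma heckeHom_app_self (hP : ∀ v, P (P v) = P v) (v : Fin 2 → ℂ) :
    (heckeHom E p hP).app p v = P v := LinearMap.congr_fun (heckeLin_self p) v

end Hecke

/-- Hecke modifications with a given line exist. -/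
lemma exists_isHecke (E : HolBundle 2) (p : CP1) (l : ℙ ℂ (E.Fiber p)) :
    ∃ (F : HolBundle 2) (α : Hom F E), IsHecke α p ∧ LinearMap.range (α.app p) = l.submodule := by
  induction l using Projectivization.ind with
  | h u hu =>
    change Fin 2 → ℂ at u
    obtain ⟨k, hk⟩ : ∃ k, u k ≠ 0 := by
      by_contra h
      push Not at h
      exact hu (funext h)
    -- `P` projects onto the line of `u` along the kernel of the `k`-th coordinate, which does not
    -- vanish on `u`. The vector `w` below spans that kernel, and `u, w` is the basis in which the
    -- stretching becomes `diag(1, ξ - ξ p)`.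
    let P : (Fin 2 → ℂ) →L[ℂ] (Fin 2 → ℂ) :=
      ((u k)⁻¹ • ContinuousLinearMap.proj (R := ℂ) (φ := fun _ : Fin 2 => ℂ) k).smulRight u
    have hP_apply : ∀ v, P v = ((u k)⁻¹ * v k) • u := fun _ => rfl
    have hPu : P u = u := by rw [hP_apply, inv_mul_cancel₀ hk, one_smul]
    have hP : ∀ v, P (P v) = P v := fun v => by
      rw [hP_apply v, map_smul, hPu]
    let w : Fin 2 → ℂ := Pi.single (1 - k) 1
    have hwk : w k = 0 := by
      fin_cases k <;> simp [w]
    have hw1 : w (1 - k) = 1 := by simp [w]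
    have hPw : P w = 0 := by rw [hP_apply, hwk, mul_zero, zero_smul]
    let b : Fin 2 → Fin 2 → ℂ := ![u, w]
    have hb : LinearIndependent ℂ b := by
      rw [LinearIndependent.pair_iff]
      intro s t hst
      have h0 := congrFun hst k
      simp only [Pi.add_apply, Pi.smul_apply, smul_eq_mul, hwk, mul_zero, add_zero,
        Pi.zero_apply] at h0
      have hs : s = 0 := (mul_eq_zero.1 h0).resolve_right hk
      refine ⟨hs, ?_⟩
      have h1 := congrFun hst (1 - k)
      simpa [hs, hw1] using h1
    refine ⟨hecke E p hP, heckeHom E p hP, ⟨fun x hx => ?_, ?_⟩, ?_⟩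
    · change Function.Bijective (heckeLin p P x)
      rw [heckeLin_of_ne hx]
      exact Function.bijective_id
    · have hp : p ∈ heckeBase E p none := ⟨E.mem_base_idx p, CP1.mem_chartSet_chartIndex p⟩
      refine ⟨heckeBase E p none, CP1.chart (CP1.chartIndex p), fun k x => E.ofC (E.idx p) x (b k),
        fun k x => (hecke E p hP).ofC none x (b k), isOpen_heckeBase E p none, hp,
        CP1.chart_mem_maximalAtlas _, Set.inter_subset_right, ?_, ?_, fun x hx => ?_⟩
      · refine isFrame_of_toC (E.idx p) Set.inter_subset_left (fun k x hx => ?_) fun x hx => ?_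
        · exact (E.secAt_iff hx.1).1 (E.secAt_ofC hx.1 (f := fun _ => b k) contMDiffAt_const)
        · simpa only [E.toC_ofC hx.1] using hb
      · refine isFrame_of_toC (E := hecke E p hP) none subset_rfl (fun k x hx => ?_) fun x hx => ?_
        · exact ((hecke E p hP).secAt_iff hx).1
            ((hecke E p hP).secAt_ofC hx (f := fun _ => b k) contMDiffAt_const)
        · simpa only [(hecke E p hP).toC_ofC (i := none) hx] using hb
      · have h := toC_heckeApp (E := E) (p := p) hP hx
        constructor
        · refine (h u).trans ?_
          rw [stretch_apply, hPu, sub_self, smul_zero, add_zero]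
          rfl
        · refine (h w).trans ?_
          rw [stretch_apply, hPw, sub_zero, zero_add, map_smul]
          rfl
    · refine Eq.trans ?_ (Projectivization.submodule_mk (K := ℂ) (V := E.Fiber p) u hu).symm
      apply le_antisymm
      · rintro _ ⟨v, rfl⟩
        exact Submodule.mem_span_singleton.2 ⟨(u k)⁻¹ * v k, (heckeHom_app_self E p hP v).symm⟩
      · exact (Submodule.span_singleton_le_iff_mem _ _).2 ⟨u, (heckeHom_app_self E p hP u).trans hPu⟩

end HolBundle

/-! ### Sequences of Hecke modifications and their lines -/

/-- The line that is the image of a line under an injective linear map. -/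
lemma Projectivization.submodule_map_eq {V W : Type*} [AddCommGroup V] [Module ℂ V]
    [AddCommGroup W] [Module ℂ W] (f : V →ₗ[ℂ] W) (hf : Function.Injective f) (l : ℙ ℂ V) :
    (Projectivization.map f hf l).submodule = l.submodule.map f := by
  induction l using Projectivization.ind with
  | h v hv =>
    rw [Projectivization.map_mk, Projectivization.submodule_mk, Projectivization.submodule_mk,
      Submodule.map_span, Set.image_singleton]

namespace HolBundle

namespace HeckeSeq

variable {E E' : HolBundle 2} {n : ℕ}

/-- The points of a sequence without the first one. -/
def tailPoints (p : Fin (n + 1) ↪ CP1) : Fin n ↪ CP1 := (Fin.succEmb n).trans p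

/-- A Hecke modification of `E` followed by a sequence of Hecke modifications. -/
def cons {p : Fin (n + 1) ↪ CP1} {F : HolBundle 2} (α : Hom F E) (hα : IsHecke α (p 0))
    (s : HeckeSeq F (tailPoints p)) : HeckeSeq E p where
  tail := Fin.cons F s.tail
  map := fun i => Fin.cases (motive := fun i : Fin (n + 1) =>
    Hom (Fin.cons (α := fun _ => HolBundle 2) E (Fin.cons F s.tail) i.succ)
      (Fin.cons (α := fun _ => HolBundle 2) E (Fin.cons F s.tail) i.castSucc)) α s.map i
  isHecke := fun i => by
    induction i using Fin.cases with
    | zero => exact hα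
    | succ i => exact s.isHecke i

lemma cons_comp {p : Fin (n + 1) ↪ CP1} {F : HolBundle 2} (α : Hom F E) (hα : IsHecke α (p 0))
    (s : HeckeSeq F (tailPoints p)) (k : Fin (n + 1)) :
    (cons α hα s).comp k.succ = α.comp (s.comp k) := by
  induction k using Fin.induction with
  | zero => rfl
  | succ i ih =>
    change ((cons α hα s).comp i.castSucc.succ).comp (s.map i) =
      (α.comp (s.comp i.castSucc)).comp (s.map i)
    rw [ih]
    rfl

/-- Sequences of Hecke modifications with given lines exist. -/
lemma exists_direction_eq {p : Fin n ↪ CP1} (l : E.Parabolic p) :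
    ∃ s : HeckeSeq E p, s.direction = l := by
  induction n generalizing E with
  | zero => exact ⟨⟨fun i => i.elim0, fun i => i.elim0, fun i => i.elim0⟩, funext fun i => i.elim0⟩
  | succ n ih =>
    obtain ⟨F, α, hα, hl⟩ := exists_isHecke E (p 0) (l 0)
    have hb : ∀ i : Fin n, Function.Bijective (α.app (p i.succ)) := fun i =>
      hα.bijective _ fun h => Fin.succ_ne_zero i (p.injective h)
    let e : ∀ i : Fin n, F.Fiber (p i.succ) ≃ₗ[ℂ] E.Fiber (p i.succ) := fun i =>
      LinearEquiv.ofBijective _ (hb i)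
    -- The points are distinct, so `α` is an isomorphism over the remaining ones and the remaining
    -- lines can be transported to `F`.
    let l' : F.Parabolic (tailPoints p) := fun i =>
      Projectivization.map ((e i).symm : E.Fiber (p i.succ) →ₗ[ℂ] F.Fiber (p i.succ))
        (e i).symm.injective (l i.succ)
    obtain ⟨s, hs⟩ := ih l'
    refine ⟨cons α hα s, funext fun i => Projectivization.submodule_injective ?_⟩
    rw [submodule_direction]
    induction i using Fin.cases with
    | zero => exact hl
    | succ i =>
      have h0 : LinearMap.range (((cons α hα s).comp i.succ.succ).app (p i.succ)) =
          LinearMap.range ((α.comp (s.comp i.succ)).app (p i.succ)) := by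
        rw [cons_comp]
        rfl
      refine h0.trans ?_
      have h1 : LinearMap.range ((α.comp (s.comp i.succ)).app (p i.succ)) =
          (LinearMap.range ((s.comp i.succ).app (p i.succ))).map (α.app (p i.succ)) :=
        LinearMap.range_comp _ _
      have h2 : (s.direction i).submodule = LinearMap.range ((s.comp i.succ).app (p i.succ)) :=
        s.submodule_direction i
      rw [h1, ← h2, hs]
      have h3 : (l' i).submodule = (l i.succ).submodule.map
          ((e i).symm : E.Fiber (p i.succ) →ₗ[ℂ] F.Fiber (p i.succ)) :=
        Projectivization.submodule_map_eq _ _ _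
      rw [h3, ← Submodule.map_comp]
      have h4 : (α.app (p i.succ)).comp
          ((e i).symm : E.Fiber (p i.succ) →ₗ[ℂ] F.Fiber (p i.succ)) = LinearMap.id :=
        LinearMap.ext fun v => (e i).apply_symm_apply v
      rw [h4, Submodule.map_id]

/-- An isomorphism that matches the lines of two sequences of Hecke modifications extends to an
isomorphism of the sequences. -/
lemma extends_of_direction {p : Fin n ↪ CP1} (φ : Iso E E') (s : HeckeSeq E p) (s' : HeckeSeq E' p)
    (h : ∀ i, (s.direction i).submodule.map (φ.hom.app (p i)) = (s'.direction i).submodule) :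
    Extends φ s s' := by
  -- The lines live in `E` and `E'`, whereas the lifting problem lives in the intermediate bundles.
  -- Carrying the compatibility with the composed maps along the induction allows passing from one
  -- to the other.
  let P : Fin (n + 1) → Type := fun k =>
    {ψ : Iso (s.bundle k) (s'.bundle k) // (s'.comp k).comp ψ.hom = φ.hom.comp (s.comp k)}
  have step : ∀ (i : Fin n) (f : P i.castSucc), ∃ g : P i.succ,
      f.1.hom.comp (s.map i) = (s'.map i).comp g.1.hom := by
    rintro i ⟨f, hf⟩
    have hb := s'.comp_bijective i.castSucc (p i) fun j hj h => by
      have : i = j := p.injective h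
      subst this
      exact lt_irrefl _ hj
    obtain ⟨g, hg⟩ := (s.isHecke i).exists_iso (s'.isHecke i) f (by
      -- The point `p i` is none of the earlier points, so the composed map to `E'` is injective
      -- over it and the two lines may be compared in `E'`.
      apply Submodule.map_injective_of_injective hb.1
      have h1 := h i
      rw [submodule_direction, submodule_direction] at h1
      rw [← Submodule.map_comp, ← LinearMap.range_comp, ← LinearMap.range_comp]
      have h2 : LinearMap.range ((s'.comp i.succ).app (p i)) =
        LinearMap.range (((s'.comp i.castSucc).app (p i)).comp ((s'.map i).app (p i))) := rfl
      rw [← h2, ← h1, ← LinearMap.range_comp]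
      have h3 : ((s'.comp i.castSucc).app (p i)).comp (f.hom.app (p i)) =
          (φ.hom.app (p i)).comp ((s.comp i.castSucc).app (p i)) :=
        congrArg (fun g : Hom _ E' => g.app (p i)) hf
      rw [h3]
      rfl)
    refine ⟨⟨g, ?_⟩, hg⟩
    change (s'.comp i.castSucc).comp ((s'.map i).comp g.hom) =
      (φ.hom.comp (s.comp i.castSucc)).comp (s.map i)
    rw [← hg, ← hf]
    rfl
  choose step hstep using step
  let f : ∀ k, P k := fun k => Fin.induction (motive := P) ⟨φ, rfl⟩ step k
  exact ⟨fun k => (f k).1, rfl, fun i => hstep i (f i.castSucc)⟩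

/-- An isomorphism of bundles extends to sequences of Hecke modifications. -/
lemma exists_extends {p : Fin n ↪ CP1} (φ : Iso E E') (s : HeckeSeq E p) :
    ∃ s' : HeckeSeq E' p, Extends φ s s' := by
  have hφ : ∀ i, Function.Injective (φ.hom.app (p i)) := fun i v w hvw => by
    rw [← φ.inv_hom_apply _ v, hvw, φ.inv_hom_apply]
  obtain ⟨s', hs'⟩ := exists_direction_eq (E := E') (p := p) fun i =>
    Projectivization.map (φ.hom.app (p i)) (hφ i) (s.direction i)
  refine ⟨s', extends_of_direction φ s s' fun i => ?_⟩
  rw [hs', Projectivization.submodule_map_eq]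

/-- Isomorphic sequences have isomorphic last bundles. -/
lemma Extends.isHeckeLength {p : Fin n ↪ CP1} {φ : Iso E E'} {s : HeckeSeq E p}
    {s' : HeckeSeq E' p} (h : Extends φ s s') {k : ℕ} (hk : IsHeckeLength s.terminal k) :
    IsHeckeLength s'.terminal k := by
  obtain ⟨ψ, -, -⟩ := h
  obtain ⟨a, b, ⟨χ⟩, hab⟩ := hk
  exact ⟨a, b, ⟨(ψ (Fin.last n)).symm.trans χ⟩, hab⟩

end HeckeSeq

variable {E : HolBundle 2} {n : ℕ} {p : Fin n ↪ CP1}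

/-- At distinct points the lines can be prescribed freely, and matching lines make the identity of
`E` extend to an isomorphism of sequences. -/
lemma Htot.direction_bijective :
    Function.Bijective (Htot.direction : Htot E p → E.Parabolic p) := by
  constructor
  · rintro ⟨s⟩ ⟨s'⟩ h
    refine Quotient.sound (HeckeSeq.extends_of_direction _ s s' fun i => ?_)
    have h1 : s.direction = s'.direction := h
    rw [h1]
    exact Submodule.map_id _
  · intro l
    obtain ⟨s, hs⟩ := HeckeSeq.exists_direction_eq l
    exact ⟨Quotient.mk _ s, hs⟩

lemma Htot.lines_bijective : Function.Bijective (Htot.lines : Htot E p → Fin n → CP1) :=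
  Htot.direction_bijective

end HolBundle

/-! ### Divisors of vector-valued functions -/

section Divisor

variable {V : Type*} [NormedAddCommGroup V] [NormedSpace ℂ V]

/-- An entire function with a limit at infinity is constant. -/
lemma Differentiable.eq_of_tendsto_inv {H : ℂ → V} (hH : Differentiable ℂ H) {v : V}
    (h : Tendsto (fun w => H w⁻¹) (𝓝[≠] 0) (𝓝 v)) (z : ℂ) : H z = v := by
  refine hH.apply_eq_of_tendsto_cocompact z ?_
  rw [← Metric.cobounded_eq_cocompact]
  have := h.comp (tendsto_inv₀_cobounded' (α := ℂ))
  simpa [Function.comp_def] using this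

/-- Two local coordinates that vanish at the same point differ by a nonvanishing factor. -/
lemma exists_coordinate_factor {ξ η : OpenPartialHomeomorph CP1 ℂ}
    (hξ : HolBundle.IsCoordinate ξ) (hη : HolBundle.IsCoordinate η) {x : CP1} (hx : x ∈ ξ.source)
    (hx' : x ∈ η.source) :
    ∃ κ : CP1 → ℂ, HolAt κ x ∧ κ x ≠ 0 ∧ ∀ᶠ y in 𝓝 x, ξ y - ξ x = (η y - η x) * κ y := by
  have hol : ∀ {ζ : OpenPartialHomeomorph CP1 ℂ}, HolBundle.IsCoordinate ζ → x ∈ ζ.source →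
      HolAt (fun y => ζ y - ζ x) x := by
    intro ζ hζ hxζ
    exact ((contMDiffOn_of_mem_maximalAtlas hζ).contMDiffAt (ζ.open_source.mem_nhds hxζ)).sub
      contMDiffAt_const
  obtain ⟨κ, hκ, h1⟩ := HolBundle.exists_holAt_smul hη hx' (hol hξ hx) (sub_self _)
  obtain ⟨κ', hκ', h2⟩ := HolBundle.exists_holAt_smul hξ hx (hol hη hx') (sub_self _)
  refine ⟨κ, hκ, ?_, h1⟩
  -- Off `x` the two factorizations cancel to `κ κ' = 1`; continuity gives the same at `x`.
  have h3 : κ x * κ' x = 1 := by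
    have hc : ContinuousAt (fun y => κ y * κ' y) x := hκ.continuousAt.mul hκ'.continuousAt
    refine tendsto_nhds_unique (hc.mono_left (nhdsWithin_le_nhds (s := {x}ᶜ)))
      (tendsto_const_nhds.congr' ?_)
    filter_upwards [nhdsWithin_le_nhds h1, nhdsWithin_le_nhds h2, self_mem_nhdsWithin,
      nhdsWithin_le_nhds (ξ.open_source.mem_nhds hx)] with y hy1 hy2 hy hyξ
    have hne : ξ y - ξ x ≠ 0 := fun h => hy (ξ.injOn hyξ hx (sub_eq_zero.1 h))
    rw [smul_eq_mul] at hy1 hy2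
    rw [hy2] at hy1
    have h4 : (ξ y - ξ x) * (κ y * κ' y - 1) = 0 := by linear_combination -hy1
    have := (mul_eq_zero.1 h4).resolve_left hne
    exact (sub_eq_zero.1 this).symm
  exact fun h => by simp [h] at h3

lemma HolAt.inv₀ {f : CP1 → ℂ} {x : CP1} (hf : HolAt f x) (h : f x ≠ 0) :
    HolAt (fun y => (f y)⁻¹) x := by
  rw [CP1.holAt_iff _ (CP1.mem_chartSet_chartIndex x)] at hf ⊢
  refine hf.inv ?_
  rwa [Function.comp_apply, CP1.ofCoord_coord _ _ (CP1.mem_chartSet_chartIndex x)]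

lemma HolAt.zpow {f : CP1 → ℂ} {x : CP1} (hf : HolAt f x) (h : f x ≠ 0) (n : ℤ) :
    HolAt (fun y => f y ^ n) x := by
  rw [CP1.holAt_iff _ (CP1.mem_chartSet_chartIndex x)] at hf ⊢
  refine AnalyticAt.zpow hf ?_
  rwa [CP1.ofCoord_coord _ _ (CP1.mem_chartSet_chartIndex x)]

variable [CompleteSpace V]

/-- The expansion of a function near a point in terms of an affine coordinate. -/
lemma exists_affine_expansion {F : CP1 → V} {n : ℤ} {x : CP1} {ξ : OpenPartialHomeomorph CP1 ℂ}
    (hξ : HolBundle.IsCoordinate ξ) (hx : x ∈ ξ.source) {G : CP1 → V} (hG : HolAt G x)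
    (hGx : G x ≠ 0) (hF : ∀ᶠ y in 𝓝[≠] x, F y = (ξ y - ξ x) ^ n • G y) (i : Fin 2)
    (hi : x ∈ CP1.chartSet i) :
    ∃ g : ℂ → V, AnalyticAt ℂ g (CP1.coord i x) ∧ g (CP1.coord i x) ≠ 0 ∧
      (∃ c : ℂ, c ≠ 0 ∧ g (CP1.coord i x) = c • G x) ∧
      ∀ᶠ z in 𝓝[≠] (CP1.coord i x), F (CP1.ofCoord i z) = (z - CP1.coord i x) ^ n • g z := by
  obtain ⟨κ, hκ, hκ0, h⟩ := exists_coordinate_factor hξ (CP1.chart_mem_maximalAtlas i) hx hi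
  refine ⟨fun z => κ (CP1.ofCoord i z) ^ n • G (CP1.ofCoord i z), ?_, ?_, ?_, ?_⟩
  · exact (CP1.holAt_iff i hi).1 ((hκ.zpow hκ0 n).smul hG)
  · beta_reduce
    rw [CP1.ofCoord_coord i x hi]
    exact smul_ne_zero (zpow_ne_zero _ hκ0) hGx
  · beta_reduce
    rw [CP1.ofCoord_coord i x hi]
    exact ⟨_, zpow_ne_zero _ hκ0, rfl⟩
  · rw [eventually_nhdsWithin_iff] at hF ⊢
    rw [CP1.ofCoord_eventually i hi] at hF h
    filter_upwards [hF, h] with z hz hz' hne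
    have hne' : CP1.ofCoord i z ∈ ({x}ᶜ : Set CP1) := fun h0 => hne (by
      rw [Set.mem_singleton_iff, ← CP1.coord_ofCoord i z, Set.mem_singleton_iff.1 h0])
    rw [hz hne', hz', mul_zpow, mul_smul]
    have : CP1.chart i (CP1.ofCoord i z) = z := CP1.coord_ofCoord i z
    rw [this]
    rfl

/-- A vector-valued function with divisor `D`, that is of the form `(ξ - ξ x) ^ D x` times a
nonvanishing vector near every point `x`, has nonpositive degree; in degree `0` its direction is
constant. -/
theorem degree_nonpos_of_local {F : CP1 → V} (D : CP1 →₀ ℤ) (ξ : CP1 → OpenPartialHomeomorph CP1 ℂ)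
    (G : CP1 → CP1 → V) (hξ : ∀ x, HolBundle.IsCoordinate (ξ x)) (hx : ∀ x, x ∈ (ξ x).source)
    (hG : ∀ x, HolAt (G x) x) (hG0 : ∀ x, G x x ≠ 0)
    (hF : ∀ x, ∀ᶠ y in 𝓝[≠] x, F y = (ξ x y - ξ x x) ^ D x • G x y) :
    D.sum (fun _ m => m) ≤ 0 ∧
      (D.sum (fun _ m => m) = 0 → ∃ v : V, ∀ x, ∃ c : ℂ, G x x = c • v) := by
  classical
  have hexp := fun x i hi => exists_affine_expansion (hξ x) (hx x) (hG x) (hG0 x) (hF x) i hi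
  choose g hga hg0 hgc hgF using fun a : ℂ => hexp (CP1.ofCoord 0 a) 0 (CP1.ofCoord_mem 0 a)
  simp only [CP1.coord_ofCoord] at hga hg0 hgc hgF
  obtain ⟨k, hka, hk0, hkc, hkF⟩ := hexp CP1.infty 1 CP1.infty_mem
  simp only [CP1.coord_infty, sub_zero] at hka hk0 hkc hkF
  let E : ℂ → ℤ := fun a => D (CP1.ofCoord 0 a)
  let S : Finset ℂ := (D.support.erase CP1.infty).image (CP1.coord 0)
  have hS : ∀ a, a ∉ S → E a = 0 := by
    intro a ha
    by_contra h
    refine ha (Finset.mem_image.2 ⟨CP1.ofCoord 0 a, Finset.mem_erase.2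
      ⟨CP1.ofCoord_ne_infty a, Finsupp.mem_support_iff.2 h⟩, CP1.coord_ofCoord 0 a⟩)
  have hdeg : D.sum (fun _ m => m) = D CP1.infty + ∑ b ∈ S, E b := by
    have h1 : ∑ b ∈ S, E b = ∑ x ∈ D.support.erase CP1.infty, D x := by
      rw [Finset.sum_image]
      · refine Finset.sum_congr rfl fun x hx => ?_
        simp only [E]
        rw [CP1.ofCoord_coord 0 x (CP1.mem_chartSet_zero_iff.2 (Finset.ne_of_mem_erase hx))]
      · intro x hx y hy hxy
        rw [← CP1.ofCoord_coord 0 x (CP1.mem_chartSet_zero_iff.2 (Finset.ne_of_mem_erase hx)), hxy,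
          CP1.ofCoord_coord 0 y (CP1.mem_chartSet_zero_iff.2 (Finset.ne_of_mem_erase hy))]
    rw [h1, Finsupp.sum]
    by_cases h : CP1.infty ∈ D.support
    · rw [Finset.add_sum_erase _ _ h]
    · rw [Finset.erase_eq_of_notMem h, Finsupp.notMem_support_iff.1 h, zero_add]
  set d := D.sum (fun _ m => m)
  -- The rational factor removes all zeros and poles of `F` in the affine line. What remains is
  -- their total effect at infinity, a factor `w ^ d`.
  let H₀ : ℂ → V := fun z => (∏ b ∈ S, (z - b) ^ (-E b)) • F (CP1.ofCoord 0 z)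
  have hloc : ∀ a, ∃ h : ℂ → V, AnalyticAt ℂ h a ∧ h a ≠ 0 ∧ (∃ c : ℂ, c ≠ 0 ∧ h a = c • g a a) ∧
      ∀ᶠ z in 𝓝[≠] a, H₀ z = h z := by
    intro a
    have hne : ∏ b ∈ S.erase a, (a - b) ^ (-E b) ≠ 0 := by
      refine Finset.prod_ne_zero_iff.2 fun b hb => zpow_ne_zero _ (sub_ne_zero.2 ?_)
      exact (Finset.ne_of_mem_erase hb).symm
    refine ⟨fun z => (∏ b ∈ S.erase a, (z - b) ^ (-E b)) • g a z, ?_, smul_ne_zero hne (hg0 a),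
      ⟨_, hne, rfl⟩, ?_⟩
    · refine AnalyticAt.smul ?_ (hga a)
      refine Finset.analyticAt_fun_prod _ fun b hb => ?_
      exact AnalyticAt.zpow (analyticAt_id.sub analyticAt_const)
        (sub_ne_zero.2 (Finset.ne_of_mem_erase hb).symm)
    · filter_upwards [hgF a, self_mem_nhdsWithin] with z hz hza
      have hza' : z - a ≠ 0 := sub_ne_zero.2 hza
      have h1 : ∏ b ∈ S, (z - b) ^ (-E b) =
          (z - a) ^ (-E a) * ∏ b ∈ S.erase a, (z - b) ^ (-E b) := by
        by_cases ha : a ∈ S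
        · rw [Finset.mul_prod_erase _ (fun b => (z - b) ^ (-E b)) ha]
        · rw [Finset.erase_eq_of_notMem ha, hS a ha, neg_zero, zpow_zero, one_mul]
      simp only [H₀]
      rw [h1, hz, smul_smul, mul_right_comm, ← zpow_add₀ hza', neg_add_cancel, zpow_zero, one_mul]
  choose h ha h0 hc hH using hloc
  have hmer : MeromorphicOn H₀ Set.univ := fun a _ =>
    (ha a).meromorphicAt.congr ((hH a).mono fun _ h => h.symm)
  -- The hypotheses on `F` concern only punctured neighbourhoods, so `H₀` may have wrong values at
  -- isolated points. The normal form repairs them and is entire without zeros.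
  set H := toMeromorphicNFOn H₀ Set.univ
  have hNF : ∀ a, MeromorphicNFAt H a := fun a =>
    meromorphicNFOn_toMeromorphicNFOn H₀ Set.univ (Set.mem_univ a)
  have hord : ∀ a, meromorphicOrderAt H a = 0 := by
    intro a
    rw [meromorphicOrderAt_toMeromorphicNFOn hmer (Set.mem_univ a)]
    exact (meromorphicOrderAt_eq_int_iff (n := 0) (hmer a (Set.mem_univ a))).2
      ⟨h a, ha a, h0 a, by simpa using hH a⟩
  have hHa : ∀ a, AnalyticAt ℂ H a := fun a =>
    (hNF a).meromorphicOrderAt_nonneg_iff_analyticAt.1 (hord a).ge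
  have hHne : ∀ a, H a ≠ 0 := fun a => (hNF a).meromorphicOrderAt_eq_zero_iff.1 (hord a)
  have hHh : ∀ a, H a = h a a := by
    intro a
    refine tendsto_nhds_unique ((hHa a).continuousAt.mono_left (nhdsWithin_le_nhds (s := {a}ᶜ)))
      (((ha a).continuousAt.mono_left nhdsWithin_le_nhds).congr' ?_)
    filter_upwards [hmer.toMeromorphicNFOn_eq_self_on_nhdsNE (Set.mem_univ a), hH a] with z h1 h2
    rw [← h2]
    exact h1.symm
  have hd : Differentiable ℂ H := fun a => (hHa a).differentiableAt
  -- The factors come from `w⁻¹ - b = w⁻¹ (1 - b w)`; the powers of `w` split off here add up, with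
  -- the one from `F` at infinity, to the degree `d`.
  let K : ℂ → V := fun w => (∏ b ∈ S, (1 - b * w) ^ (-E b)) • k w
  have hKa : AnalyticAt ℂ K 0 := by
    refine AnalyticAt.smul (Finset.analyticAt_fun_prod _ fun b hb => AnalyticAt.zpow ?_ ?_) hka
    · exact analyticAt_const.sub (analyticAt_const.mul analyticAt_id)
    · simp
  have hK0 : K 0 = k 0 := by simp [K]
  have hinf : ∀ᶠ w in 𝓝[≠] (0 : ℂ), H w⁻¹ = w ^ d • K w := by
    have hF1 : ∀ᶠ w in 𝓝[≠] (0 : ℂ), H₀ w⁻¹ = w ^ d • K w := by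
      filter_upwards [hkF, self_mem_nhdsWithin] with w hw hw0
      have hw0' : w ≠ 0 := hw0
      simp only [H₀, K]
      rw [← CP1.ofCoord_one_eq hw0', hw, smul_smul, smul_smul]
      congr 1
      have h1 : ∀ b, (w⁻¹ - b) ^ (-E b) = w ^ (E b) * (1 - b * w) ^ (-E b) := by
        intro b
        have : w⁻¹ - b = w⁻¹ * (1 - b * w) := by field_simp
        rw [this, mul_zpow, inv_zpow, zpow_neg, inv_inv]
      rw [Finset.prod_congr rfl fun b _ => h1 b, Finset.prod_mul_distrib, hdeg, zpow_add₀ hw0']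
      have h2 : ∏ b ∈ S, w ^ E b = w ^ ∑ b ∈ S, E b := by
        induction S using Finset.induction_on with
        | empty => simp
        | insert b S hb ih => rw [Finset.prod_insert hb, Finset.sum_insert hb, zpow_add₀ hw0', ih]
      rw [h2]
      ring
    have hF2 := eventually_eventually_nhdsWithin.2 hF1
    filter_upwards [hF1, hF2, nhdsWithin_le_nhds hKa.eventually_analyticAt, self_mem_nhdsWithin]
      with w hw hw2 hw3 hw0
    have hw0' : w ≠ 0 := hw0
    rw [← hw]
    -- Equality at the point `w⁻¹` itself is needed. The formula holds around `w`, so `H₀` is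
    -- analytic at `w⁻¹`, and passing to the normal form does not change its value.
    refine (eventuallyEq_nhds_of_eventuallyEq_nhdsNE
      (hmer.toMeromorphicNFOn_eq_self_on_nhdsNE (Set.mem_univ _)) ?_).self_of_nhds
    have h3 : AnalyticAt ℂ H₀ w⁻¹ := by
      have h4 : AnalyticAt ℂ (fun z : ℂ => z⁻¹ ^ d • K z⁻¹) w⁻¹ := by
        have h5 : AnalyticAt ℂ (fun z : ℂ => z⁻¹) w⁻¹ := analyticAt_id.inv (inv_ne_zero hw0')
        refine AnalyticAt.smul (h5.zpow (by simpa using hw0')) ?_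
        exact AnalyticAt.fun_comp (by rwa [inv_inv]) h5
      refine h4.congr ?_
      have h6 : Tendsto (fun z : ℂ => z⁻¹) (𝓝 w⁻¹) (𝓝 w) := by
        simpa using (tendsto_inv₀ (inv_ne_zero hw0'))
      rw [nhdsWithin_eq_nhds.2 (isOpen_compl_singleton.mem_nhds hw0)] at hw2
      filter_upwards [h6.eventually hw2] with z hz
      rw [← hz, inv_inv]
    change toMeromorphicNFOn H₀ Set.univ w⁻¹ = _
    simp only [toMeromorphicNFOn, hmer, Set.mem_univ, dif_pos]
    rw [toMeromorphicNFAt_eq_self.2 h3.meromorphicNFAt]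
  have hKlim : Tendsto K (𝓝[≠] 0) (𝓝 (k 0)) := by
    rw [← hK0]
    exact hKa.continuousAt.mono_left nhdsWithin_le_nhds
  have hlim : 0 ≤ d → Tendsto (fun w => H w⁻¹) (𝓝[≠] 0) (𝓝 ((0 : ℂ) ^ d • k 0)) := by
    intro hd0
    have h1 : Tendsto (fun w : ℂ => w ^ d) (𝓝[≠] 0) (𝓝 (0 ^ d)) :=
      (continuousAt_zpow₀ 0 d (Or.inr hd0)).mono_left nhdsWithin_le_nhds
    exact (h1.smul hKlim).congr' (hinf.mono fun _ h => h.symm)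
  constructor
  -- For `d > 0` the entire function `H` tends to zero at infinity, hence vanishes identically,
  -- although it has no zeros.
  · by_contra hpos
    push Not at hpos
    have := hd.eq_of_tendsto_inv (hlim hpos.le) 0
    rw [zero_zpow _ hpos.ne', zero_smul] at this
    exact hHne 0 this
  · intro hd0
    -- For `d = 0` the function `H` is constant, and every `G x x` is a multiple of its value.
    have h1 : ∀ z, H z = k 0 := fun z => by
      have := hd.eq_of_tendsto_inv (hlim hd0.ge) z
      rwa [hd0, zpow_zero, one_smul] at this
    refine ⟨k 0, fun x => ?_⟩
    rcases CP1.cases_point x with rfl | ⟨a, rfl⟩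
    · obtain ⟨c, hc0, hc'⟩ := hkc
      exact ⟨c⁻¹, by rw [hc', inv_smul_smul₀ hc0]⟩
    · obtain ⟨c, hc0, hc1⟩ := hc a
      obtain ⟨c', hc0', hc1'⟩ := hgc a
      refine ⟨c'⁻¹ * c⁻¹, ?_⟩
      rw [← h1 a, hHh a, hc1, mul_smul, inv_smul_smul₀ hc0, hc1', inv_smul_smul₀ hc0']

end Divisor

/-! ### Degrees of line bundles and of line subbundles of the trivial bundle -/

namespace HolBundle

variable {r s : ℕ}

/-- In rank one, the determinant bundle has the same coordinates. -/
lemma det_toC (L : HolBundle 1) (i : L.ι) (x : CP1) (v : Fin 1 → ℂ) :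
    L.det.toC i x v = L.toC i x v := by
  change LinearMap.det (L.core.coordChange (L.idx x) i x : (Fin 1 → ℂ) →ₗ[ℂ] (Fin 1 → ℂ)) • v =
    L.core.coordChange (L.idx x) i x v
  set A := L.core.coordChange (L.idx x) i x
  have h : ∀ k, v k • (Pi.single 0 1 : Fin 1 → ℂ) = v := fun k => by
    ext l
    fin_cases l
    fin_cases k
    simp
  rw [← LinearMap.det_toMatrix', Matrix.det_fin_one, LinearMap.toMatrix'_apply]
  conv_rhs => rw [← h 0, map_smul]
  ext l
  fin_cases l
  simp [mul_comm]

lemma holAt_toC_of_det {L : HolBundle 1} {σ : CP1 → Fin 1 → ℂ} {x : CP1} {i : L.ι}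
    (h : HolAt (fun y => L.det.toC i y (σ y)) x) : HolAt (fun y => L.toC i y (σ y)) x :=
  h.eventually_eq (Filter.Eventually.of_forall fun y => (det_toC L _ y (σ y)).symm)

lemma split_coordChange (a : Fin r → ℤ) (i j : Fin 2) (x : CP1) (v : Fin r → ℂ) (k : Fin r) :
    (split a).core.coordChange i j x v k = CP1.coord 1 x ^ (a k * ((j : ℤ) - (i : ℤ))) * v k := rfl

lemma OO_zero_toC (i : Fin 2) (x : CP1) (v : Fin 2 → ℂ) : (OO 0 0).toC i x v = v := by
  funext k
  refine (split_coordChange ![0, 0] _ i x v k).trans ?_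
  fin_cases k <;> simp

lemma O_zero_toC (i : Fin 2) (x : CP1) (v : Fin 1 → ℂ) : (O 0).toC i x v = v := by
  funext k
  refine (split_coordChange ![0] _ i x v k).trans ?_
  fin_cases k
  simp

lemma OO_zero_ofC (i : Fin 2) (x : CP1) (v : Fin 2 → ℂ) : (OO 0 0).ofC i x v = v := by
  funext k
  refine (split_coordChange ![0, 0] i _ x v k).trans ?_
  fin_cases k <;> simp

lemma OO_zero_det_toC (i : Fin 2) (x : CP1) (v : Fin 1 → ℂ) : (OO 0 0).det.toC i x v = v := by
  have h : (((OO 0 0).core.coordChange ((OO 0 0).idx x) i x : (Fin 2 → ℂ) →L[ℂ] (Fin 2 → ℂ)) :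
        (Fin 2 → ℂ) →ₗ[ℂ] (Fin 2 → ℂ)) = LinearMap.id :=
    LinearMap.ext fun v => OO_zero_toC i x v
  change LinearMap.det (((OO 0 0).core.coordChange ((OO 0 0).idx x) i x :
    (Fin 2 → ℂ) →L[ℂ] (Fin 2 → ℂ)) : (Fin 2 → ℂ) →ₗ[ℂ] (Fin 2 → ℂ)) • v = v
  rw [h, LinearMap.det_id, one_smul]

lemma linearIndependent_fin_one {V : Type*} [AddCommGroup V] [Module ℂ V] {v : Fin 1 → V}
    (h : v 0 ≠ 0) : LinearIndependent ℂ v := by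
  rw [linearIndependent_unique_iff]
  exact h

/-- A line bundle with a nowhere vanishing section has degree zero. -/
lemma isDegree_zero_of_hasTrivialDet {E : HolBundle r} (h : E.HasTrivialDet) : E.IsDegree 0 := by
  obtain ⟨φ⟩ := h
  let s₀ : ∀ x, (O 0).Fiber x := fun _ => (fun _ => 1 : Fin 1 → ℂ)
  have hs₀ : ∀ x, (O 0).SecAt s₀ x := fun x => by
    rw [(O 0).secAt_iff ((O 0).mem_base_idx x)]
    refine HolAt.eventually_eq (f := fun _ => (fun _ => 1 : Fin 1 → ℂ)) contMDiffAt_const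
      (Filter.Eventually.of_forall fun y => O_zero_toC _ y _)
  have hs₀' : ∀ x, s₀ x ≠ 0 := fun x h => one_ne_zero (α := ℂ) (congrFun h (0 : Fin 1))
  let s : ∀ x, E.det.Fiber x := fun x => φ.inv.app x (s₀ x)
  have hs : ∀ x, E.det.SecAt s x := fun x => φ.inv.secAt (hs₀ x)
  have hs' : ∀ x, s x ≠ 0 := fun x h => hs₀' x (by
    rw [← φ.hom_inv_apply x (s₀ x)]
    exact (congrArg _ h).trans (map_zero _))
  refine ⟨0, s, fun x => ⟨E.det.base (E.det.idx x) ∩ CP1.chartSet (CP1.chartIndex x),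
    CP1.chart (CP1.chartIndex x), s, (E.det.isOpen_base _).inter (CP1.isOpen_chartSet _),
    ⟨E.det.mem_base_idx x, CP1.mem_chartSet_chartIndex x⟩, CP1.chart_mem_maximalAtlas _,
    Set.inter_subset_right, ?_, fun y _ _ => ?_⟩, by simp⟩
  · refine isFrame_of_toC (E.det.idx x) Set.inter_subset_left (fun _ y hy => ?_) fun y hy => ?_
    · exact (E.det.secAt_iff hy.1).1 (hs y)
    · refine linearIndependent_fin_one fun h => hs' y (E.det.toC_injective hy.1 ?_)
      rw [h, map_zero]
  · simp

/-- The degree of `O(n)` is `n`. -/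
lemma isDegree_O (n : ℤ) : (O n).IsDegree n := by
  let L := (O n).det
  have hbase : ∀ i : Fin 2, L.base i = CP1.chartSet i := fun _ => rfl
  let e : Fin 2 → ∀ x, L.Fiber x := fun i x => L.ofC i x (fun _ => 1 : Fin 1 → ℂ)
  have he : ∀ i : Fin 2, L.IsFrame (fun _ => e i) (CP1.chartSet i) := fun i => by
    refine isFrame_of_toC (E := L) i subset_rfl (fun _ y hy => ?_) fun y hy => ?_
    · exact (L.secAt_iff hy).1
        (L.secAt_ofC hy (f := fun _ => (fun _ => 1 : Fin 1 → ℂ)) contMDiffAt_const)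
    · refine linearIndependent_fin_one fun h => ?_
      have h2 : L.toC i y (e i y) = fun _ => 1 := L.toC_ofC hy _
      rw [h2] at h
      exact one_ne_zero (α := ℂ) (congrFun h (0 : Fin 1))
  have hw : ∀ y ∈ CP1.chartSet 0, ∀ hy : y ∈ CP1.chartSet 1,
      e 0 y = (CP1.coord 1 y) ^ n • e 1 y := by
    intro y hy0 hy1
    apply L.toC_injective (i := (1 : Fin 2)) hy1
    have h1 : L.toC (1 : Fin 2) y (e 1 y) = fun _ => 1 := L.toC_ofC (i := (1 : Fin 2)) hy1 _
    rw [map_smul, h1]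
    have h2 : e 0 y = (O n).ofC (0 : Fin 2) y (fun _ => 1) := by
      apply L.toC_injective (i := (0 : Fin 2)) hy0
      have h3 : L.toC (0 : Fin 2) y (e 0 y) = fun _ => 1 := L.toC_ofC (i := (0 : Fin 2)) hy0 _
      rw [h3]
      exact (((O n).det_toC (0 : Fin 2) y _).trans ((O n).toC_ofC (i := (0 : Fin 2)) hy0 _)).symm
    rw [h2]
    refine ((O n).det_toC (1 : Fin 2) y _).trans (((O n).toC_ofC' (i := (0 : Fin 2))
      (j := (1 : Fin 2)) hy0 hy1 _).trans ?_)
    funext k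
    refine (split_coordChange ![n] 0 1 y _ k).trans ?_
    fin_cases k
    simp
  -- The frame `e 0` over the affine line equals `w ^ n` times the frame `e 1` near infinity, so its
  -- divisor is `n` times the point at infinity.
  refine ⟨Finsupp.single CP1.infty n, e 0, fun x => ?_, by simp⟩
  rcases CP1.cases_point x with rfl | ⟨z, rfl⟩
  · refine ⟨CP1.chartSet 1, CP1.chart 1, e 1, CP1.isOpen_chartSet 1, CP1.infty_mem,
      CP1.chart_mem_maximalAtlas 1, subset_rfl, he 1, fun y hy hne => ?_⟩
    rw [hw y (CP1.mem_chartSet_zero_iff.2 hne) hy, Finsupp.single_eq_same]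
    have h1 : CP1.chart 1 y - CP1.chart 1 CP1.infty = CP1.coord 1 y := by
      change CP1.coord 1 y - CP1.coord 1 CP1.infty = _
      rw [CP1.coord_infty, sub_zero]
    rw [h1]
  · refine ⟨CP1.chartSet 0, CP1.chart 0, e 0, CP1.isOpen_chartSet 0, CP1.ofCoord_mem 0 z,
      CP1.chart_mem_maximalAtlas 0, subset_rfl, he 0, fun y hy hne => ?_⟩
    rw [Finsupp.single_eq_of_ne (CP1.ofCoord_ne_infty z), zpow_zero, one_smul]

lemma exists_smul_eq_of_ne_zero {L : HolBundle 1} {x : CP1} {e : L.Fiber x} (he : e ≠ 0)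
    (u : L.Fiber x) : ∃ b : ℂ, u = b • e := by
  have h : ∀ e u : Fin 1 → ℂ, e ≠ 0 → ∃ b : ℂ, u = b • e := fun e u he => by
    have h1 : e 0 ≠ 0 := fun h => he (funext fun k => by
      fin_cases k
      exact h)
    refine ⟨u 0 / e 0, funext fun k => ?_⟩
    fin_cases k
    exact (div_mul_cancel₀ _ h1).symm
  exact h e u he

/-- Line subbundles of the trivial bundle have nonpositive degree, and those of degree zero are
constant. -/
lemma degree_subbundle_OO_zero {L : HolBundle 1} (f : Hom L (OO 0 0))
    (hf : ∀ x, Function.Injective (f.app x)) {d : ℤ} (hd : L.IsDegree d) :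
    d ≤ 0 ∧ (d = 0 → ∃ v : Fin 2 → ℂ, ∀ x u, ∃ c : ℂ, (f.app x u : Fin 2 → ℂ) = c • v) := by
  obtain ⟨D, s, H, rfl⟩ := hd
  choose U ξ e hU hx hξ hUξ he hs using H
  -- Because `f` is injective on fibres, it maps the meromorphic section `s` to a `ℂ²`-valued
  -- function with the same divisor, to which `degree_nonpos_of_local` applies.
  let F : CP1 → Fin 2 → ℂ := fun y => f.app y (s y)
  let G : CP1 → CP1 → Fin 2 → ℂ := fun x y => f.app y (e x y)
  have hene : ∀ x, ∀ y ∈ U x, e x y ≠ 0 := fun x y hy => ((he x).linearIndependent hy).ne_zero 0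
  have hmain := degree_nonpos_of_local (F := F) D ξ G hξ (fun x => hUξ x (hx x)) (fun x => ?_)
    (fun x h => ?_) fun x => ?_
  · refine ⟨hmain.1, fun h => ?_⟩
    obtain ⟨v, hv⟩ := hmain.2 h
    refine ⟨v, fun x u => ?_⟩
    obtain ⟨c, hc⟩ := hv x
    obtain ⟨b, rfl⟩ := exists_smul_eq_of_ne_zero (L := L) (hene x x (hx x)) u
    have h2 : (f.app x (b • (e x x : L.Fiber x)) : Fin 2 → ℂ) = b • G x x :=
      (f.app x).map_smul b (e x x)
    exact ⟨b * c, h2.trans ((congrArg (b • ·) hc).trans (mul_smul b c v).symm)⟩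
  · have h1 : L.det.SecAt (e x) x := (he x).contMDiffAt (hU x) (hx x) 0
    have h1' : HolAt (fun y => L.det.toC (L.idx x) y (e x y)) x :=
      (L.det.secAt_iff (i := L.idx x) (L.mem_base_idx x)).1 h1
    have h2 := f.secAt ((L.secAt_iff (σ := e x) (L.mem_base_idx x)).2 (holAt_toC_of_det h1'))
    rw [(OO 0 0).secAt_iff ((OO 0 0).mem_base_idx x)] at h2
    exact h2.eventually_eq (Filter.Eventually.of_forall fun y => (OO_zero_toC _ y _).symm)
  · exact hene x x (hx x) (hf x (h.trans (map_zero (f.app x)).symm))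
  · filter_upwards [self_mem_nhdsWithin, nhdsWithin_le_nhds ((hU x).mem_nhds (hx x))] with y hy hyU
    have h1 := hs x y hyU hy
    change f.app y (s y) = _ • f.app y (e x y)
    exact (congrArg (f.app y) h1).trans (map_smul (f.app y) _ _)

/-- The degree of the trivial bundle is nonnegative. -/
lemma degree_OO_zero_nonneg {d : ℤ} (hd : (OO 0 0).IsDegree d) : 0 ≤ d := by
  obtain ⟨D, s, H, rfl⟩ := hd
  choose U ξ e hU hx hξ hUξ he hs using H
  -- A section of the trivial determinant bundle is a function; its inverse has divisor `-D`. The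
  -- bound `deg (-D) ≤ 0` suffices, since stability only needs a lower bound for every integer that
  -- is a degree of the bundle.
  let F : CP1 → ℂ := fun y => ((s y : Fin 1 → ℂ) 0)⁻¹
  let G : CP1 → CP1 → ℂ := fun x y => ((e x y : Fin 1 → ℂ) 0)⁻¹
  have hene : ∀ x, ∀ y ∈ U x, (e x y : Fin 1 → ℂ) 0 ≠ 0 := fun x y hy h =>
    ((he x).linearIndependent hy).ne_zero 0 (funext fun k => by
      fin_cases k
      exact h)
  have hmain := degree_nonpos_of_local (F := F) (-D) ξ G hξ (fun x => hUξ x (hx x)) (fun x => ?_)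
    (fun x => inv_ne_zero (hene x x (hx x))) fun x => ?_
  · have h1 : (-D).sum (fun _ m => m) = -D.sum (fun _ m => m) := by
      rw [Finsupp.sum, Finsupp.sum, Finsupp.support_neg]
      simp
    have := hmain.1
    rw [h1] at this
    omega
  · have h1 : (OO 0 0).det.SecAt (e x) x := (he x).contMDiffAt (hU x) (hx x) 0
    rw [(OO 0 0).det.secAt_iff ((OO 0 0).det.mem_base_idx x)] at h1
    have h2 : HolAt (fun y => (e x y : Fin 1 → ℂ)) x :=
      h1.eventually_eq (Filter.Eventually.of_forall fun y => (OO_zero_det_toC _ y _).symm)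
    exact HolAt.inv₀ (HolAt.clm_comp (ContinuousLinearMap.proj (R := ℂ)
      (φ := fun _ : Fin 1 => ℂ) 0) h2) (hene x x (hx x))
  · filter_upwards [self_mem_nhdsWithin, nhdsWithin_le_nhds ((hU x).mem_nhds (hx x))] with y hy hyU
    have h1 : (s y : Fin 1 → ℂ) 0 = (ξ x y - ξ x x) ^ D x * (e x y : Fin 1 → ℂ) 0 :=
      congrFun (hs x y hyU hy) 0
    simp only [F, G, h1, Finsupp.neg_apply, zpow_neg, mul_inv, smul_eq_mul]

/-- A bundle map from a sum of line bundles, given by sections with prescribed behaviour at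
infinity. -/
lemma exists_hom_split {E : HolBundle s} (a : Fin r → ℤ) (σ t : Fin r → ∀ x, E.Fiber x)
    (hσ : ∀ k x, x ≠ CP1.infty → E.SecAt (σ k) x) (ht : ∀ k, E.SecAt (t k) CP1.infty)
    (hσt : ∀ k, ∀ᶠ x in 𝓝[≠] CP1.infty, σ k x = CP1.coord 1 x ^ a k • t k x) :
    ∃ f : Hom (split a) E, (∀ x, x ≠ CP1.infty → ∀ v : Fin r → ℂ, f.app x v = ∑ k, v k • σ k x) ∧
      ∀ v : Fin r → ℂ, f.app CP1.infty v = ∑ k, v k • t k CP1.infty := by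
  classical
  -- The basis vectors of the chart at infinity are `w ^ (-a k)` times those of the affine chart, so
  -- sending the affine ones to `σ k` forces the others to go to `t k`.
  let τ : Fin r → ∀ x, E.Fiber x := fun k x => if x = CP1.infty then t k x else σ k x
  have hτ : ∀ k x, x ≠ CP1.infty → τ k x = σ k x := fun k x hx => if_neg hx
  have hτ' : ∀ k, τ k CP1.infty = t k CP1.infty := fun k => if_pos rfl
  let A : ∀ x, (split a).Fiber x →ₗ[ℂ] E.Fiber x := fun x =>
    (Fintype.linearCombination ℂ (τ · x) : (Fin r → ℂ) →ₗ[ℂ] E.Fiber x)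
  have hA : ∀ x, ∀ v : Fin r → ℂ, A x v = ∑ k, v k • τ k x := fun x v =>
    Fintype.linearCombination_apply ℂ (τ · x) v
  have hA1 : ∀ x k, ∀ c : ℂ, A x (fun l => c * (Pi.single k 1 : Fin r → ℂ) l) = c • τ k x := by
    intro x k c
    rw [hA]
    simp [Pi.single_apply]
  have hofC : ∀ (i : Fin 2) (x : CP1) (k : Fin r), ((split a).ofC i x (Pi.single k 1) : Fin r → ℂ) =
      fun l => CP1.coord 1 x ^ (a k * ((CP1.chartIndex x : ℤ) - (i : ℤ))) *
        (Pi.single k 1 : Fin r → ℂ) l := by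
    intro i x k
    funext l
    refine (split_coordChange a i _ x _ l).trans ?_
    by_cases h : l = k
    · subst h
      rfl
    · simp [h]
  refine ⟨Hom.ofLocal A fun x => ?_, fun x hx v => ?_, fun v => ?_⟩
  · rcases CP1.cases_point x with rfl | ⟨z, rfl⟩
    · refine ⟨(1 : Fin 2), E.idx CP1.infty, CP1.infty_mem, E.mem_base_idx _,
        holAt_clm_of_columns fun k => ?_⟩
      refine HolAt.eventually_eq ((E.secAt_iff (E.mem_base_idx _)).1 (ht k)) ?_
      have h1 := hσt k
      rw [eventually_nhdsWithin_iff] at h1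
      filter_upwards [h1, (CP1.isOpen_chartSet 1).mem_nhds CP1.infty_mem] with y hy hy1
      refine congrArg (E.toC _ y) (?_ : A y ((split a).ofC (1 : Fin 2) y (Pi.single k 1)) = _)
      refine (congrArg (A y) (hofC 1 y k)).trans ((hA1 y k _).trans ?_)
      by_cases hyi : y = CP1.infty
      · subst hyi
        rw [hτ', CP1.chartIndex_infty]
        simp
      · have hw : CP1.coord 1 y ≠ 0 := fun h => by
          have := CP1.coord_mul_coord (i := 0) (j := 1) (by decide) y
            (CP1.mem_chartSet_zero_iff.2 hyi) hy1
          simp [h] at this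
        have hc : CP1.chartIndex y = 0 := if_pos (CP1.mem_chartSet_zero_iff.2 hyi)
        rw [hτ k y hyi, hy hyi, hc, smul_smul, ← zpow_add₀ hw]
        simp
    · refine ⟨(0 : Fin 2), E.idx _, CP1.ofCoord_mem 0 z, E.mem_base_idx _,
        holAt_clm_of_columns fun k => ?_⟩
      refine HolAt.eventually_eq ((E.secAt_iff (E.mem_base_idx _)).1
        (hσ k _ (CP1.ofCoord_ne_infty z))) ?_
      filter_upwards [(CP1.isOpen_chartSet 0).mem_nhds (CP1.ofCoord_mem 0 z)] with y hy
      refine congrArg (E.toC _ y) (?_ : A y ((split a).ofC (0 : Fin 2) y (Pi.single k 1)) = _)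
      refine (congrArg (A y) (hofC 0 y k)).trans ((hA1 y k _).trans ?_)
      have hc : CP1.chartIndex y = 0 := if_pos hy
      rw [hτ k y (CP1.mem_chartSet_zero_iff.1 hy), hc]
      simp
  · refine (hA x v).trans (Finset.sum_congr rfl fun k _ => ?_)
    rw [hτ k x hx]
  · refine (hA _ v).trans (Finset.sum_congr rfl fun k _ => ?_)
    rw [hτ']

end HolBundle

/-! ### The Cauchy transform of bounded densities with bounded support -/

section CauchyTransform

open MeasureTheory Metric

/-- In polar coordinates the area element contributes a factor `y`, and `y ^ (-1/2)` is integrable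
near `0`. -/
lemma integrable_norm_rpow_indicator :
    Integrable (fun x : ℂ => (Set.Iio (1 : ℝ)).indicator (fun y => y ^ (-(3 / 2) : ℝ)) ‖x‖) := by
  refine (integrable_fun_norm_addHaar (E := ℂ) volume
    (f := (Set.Iio (1 : ℝ)).indicator (fun y => y ^ (-(3 / 2) : ℝ)))).2 ?_
  have h1 : IntegrableOn (fun y : ℝ => y ^ (-(1 / 2) : ℝ)) (Set.Ioo 0 1) :=
    (intervalIntegral.integrableOn_Ioo_rpow_iff one_pos).2 (by norm_num)
  rw [Complex.finrank_real_complex]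
  rw [← integrable_indicator_iff measurableSet_Ioo] at h1
  rw [← integrable_indicator_iff measurableSet_Ioi]
  refine h1.congr (Filter.Eventually.of_forall fun y => ?_)
  by_cases h0 : 0 < y
  · by_cases h : y < 1
    · simp only [Set.indicator, Set.mem_Ioo, Set.mem_Ioi, Set.mem_Iio, h0, h, and_self, if_true]
      rw [smul_eq_mul, show (-(1 / 2) : ℝ) = 1 + -(3 / 2) by norm_num, Real.rpow_add h0]
      simp
    · simp [Set.indicator, h0, h]
  · simp [Set.indicator, h0]

lemma rpow_le_indicator_add_one (x : ℂ) : ‖x‖ ^ (-(3 / 2) : ℝ) ≤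
    (Set.Iio (1 : ℝ)).indicator (fun y => y ^ (-(3 / 2) : ℝ)) ‖x‖ + 1 := by
  by_cases h : ‖x‖ < 1
  · simp [Set.indicator, h]
  · simp only [Set.indicator, Set.mem_Iio, h, if_false, zero_add]
    exact Real.rpow_le_one_of_one_le_of_nonpos (not_lt.1 h) (by norm_num)

/-- The kernel is at most a translate of an integrable function plus `1`. By translation invariance
the resulting bound does not depend on `z`. -/
lemma exists_kernel_bound (R : ℝ) : ∃ c : ℝ, 0 ≤ c ∧ ∀ z : ℂ,
    IntegrableOn (fun w : ℂ => ‖z - w‖ ^ (-(3 / 2) : ℝ)) (closedBall 0 R) ∧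
      ∫ w in closedBall (0 : ℂ) R, ‖z - w‖ ^ (-(3 / 2) : ℝ) ≤ c := by
  set h : ℂ → ℝ := fun x => (Set.Iio (1 : ℝ)).indicator (fun y => y ^ (-(3 / 2) : ℝ)) ‖x‖ with hh
  have hi : Integrable h := integrable_norm_rpow_indicator
  have h0 : ∀ x, 0 ≤ h x := fun x => by
    simp only [hh, Set.indicator]
    split_ifs
    · positivity
    · exact le_rfl
  refine ⟨(∫ x, h x) + volume.real (closedBall (0 : ℂ) R), by
    have := integral_nonneg (μ := volume) (f := h) h0
    positivity, fun z => ?_⟩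
  have h1 : Integrable (fun w => h (z - w)) := (integrable_comp_sub_left h z).2 hi
  have hc : IntegrableOn (fun _ : ℂ => (1 : ℝ)) (closedBall (0 : ℂ) R) :=
    integrableOn_const (isCompact_closedBall _ _).measure_ne_top
  have h2 : IntegrableOn (fun w => h (z - w) + 1) (closedBall (0 : ℂ) R) :=
    h1.integrableOn.add hc
  have h3 : IntegrableOn (fun w : ℂ => ‖z - w‖ ^ (-(3 / 2) : ℝ)) (closedBall 0 R) := by
    refine Integrable.mono' h2 ?_ (Filter.Eventually.of_forall fun w => ?_)
    · exact (Measurable.pow_const (by fun_prop) _).aestronglyMeasurable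
    · rw [Real.norm_of_nonneg (by positivity)]
      exact rpow_le_indicator_add_one (z - w)
  refine ⟨h3, ?_⟩
  calc _ ≤ ∫ w in closedBall (0 : ℂ) R, (h (z - w) + 1) :=
        integral_mono h3 h2 fun w => rpow_le_indicator_add_one (z - w)
    _ = (∫ w in closedBall (0 : ℂ) R, h (z - w)) + volume.real (closedBall (0 : ℂ) R) := by
        rw [integral_add h1.integrableOn hc]
        simp
    _ ≤ _ := by
        have : ∫ w in closedBall (0 : ℂ) R, h (z - w) ≤ ∫ w, h (z - w) :=
          setIntegral_le_integral h1 (Filter.Eventually.of_forall fun w => h0 _)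
        rw [integral_sub_left_eq_self h volume z] at this
        linarith

lemma norm_inv_le_rpow (x : ℂ) : ‖x⁻¹‖ ≤ 1 + ‖x‖ ^ (-(3 / 2) : ℝ) := by
  rw [norm_inv]
  by_cases hx : x = 0
  · simp [hx]
  have h0 : 0 < ‖x‖ := norm_pos_iff.2 hx
  by_cases h : ‖x‖ < 1
  · have : ‖x‖⁻¹ ≤ ‖x‖ ^ (-(3 / 2) : ℝ) := by
      rw [← Real.rpow_neg_one]
      exact Real.rpow_le_rpow_of_exponent_ge h0 h.le (by norm_num)
    linarith
  · have : ‖x‖⁻¹ ≤ 1 := inv_le_one_of_one_le₀ (not_lt.1 h)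
    have : 0 ≤ ‖x‖ ^ (-(3 / 2) : ℝ) := by positivity
    linarith

/-- This estimate under the integral gives the Hölder exponent `1/2` of the Cauchy transform. The
exponent `-3/2` is the price for splitting off half a power of `‖a - b‖`, and it is still integrable
in the plane. -/
lemma norm_inv_sub_inv_le (a b : ℂ) : ‖a⁻¹ - b⁻¹‖ ≤
    ‖a - b‖ ^ (1 / 2 : ℝ) * (2 * (‖a‖ ^ (-(3 / 2) : ℝ) + ‖b‖ ^ (-(3 / 2) : ℝ))) := by
  have key : ∀ x : ℂ, x ≠ 0 → ‖x⁻¹‖ = ‖x‖ ^ (1 / 2 : ℝ) * ‖x‖ ^ (-(3 / 2) : ℝ) := fun x hx => by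
    rw [← Real.rpow_add (norm_pos_iff.2 hx), norm_inv, ← Real.rpow_neg_one]
    norm_num
  by_cases ha : a = 0
  · by_cases hb : b = 0
    · simp [ha, hb]
    · subst ha
      simp only [inv_zero, zero_sub, norm_neg, norm_zero]
      rw [key b hb]
      refine mul_le_mul_of_nonneg_left ?_ (by positivity)
      have : 0 ≤ ‖b‖ ^ (-(3 / 2) : ℝ) := by positivity
      rw [Real.zero_rpow (by norm_num)]
      linarith
  by_cases hb : b = 0
  · subst hb
    simp only [inv_zero, sub_zero, norm_zero]
    rw [key a ha]
    refine mul_le_mul_of_nonneg_left ?_ (by positivity)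
    have : 0 ≤ ‖a‖ ^ (-(3 / 2) : ℝ) := by positivity
    rw [Real.zero_rpow (by norm_num)]
    linarith
  -- In terms of `x = ‖a‖ ^ (-1/2)`, `y = ‖b‖ ^ (-1/2)` and `d = ‖a - b‖ ^ (1/2)` the left side is
  -- `d² x² y²`. One factor `d` is kept, the other is at most `x⁻¹ + y⁻¹`, and a cubic inequality
  -- remains.
  set x := ‖a‖ ^ (-(1 / 2) : ℝ) with hx
  set y := ‖b‖ ^ (-(1 / 2) : ℝ) with hy
  have ha0 : 0 < ‖a‖ := norm_pos_iff.2 ha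
  have hb0 : 0 < ‖b‖ := norm_pos_iff.2 hb
  have hx0 : 0 < x := by positivity
  have hy0 : 0 < y := by positivity
  have hx3 : ‖a‖ ^ (-(3 / 2) : ℝ) = x ^ 3 := by
    rw [hx, ← Real.rpow_natCast, ← Real.rpow_mul ha0.le]
    norm_num
  have hy3 : ‖b‖ ^ (-(3 / 2) : ℝ) = y ^ 3 := by
    rw [hy, ← Real.rpow_natCast, ← Real.rpow_mul hb0.le]
    norm_num
  have hx2 : ‖a‖⁻¹ = x ^ 2 := by
    rw [hx, ← Real.rpow_natCast, ← Real.rpow_mul ha0.le, ← Real.rpow_neg_one]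
    norm_num
  have hy2 : ‖b‖⁻¹ = y ^ 2 := by
    rw [hy, ← Real.rpow_natCast, ← Real.rpow_mul hb0.le, ← Real.rpow_neg_one]
    norm_num
  have hx1 : ‖a‖ ^ (1 / 2 : ℝ) = x⁻¹ := by
    rw [hx, ← Real.rpow_neg ha0.le]
    norm_num
  have hy1 : ‖b‖ ^ (1 / 2 : ℝ) = y⁻¹ := by
    rw [hy, ← Real.rpow_neg hb0.le]
    norm_num
  set d := ‖a - b‖ ^ (1 / 2 : ℝ) with hd
  have hd0 : 0 ≤ d := by positivity
  have hdd : ‖a - b‖ = d * d := by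
    rw [hd, ← Real.rpow_add_of_nonneg (norm_nonneg _) (by norm_num) (by norm_num)]
    norm_num
  have hdle : d ≤ x⁻¹ + y⁻¹ := by
    rw [← hx1, ← hy1]
    exact (Real.rpow_le_rpow (norm_nonneg _) (norm_sub_le a b) (by norm_num)).trans
      (Real.rpow_add_le_add_rpow ha0.le hb0.le (by norm_num) (by norm_num))
  have h1 : ‖a⁻¹ - b⁻¹‖ = d * d * (x ^ 2 * y ^ 2) := by
    rw [inv_sub_inv ha hb, norm_div, norm_mul, norm_sub_rev, hdd, ← hx2, ← hy2]
    field_simp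
  rw [h1, hx3, hy3, mul_assoc]
  refine mul_le_mul_of_nonneg_left ?_ hd0
  calc d * (x ^ 2 * y ^ 2) ≤ (x⁻¹ + y⁻¹) * (x ^ 2 * y ^ 2) := by gcongr
    _ = x * y ^ 2 + x ^ 2 * y := by field_simp
    _ ≤ 2 * (x ^ 3 + y ^ 3) := by
        nlinarith [mul_nonneg (add_pos hx0 hy0).le (sq_nonneg (x - y)), pow_pos hx0 3, pow_pos hy0 3]

variable {V W : Type*} [NormedAddCommGroup V]

/-- `g` is a measurable function bounded by `M` that vanishes outside the disc of radius `R`. -/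
structure IsDensity (g : ℂ → V) (R M : ℝ) : Prop where
  meas : AEStronglyMeasurable g
  bound : ∀ w, ‖g w‖ ≤ M
  supp : ∀ w, R < ‖w‖ → g w = 0

lemma IsDensity.nonneg {g : ℂ → V} {R M : ℝ} (hg : IsDensity g R M) : 0 ≤ M :=
  (norm_nonneg _).trans (hg.bound 0)

variable [NormedSpace ℂ V] [NormedAddCommGroup W] [NormedSpace ℂ W]

/-- The Cauchy transform, the solution of the inhomogeneous Cauchy-Riemann equation. -/
def cauchy (g : ℂ → V) (z : ℂ) : V := ∫ w, ((Real.pi : ℂ) * (z - w))⁻¹ • g w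

namespace IsDensity

variable {g : ℂ → V} {R M : ℝ}

lemma aestronglyMeasurable_mul (hg : IsDensity g R M) (z : ℂ) :
    AEStronglyMeasurable (fun w => ((Real.pi : ℂ) * (z - w))⁻¹ • g w) :=
  AEStronglyMeasurable.smul (by fun_prop) hg.meas

lemma norm_le (hg : IsDensity g R M) (z w : ℂ) : ‖((Real.pi : ℂ) * (z - w))⁻¹ • g w‖ ≤
    (closedBall (0 : ℂ) R).indicator (fun w => M * (1 + ‖z - w‖ ^ (-(3 / 2) : ℝ))) w := by
  by_cases hw : w ∈ closedBall (0 : ℂ) R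
  · rw [Set.indicator_of_mem hw, norm_smul, mul_inv, norm_mul, mul_comm M]
    refine mul_le_mul ?_ (hg.bound w) (norm_nonneg _) (by positivity)
    refine (mul_le_of_le_one_left (norm_nonneg _) ?_).trans (norm_inv_le_rpow _)
    rw [norm_inv, Complex.norm_real, Real.norm_of_nonneg Real.pi_pos.le]
    exact inv_le_one_of_one_le₀ (by linarith [Real.pi_gt_three])
  · rw [Set.indicator_of_notMem hw, hg.supp w (by simpa using hw), smul_zero, norm_zero]

lemma integrable_dominant (R M : ℝ) (z : ℂ) : Integrable
    ((closedBall (0 : ℂ) R).indicator (fun w => M * (1 + ‖z - w‖ ^ (-(3 / 2) : ℝ)))) := by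
  rw [integrable_indicator_iff measurableSet_closedBall]
  obtain ⟨c, -, hc⟩ := exists_kernel_bound R
  exact (Integrable.add (integrableOn_const (isCompact_closedBall _ _).measure_ne_top)
    (hc z).1).const_mul M

lemma integrable (hg : IsDensity g R M) (z : ℂ) :
    Integrable (fun w => ((Real.pi : ℂ) * (z - w))⁻¹ • g w) :=
  Integrable.mono' (integrable_dominant R M z) (hg.aestronglyMeasurable_mul z)
    (Filter.Eventually.of_forall (hg.norm_le z))

lemma integral_dominant_le (R : ℝ) : ∃ c : ℝ, 0 ≤ c ∧ ∀ M, 0 ≤ M → ∀ z : ℂ,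
    ∫ w, (closedBall (0 : ℂ) R).indicator (fun w => M * (1 + ‖z - w‖ ^ (-(3 / 2) : ℝ))) w ≤
      c * M := by
  obtain ⟨c, hc0, hc⟩ := exists_kernel_bound R
  refine ⟨volume.real (closedBall (0 : ℂ) R) + c, by positivity, fun M hM z => ?_⟩
  rw [integral_indicator measurableSet_closedBall, integral_const_mul, mul_comm]
  refine mul_le_mul_of_nonneg_right ?_ hM
  have h1 : IntegrableOn (fun _ : ℂ => (1 : ℝ)) (closedBall (0 : ℂ) R) :=
    integrableOn_const (isCompact_closedBall _ _).measure_ne_top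
  rw [integral_add h1 (hc z).1]
  simpa using (hc z).2

/-- The Cauchy transform is bounded by a multiple of the bound of the density. -/
lemma exists_norm_cauchy_le (R : ℝ) : ∃ c : ℝ, 0 ≤ c ∧ ∀ (M : ℝ) (g : ℂ → V), IsDensity g R M →
    ∀ z, ‖cauchy g z‖ ≤ c * M := by
  obtain ⟨c, hc0, hc⟩ := integral_dominant_le R
  refine ⟨c, hc0, fun M g hg z => ?_⟩
  exact (norm_integral_le_of_norm_le (integrable_dominant R M z)
    (Filter.Eventually.of_forall (hg.norm_le z))).trans (hc M hg.nonneg z)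

/-- The Cauchy transform is Hölder continuous. -/
lemma exists_norm_cauchy_sub_le (R : ℝ) : ∃ c : ℝ, 0 ≤ c ∧ ∀ (M : ℝ) (g : ℂ → V),
    IsDensity g R M → ∀ z z', ‖cauchy g z - cauchy g z'‖ ≤ c * M * ‖z - z'‖ ^ (1 / 2 : ℝ) := by
  obtain ⟨c, hc0, hc⟩ := exists_kernel_bound R
  refine ⟨4 * c, by positivity, fun M g hg z z' => ?_⟩
  have hM := hg.nonneg
  unfold cauchy
  rw [← integral_sub (hg.integrable z) (hg.integrable z')]
  have hi := (((hc z).1.add (hc z').1).const_mul 2).const_mul (M * ‖z - z'‖ ^ (1 / 2 : ℝ))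
  have hi' := (integrable_indicator_iff (μ := volume) (measurableSet_closedBall (x := (0 : ℂ))
    (ε := R))).2 hi
  refine (norm_integral_le_of_norm_le hi' (Filter.Eventually.of_forall fun w => ?_)).trans ?_
  · by_cases hw : w ∈ closedBall (0 : ℂ) R
    · rw [Set.indicator_of_mem hw, ← sub_smul, norm_smul, mul_inv, mul_inv, ← mul_sub, norm_mul]
      have h1 := norm_inv_sub_inv_le (z - w) (z' - w)
      rw [sub_sub_sub_cancel_right] at h1
      have h2 : ‖((Real.pi : ℂ))⁻¹‖ ≤ 1 := by
        rw [norm_inv, Complex.norm_real, Real.norm_of_nonneg Real.pi_pos.le]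
        exact inv_le_one_of_one_le₀ (by linarith [Real.pi_gt_three])
      refine (mul_le_mul ((mul_le_of_le_one_left (norm_nonneg _) h2).trans h1) (hg.bound w)
        (norm_nonneg _) (by positivity)).trans (le_of_eq ?_)
      simp only [Pi.add_apply]
      ring
    · rw [Set.indicator_of_notMem hw, hg.supp w (by simpa using hw)]
      simp
  · rw [integral_indicator measurableSet_closedBall, integral_const_mul, integral_const_mul]
    have h3 : ∫ w in closedBall (0 : ℂ) R,
        ((fun w : ℂ => ‖z - w‖ ^ (-(3 / 2) : ℝ)) + fun w => ‖z' - w‖ ^ (-(3 / 2) : ℝ)) w ≤ c + c := by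
      refine (integral_add (hc z).1 (hc z').1).le.trans ?_
      exact add_le_add (hc z).2 (hc z').2
    calc _ ≤ M * ‖z - z'‖ ^ (1 / 2 : ℝ) * (2 * (c + c)) := by gcongr
      _ = _ := by ring

lemma continuous_cauchy (hg : IsDensity g R M) : Continuous (cauchy g) := by
  obtain ⟨c, hc0, hc⟩ := exists_norm_cauchy_sub_le (V := V) R
  rw [continuous_iff_continuousAt]
  intro z
  rw [ContinuousAt, tendsto_iff_norm_sub_tendsto_zero]
  have h1 : Tendsto (fun y : ℂ => c * M * ‖y - z‖ ^ (1 / 2 : ℝ)) (𝓝 z) (𝓝 0) := by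
    have : Continuous (fun y : ℂ => c * M * ‖y - z‖ ^ (1 / 2 : ℝ)) :=
      continuous_const.mul (Continuous.rpow_const (by fun_prop) fun _ => Or.inr (by norm_num))
    have h := this.tendsto z
    simpa using h
  exact squeeze_zero (fun _ => norm_nonneg _) (fun y => hc M g hg y z) h1

/-- The Cauchy transform tends to zero at infinity. -/
lemma tendsto_cauchy (hg : IsDensity g R M) : Tendsto (cauchy g) (Bornology.cobounded ℂ) (𝓝 0) := by
  rw [tendsto_zero_iff_norm_tendsto_zero]
  have hM := hg.nonneg
  have h1 : Tendsto (fun z : ℂ => (M * volume.real (closedBall (0 : ℂ) R)) * (‖z‖ - R)⁻¹)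
      (Bornology.cobounded ℂ) (𝓝 0) := by
    rw [← mul_zero (M * volume.real (closedBall (0 : ℂ) R))]
    exact ((tendsto_atTop_add_const_right _ (-R) tendsto_norm_cobounded_atTop).inv_tendsto_atTop).const_mul _
  refine squeeze_zero' (Filter.Eventually.of_forall fun _ => norm_nonneg _) ?_ h1
  filter_upwards [tendsto_norm_cobounded_atTop.eventually (eventually_gt_atTop R)] with z hz
  have hc : Integrable ((closedBall (0 : ℂ) R).indicator fun _ : ℂ => M * (‖z‖ - R)⁻¹) :=
    (integrable_indicator_iff measurableSet_closedBall).2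
      (integrableOn_const (isCompact_closedBall _ _).measure_ne_top)
  refine (norm_integral_le_of_norm_le hc (Filter.Eventually.of_forall fun w => ?_)).trans ?_
  · by_cases hw : w ∈ closedBall (0 : ℂ) R
    · rw [Set.indicator_of_mem hw, norm_smul, mul_comm M]
      refine mul_le_mul ?_ (hg.bound w) (norm_nonneg _) (by have := sub_pos.2 hz; positivity)
      have h2 : ‖z‖ - R ≤ ‖z - w‖ := by
        have := norm_sub_norm_le z w
        have := mem_closedBall_zero_iff.1 hw
        linarith
      rw [norm_inv, norm_mul, Complex.norm_real, Real.norm_of_nonneg Real.pi_pos.le]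
      refine inv_anti₀ (sub_pos.2 hz) (h2.trans ?_)
      exact le_mul_of_one_le_left (norm_nonneg _) (by linarith [Real.pi_gt_three])
    · rw [Set.indicator_of_notMem hw, hg.supp w (by simpa using hw)]
      simp
  · rw [integral_indicator measurableSet_closedBall]
    simp only [integral_const, MeasurableSet.univ, measureReal_restrict_apply, Set.univ_inter,
      smul_eq_mul]
    exact le_of_eq (by ring)

/-- The Cauchy transform is holomorphic where the density vanishes. -/
lemma differentiableAt_cauchy (hg : IsDensity g R M) {z₀ : ℂ} (h : ∀ᶠ w in 𝓝 z₀, g w = 0) :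
    DifferentiableAt ℂ (cauchy g) z₀ := by
  obtain ⟨ε, hε, hz⟩ := Metric.eventually_nhds_iff_ball.1 h
  -- For `z` near `z₀` the points where `g` is nonzero stay at distance at least `ε / 2`, so the
  -- kernel can be differentiated under the integral with derivative at most `(ε / 2)⁻²`.
  have hne : ∀ z ∈ ball z₀ (ε / 2), ∀ w, g w ≠ 0 → ε / 2 ≤ ‖z - w‖ := by
    intro z hz' w hw
    by_contra hlt
    push Not at hlt
    refine hw (hz w ?_)
    rw [mem_ball, dist_eq_norm] at hz' ⊢
    calc ‖w - z₀‖ = ‖(z - z₀) - (z - w)‖ := by congr 1; ring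
      _ ≤ ‖z - z₀‖ + ‖z - w‖ := norm_sub_le _ _
      _ < ε := by linarith
  have hd : ∀ w, ∀ z ∈ ball z₀ (ε / 2),
      HasDerivAt (fun z => ((Real.pi : ℂ) * (z - w))⁻¹ • g w)
        ((-(Real.pi : ℂ) / ((Real.pi : ℂ) * (z - w)) ^ 2) • g w) z := by
    intro w z hz'
    by_cases hw : g w = 0
    · simp only [hw, smul_zero]
      exact hasDerivAt_const z 0
    · have h1 : z - w ≠ 0 := by
        have := hne z hz' w hw
        rw [← norm_pos_iff]
        linarith
      have h2 : HasDerivAt (fun z => (Real.pi : ℂ) * (z - w)) (Real.pi : ℂ) z := by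
        simpa using ((hasDerivAt_id z).sub_const w).const_mul (Real.pi : ℂ)
      exact (h2.inv (mul_ne_zero (by exact_mod_cast Real.pi_ne_zero) h1)).smul_const (g w)
  refine (hasDerivAt_integral_of_dominated_loc_of_deriv_le (ball_mem_nhds z₀ (half_pos hε))
    (Filter.Eventually.of_forall fun z => hg.aestronglyMeasurable_mul z) (hg.integrable z₀)
    (F' := fun z w => (-(Real.pi : ℂ) / ((Real.pi : ℂ) * (z - w)) ^ 2) • g w)
    (bound := (closedBall (0 : ℂ) R).indicator fun _ => (ε / 2)⁻¹ ^ 2 * M)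
    (AEStronglyMeasurable.smul (Measurable.aestronglyMeasurable (by fun_prop)) hg.meas)
    (Filter.Eventually.of_forall fun w z hz' => ?_)
    ((integrable_indicator_iff measurableSet_closedBall).2
      (integrableOn_const (isCompact_closedBall _ _).measure_ne_top))
    (Filter.Eventually.of_forall hd)).2.differentiableAt
  by_cases hw : g w = 0
  · rw [hw, smul_zero, norm_zero]
    have := hg.nonneg
    exact Set.indicator_nonneg (fun _ _ => by positivity) _
  · have hwR : w ∈ closedBall (0 : ℂ) R := by
      by_contra hwR
      exact hw (hg.supp w (by simpa using hwR))
    rw [Set.indicator_of_mem hwR, norm_smul]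
    refine mul_le_mul ?_ (hg.bound w) (norm_nonneg _) (by positivity)
    have h1 := hne z hz' w hw
    have h2 : 0 < ‖z - w‖ := by linarith
    rw [norm_div, norm_neg, norm_pow, norm_mul, Complex.norm_real,
      Real.norm_of_nonneg Real.pi_pos.le]
    have h3 : Real.pi / (Real.pi * ‖z - w‖) ^ 2 = Real.pi⁻¹ * (‖z - w‖⁻¹) ^ 2 := by
      field_simp
    rw [h3]
    refine (mul_le_of_le_one_left (by positivity)
      (inv_le_one_of_one_le₀ (by linarith [Real.pi_gt_three]))).trans ?_
    gcongr

end IsDensity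

end CauchyTransform

/-! ### The Cauchy–Riemann operator and the Cauchy–Pompeiu formula -/

section Dbar

open MeasureTheory Metric

variable {V W : Type*} [NormedAddCommGroup V] [NormedSpace ℂ V]
  [NormedAddCommGroup W] [NormedSpace ℂ W]

/-- The Cauchy-Riemann operator. -/
def dbar (f : ℂ → V) (z : ℂ) : V :=
  (1 / 2 : ℂ) • (fderiv ℝ f z 1 + Complex.I • fderiv ℝ f z Complex.I)

lemma dbar_congr {f g : ℂ → V} {z : ℂ} (h : f =ᶠ[𝓝 z] g) : dbar f z = dbar g z := by
  rw [dbar, dbar, h.fderiv_eq]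

lemma dbar_eq_zero {f : ℂ → V} {z : ℂ} (h : ∀ᶠ w in 𝓝 z, f w = 0) : dbar f z = 0 := by
  rw [dbar_congr (g := fun _ => 0) h]
  simp [dbar]

/-- In the Leibniz rule the term with the derivative of the holomorphic factor `A` drops out. -/
lemma dbar_smul {f : ℂ → ℂ} {A : ℂ → V} {z : ℂ} (hf : DifferentiableAt ℝ f z)
    (hA : DifferentiableAt ℂ A z) : dbar (fun w => f w • A w) z = dbar f z • A z := by
  have hA' := hA.hasFDerivAt.restrictScalars ℝ
  have h : fderiv ℝ (fun w => f w • A w) z = _ := (hf.hasFDerivAt.smul hA').fderiv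
  unfold dbar
  rw [h]
  have h1 : fderiv ℂ A z Complex.I = Complex.I • fderiv ℂ A z 1 := by
    rw [← map_smul, smul_eq_mul, mul_one]
  simp only [add_apply, smul_apply, ContinuousLinearMap.smulRight_apply,
    ContinuousLinearMap.coe_restrictScalars', h1]
  have h2 : Complex.I • f z • Complex.I • fderiv ℂ A z 1 = -(f z • fderiv ℂ A z 1) := by
    rw [smul_smul, smul_smul, ← neg_smul]
    congr 1
    linear_combination f z * Complex.I_mul_I
  simp only [smul_add, h2]
  module

lemma continuous_dbar {f : ℂ → V} (hf : ContDiff ℝ 1 f) : Continuous (dbar f) := by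
  have h := hf.continuous_fderiv (by simp)
  unfold dbar
  fun_prop

lemma HasCompactSupport.dbar {f : ℂ → V} (hf : HasCompactSupport f) :
    HasCompactSupport (dbar f) := by
  refine hf.mono' fun z hz => ?_
  by_contra h
  exact hz (dbar_eq_zero (notMem_tsupport_iff_eventuallyEq.1 h))

omit [NormedSpace ℂ V] in
lemma HasCompactSupport.exists_isDensity {f : ℂ → V} (hf : HasCompactSupport f)
    (hc : Continuous f) : ∃ R M, IsDensity f R M := by
  obtain ⟨R, hR⟩ := hf.isCompact.isBounded.subset_closedBall (0 : ℂ)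
  obtain ⟨M, hM⟩ := hf.exists_bound_of_continuous hc
  refine ⟨R, M, hc.aestronglyMeasurable, hM, fun w hw => ?_⟩
  by_contra h
  have := hR (subset_tsupport f h)
  rw [mem_closedBall_zero_iff] at this
  linarith

/-- Up to the factor `r`, the integrand is the derivative of `φ` along the circle of radius `r`, and
the circle closes up. -/
lemma setIntegral_polar_angular {φ : ℂ → V} [CompleteSpace V] (hφ : ContDiff ℝ 1 φ) (z : ℂ) {r : ℝ}
    (hr : 0 < r) : ∫ θ in Set.Ioo (-Real.pi) Real.pi,
      fderiv ℝ φ (z + r * (Real.cos θ + Real.sin θ * Complex.I))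
        (Complex.I * (Real.cos θ + Real.sin θ * Complex.I)) = 0 := by
  have h1 : ∀ θ : ℝ, HasDerivAt (fun θ : ℝ => φ (z + r * (Real.cos θ + Real.sin θ * Complex.I)))
      (r • fderiv ℝ φ (z + r * (Real.cos θ + Real.sin θ * Complex.I))
        (Complex.I * (Real.cos θ + Real.sin θ * Complex.I))) θ := by
    intro θ
    have h2 : HasDerivAt (fun θ : ℝ => z + r * (Real.cos θ + Real.sin θ * Complex.I))
        (r * (Complex.I * (Real.cos θ + Real.sin θ * Complex.I))) θ := by
      have hc := (Real.hasDerivAt_cos θ).ofReal_comp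
      have hs := (Real.hasDerivAt_sin θ).ofReal_comp
      refine (((hc.add (hs.mul_const Complex.I)).const_mul (r : ℂ)).const_add z).congr_deriv ?_
      push_cast
      linear_combination (-(r : ℂ) * Complex.sin θ) * Complex.I_mul_I
    have h3 := ((hφ.differentiable (by simp)) _).hasFDerivAt.comp_hasDerivAt θ h2
    refine h3.congr_deriv ?_
    rw [← map_smul]
    rfl
  have hcont : Continuous fun θ : ℝ => fderiv ℝ φ (z + r * (Real.cos θ + Real.sin θ * Complex.I))
      (Complex.I * (Real.cos θ + Real.sin θ * Complex.I)) := by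
    have h := hφ.continuous_fderiv (by simp)
    exact (h.comp (by fun_prop)).clm_apply (by fun_prop)
  have h4 := intervalIntegral.integral_eq_sub_of_hasDerivAt (a := -Real.pi) (b := Real.pi)
    (fun θ _ => h1 θ) ((hcont.const_smul r).intervalIntegrable _ _)
  rw [intervalIntegral.integral_smul] at h4
  rw [← integral_Ioc_eq_integral_Ioo,
    ← intervalIntegral.integral_of_le (by linarith [Real.pi_pos])]
  simp only [Real.cos_neg, Real.sin_neg, Real.cos_pi, Real.sin_pi, neg_zero, sub_self,
    smul_eq_zero] at h4
  exact h4.resolve_left hr.ne'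

/-- This is the fundamental theorem of calculus on a ray; compact support makes the contribution at
infinity zero. -/
lemma setIntegral_polar_radial {φ : ℂ → V} [CompleteSpace V] (hφ : ContDiff ℝ 1 φ)
    (hs : HasCompactSupport φ) (z e : ℂ) (he : ‖e‖ = 1) :
    ∫ r in Set.Ioi (0 : ℝ), fderiv ℝ φ (z + r * e) e = -φ z := by
  have h1 : ∀ r : ℝ, HasDerivAt (fun r : ℝ => φ (z + r * e)) (fderiv ℝ φ (z + r * e) e) r := by
    intro r
    have h2 : HasDerivAt (fun r : ℝ => z + r * e) e r := by
      simpa using ((Complex.ofRealCLM.hasDerivAt (x := r)).mul_const e).const_add z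
    exact ((hφ.differentiable (by simp)) _).hasFDerivAt.comp_hasDerivAt r h2
  obtain ⟨R, hR⟩ := hs.isCompact.isBounded.subset_closedBall (0 : ℂ)
  have hbig : ∀ r : ℝ, R + ‖z‖ < r → z + r * e ∉ tsupport φ := fun r hr hmem => by
    have h3 := mem_closedBall_zero_iff.1 (hR hmem)
    have h4 : ‖(r : ℂ) * e‖ = |r| := by rw [norm_mul, he, mul_one, Complex.norm_real, Real.norm_eq_abs]
    have h5 := norm_sub_norm_le ((r : ℂ) * e) (-z)
    rw [sub_neg_eq_add, add_comm, norm_neg, h4] at h5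
    have := le_abs_self r
    rw [add_comm] at h5
    rw [add_comm] at h3
    linarith
  have hcont : Continuous fun r : ℝ => fderiv ℝ φ (z + r * e) e :=
    ((hφ.continuous_fderiv (by simp)).comp (by fun_prop)).clm_apply continuous_const
  have hint : IntegrableOn (fun r : ℝ => fderiv ℝ φ (z + r * e) e) (Set.Ioi 0) := by
    refine (hcont.continuousOn.integrableOn_compact
      (isCompact_Icc (a := (0 : ℝ)) (b := R + ‖z‖))).of_forall_sdiff_eq_zero measurableSet_Ioi ?_
    rintro r ⟨hr, hr'⟩
    have h6 : R + ‖z‖ < r := by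
      by_contra h
      exact hr' ⟨le_of_lt hr, not_lt.1 h⟩
    have h7 := (notMem_tsupport_iff_eventuallyEq.1 (hbig r h6)).fderiv_eq (𝕜 := ℝ)
    rw [h7]
    simp
  have h2 := integral_Ioi_of_hasDerivAt_of_tendsto' (a := 0) (fun r _ => h1 r) hint
    (m := 0) (tendsto_const_nhds.congr' ?_)
  · simpa using h2
  · filter_upwards [eventually_gt_atTop (R + ‖z‖)] with r hr
    exact (image_eq_zero_of_notMem_tsupport (hbig r hr)).symm

/-- A smooth function with compact support is the Cauchy transform of its derivative. -/
theorem cauchy_dbar {φ : ℂ → V} [CompleteSpace V] (hφ : ContDiff ℝ 1 φ)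
    (hs : HasCompactSupport φ) (z : ℂ) : cauchy (dbar φ) z = φ z := by
  let ex : ℝ → ℂ := fun θ => Real.cos θ + Real.sin θ * Complex.I
  have hex : ∀ θ, ‖ex θ‖ = 1 := fun θ => by
    have : ex θ = Complex.exp (θ * Complex.I) := by
      simp [ex, Complex.exp_mul_I]
    rw [this, Complex.norm_exp_ofReal_mul_I]
  have hex0 : ∀ θ, ex θ ≠ 0 := fun θ h => by simpa [h] using hex θ
  let F : ℝ × ℝ → V := fun p => fderiv ℝ φ (z + p.1 * ex p.2) (ex p.2)
  let G : ℝ × ℝ → V := fun p => fderiv ℝ φ (z + p.1 * ex p.2) (Complex.I * ex p.2)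
  have hcex : Continuous ex := by fun_prop
  have hd := hφ.continuous_fderiv (n := 1) (by simp)
  have hF : Continuous F := (hd.comp (by fun_prop)).clm_apply (by fun_prop)
  have hG : Continuous G := (hd.comp (by fun_prop)).clm_apply (by fun_prop)
  obtain ⟨R, hR⟩ := hs.isCompact.isBounded.subset_closedBall (0 : ℂ)
  have hbig : ∀ p : ℝ × ℝ, R + ‖z‖ < p.1 → fderiv ℝ φ (z + p.1 * ex p.2) = 0 := fun p hr => by
    have : z + p.1 * ex p.2 ∉ tsupport φ := fun hmem => by
      have h3 := mem_closedBall_zero_iff.1 (hR hmem)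
      have h4 : ‖(p.1 : ℂ) * ex p.2‖ = |p.1| := by
        rw [norm_mul, hex, mul_one, Complex.norm_real, Real.norm_eq_abs]
      have h5 := norm_sub_norm_le ((p.1 : ℂ) * ex p.2) (-z)
      rw [sub_neg_eq_add, add_comm _ z, norm_neg, h4] at h5
      have := le_abs_self p.1
      linarith
    rw [(notMem_tsupport_iff_eventuallyEq.1 this).fderiv_eq (𝕜 := ℝ)]
    simp
  have hint : ∀ H : ℝ × ℝ → V, Continuous H → (∀ p, R + ‖z‖ < p.1 → H p = 0) →
      IntegrableOn H (Set.Ioi 0 ×ˢ Set.Ioo (-Real.pi) Real.pi) := by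
    intro H hH h0
    refine (hH.continuousOn.integrableOn_compact ((isCompact_Icc (a := (0 : ℝ))
      (b := R + ‖z‖)).prod (isCompact_Icc (a := -Real.pi) (b := Real.pi)))).of_forall_sdiff_eq_zero
      (measurableSet_Ioi.prod measurableSet_Ioo) ?_
    rintro p ⟨⟨hr, hr2⟩, hr'⟩
    refine h0 p ?_
    by_contra h
    exact hr' ⟨⟨le_of_lt hr, not_lt.1 h⟩, ⟨hr2.1.le, hr2.2.le⟩⟩
  have hF' := hint F hF fun p hp => by simp only [F, hbig p hp]; rfl
  have hG' := hint G hG fun p hp => by simp only [G, hbig p hp]; rfl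
  unfold cauchy
  rw [← integral_add_left_eq_self _ z, ← Complex.integral_comp_polarCoord_symm, polarCoord_target]
  -- The Jacobian `r` cancels the singularity of the kernel, and the integrand becomes `-1/(2π)`
  -- times `∂_r φ + (i/r) ∂_θ φ`. Here `F` is the radial and `G` the angular derivative divided by
  -- `r`.
  have key : ∀ p ∈ Set.Ioi (0 : ℝ) ×ˢ Set.Ioo (-Real.pi) Real.pi,
      p.1 • ((Real.pi * (z - (z + Complex.polarCoord.symm p)))⁻¹ •
        dbar φ (z + Complex.polarCoord.symm p)) =
      (-(2 * Real.pi : ℂ)⁻¹) • F p + (-(2 * Real.pi : ℂ)⁻¹ * Complex.I) • G p := by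
    rintro p ⟨hp, -⟩
    have hp0 : (p.1 : ℂ) ≠ 0 := by exact_mod_cast (ne_of_gt hp)
    have hpi : (Real.pi : ℂ) ≠ 0 := by exact_mod_cast Real.pi_ne_zero
    rw [Complex.polarCoord_symm_apply]
    change p.1 • ((Real.pi * (z - (z + p.1 * ex p.2)))⁻¹ • dbar φ (z + p.1 * ex p.2)) = _
    simp only [F, G, dbar]
    set D := fderiv ℝ φ (z + p.1 * ex p.2)
    have hD : ∀ a b : ℝ, D (a + b * Complex.I) = (a : ℂ) • D 1 + (b : ℂ) • D Complex.I := by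
      intro a b
      rw [map_add, show (a : ℂ) = a • (1 : ℂ) by simp,
        show ((b : ℂ) * Complex.I) = b • Complex.I by simp, map_smul, map_smul]
      simp
    have hD1 : D (ex p.2) = (Real.cos p.2 : ℂ) • D 1 + (Real.sin p.2 : ℂ) • D Complex.I := hD _ _
    have hD2 : D (Complex.I * ex p.2) =
        (-Real.sin p.2 : ℂ) • D 1 + (Real.cos p.2 : ℂ) • D Complex.I := by
      have := hD (-Real.sin p.2) (Real.cos p.2)
      push_cast at this ⊢
      rw [← this]
      congr 1
      simp only [ex]
      push_cast
      linear_combination (Complex.sin p.2) * Complex.I_mul_I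
    have hee : (ex p.2)⁻¹ = Real.cos p.2 - Real.sin p.2 * Complex.I := by
      refine inv_eq_of_mul_eq_one_right ?_
      have h1 : (Complex.cos p.2) ^ 2 + (Complex.sin p.2) ^ 2 = 1 := by
        rw [add_comm]; exact Complex.sin_sq_add_cos_sq _
      simp only [ex]
      push_cast
      linear_combination h1 - (Complex.sin p.2) ^ 2 * Complex.I_mul_I
    have hk : (Real.pi * (z - (z + p.1 * ex p.2)))⁻¹ =
        -((p.1 : ℂ)⁻¹ * (Real.pi : ℂ)⁻¹ * (Real.cos p.2 - Real.sin p.2 * Complex.I)) := by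
      rw [← hee]
      have := hex0 p.2
      rw [show z - (z + p.1 * ex p.2) = -(p.1 * ex p.2) by ring]
      field_simp
    rw [hk, hD1, hD2, ← Complex.coe_smul]
    simp only [smul_add, smul_smul]
    have e1 : (p.1 : ℂ) * (-((p.1 : ℂ)⁻¹ * (Real.pi : ℂ)⁻¹ *
        (Real.cos p.2 - Real.sin p.2 * Complex.I)) * (1 / 2)) =
        -(2 * Real.pi : ℂ)⁻¹ * (Real.cos p.2 - Real.sin p.2 * Complex.I) := by
      field_simp
    have e2 : (p.1 : ℂ) * (-((p.1 : ℂ)⁻¹ * (Real.pi : ℂ)⁻¹ *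
        (Real.cos p.2 - Real.sin p.2 * Complex.I)) * (1 / 2 * Complex.I)) =
        -(2 * Real.pi : ℂ)⁻¹ * (Real.cos p.2 * Complex.I + Real.sin p.2) := by
      have : (Real.cos p.2 - Real.sin p.2 * Complex.I) * Complex.I =
          (Real.cos p.2 * Complex.I + Real.sin p.2) := by
        linear_combination (-(Real.sin p.2 : ℂ)) * Complex.I_mul_I
      rw [← this]
      field_simp
    simp only [mul_assoc] at e1 e2 ⊢
    rw [e1, e2]
    module
  rw [setIntegral_congr_fun (measurableSet_Ioi.prod measurableSet_Ioo) key]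
  refine (integral_add (hF'.smul _) (hG'.smul _)).trans ?_
  simp only [Pi.smul_apply, integral_smul]
  rw [Measure.volume_eq_prod] at hF' hG' ⊢
  -- The angular part is integrated over `θ` first and vanishes. The radial part is integrated over
  -- `r` first and gives `-φ z` for each of the `2π` angles.
  rw [setIntegral_prod _ hG', setIntegral_congr_fun measurableSet_Ioi
    (g := fun _ => 0) fun r hr => setIntegral_polar_angular hφ z hr]
  rw [IntegrableOn, ← Measure.prod_restrict] at hF'
  rw [← Measure.prod_restrict, integral_prod_symm _ hF',
    setIntegral_congr_fun measurableSet_Ioo (g := fun _ => -φ z)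
      fun θ _ => setIntegral_polar_radial hφ hs z (ex θ) (hex θ)]
  have hpi : (Real.pi : ℂ) ≠ 0 := by exact_mod_cast Real.pi_ne_zero
  simp only [integral_zero, smul_zero, add_zero, integral_const, MeasurableSet.univ,
    measureReal_restrict_apply, Set.univ_inter, Real.volume_real_Ioo]
  rw [max_eq_left (by linarith [Real.pi_pos]), ← Complex.coe_smul, smul_smul, smul_neg, ← neg_smul]
  convert one_smul ℂ (φ z) using 2
  push_cast
  field_simp
  ring

/-- The commutator of the Cauchy transform with multiplication by a smooth function. -/
theorem apply_cauchy [CompleteSpace V] [CompleteSpace W] {Φ : ℂ → V →L[ℂ] W} (hΦ : ContDiff ℝ 1 Φ)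
    (hs : HasCompactSupport Φ) {g : ℂ → V} {R M : ℝ} (hg : IsDensity g R M) (z : ℂ) :
    Φ z (cauchy g z) = cauchy (fun w => dbar Φ w (cauchy g w) + Φ w (g w)) z := by
  -- The density `g` is only bounded and measurable, so `cauchy g` need not be differentiable and
  -- the product rule is not available. Fubini's theorem for `k(z,w) k(w,u) ∂̄Φ(w) g(u)` replaces
  -- it.
  have hD := continuous_dbar hΦ
  obtain ⟨R', N, hDd⟩ := hs.dbar.exists_isDensity hD
  obtain ⟨c, hc0, hc⟩ := IsDensity.integral_dominant_le R
  obtain ⟨R₁, N₁, hΦd⟩ := hs.exists_isDensity hΦ.continuous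
  have hM := hg.nonneg
  let k : ℂ → ℂ → ℂ := fun z w => ((Real.pi : ℂ) * (z - w))⁻¹
  have hmeas : AEStronglyMeasurable (Function.uncurry fun w u => (k z w * k w u) • dbar Φ w (g u))
      ((volume : Measure ℂ).prod volume) := by
    refine AEStronglyMeasurable.smul (Measurable.aestronglyMeasurable ?_) ?_
    · simp only [k]
      fun_prop
    · exact (isBoundedBilinearMap_apply (𝕜 := ℂ)).continuous.comp_aestronglyMeasurable
        (hD.aestronglyMeasurable.comp_fst.prodMk hg.meas.comp_snd)
  have hb : ∀ w, ∫ u, ‖(k z w * k w u) • dbar Φ w (g u)‖ ≤ ‖k z w • dbar Φ w‖ * (c * M) := by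
    intro w
    calc _ ≤ ∫ u, ‖k z w • dbar Φ w‖ * (closedBall (0 : ℂ) R).indicator
          (fun u => M * (1 + ‖w - u‖ ^ (-(3 / 2) : ℝ))) u := by
          refine integral_mono_of_nonneg (Filter.Eventually.of_forall fun _ => norm_nonneg _)
            ((IsDensity.integrable_dominant R M w).const_mul _)
            (Filter.Eventually.of_forall fun u => ?_)
          have h1 : (k z w * k w u) • dbar Φ w (g u) = (k z w • dbar Φ w) (k w u • g u) := by
            rw [map_smul, smul_apply, smul_smul, mul_comm]
          simp only [h1]
          exact (ContinuousLinearMap.le_opNorm _ _).trans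
            (mul_le_mul_of_nonneg_left (hg.norm_le w u) (norm_nonneg _))
      _ ≤ _ := by
          rw [integral_const_mul]
          exact mul_le_mul_of_nonneg_left (hc M hM w) (norm_nonneg _)
  have hint : Integrable (Function.uncurry fun w u => (k z w * k w u) • dbar Φ w (g u))
      ((volume : Measure ℂ).prod volume) := by
    rw [integrable_prod_iff hmeas]
    refine ⟨Filter.Eventually.of_forall fun w => ?_, ?_⟩
    · refine ((k z w • dbar Φ w).integrable_comp (hg.integrable w)).congr
        (Filter.Eventually.of_forall fun u => ?_)
      simp only [Function.uncurry]
      rw [map_smul, smul_apply, smul_smul, mul_comm]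
    · refine Integrable.mono' ((hDd.integrable z).norm.mul_const (c * M))
        hmeas.norm.integral_prod_right' (Filter.Eventually.of_forall fun w => ?_)
      rw [Real.norm_of_nonneg (integral_nonneg fun _ => norm_nonneg _)]
      exact hb w
  have hswap := integral_integral_swap hint
  have hC : ∀ x v, ∫ w, k x w • dbar Φ w v = Φ x v := fun x v => by
    rw [← cauchy_dbar hΦ hs x]
    unfold cauchy
    rw [ContinuousLinearMap.integral_apply (hDd.integrable x)]
    rfl
  have hCi : ∀ x v, Integrable fun w => k x w • dbar Φ w v := fun x v =>
    (hDd.integrable x).apply_continuousLinearMap v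
  have hleft : ∀ w, ∫ u, (k z w * k w u) • dbar Φ w (g u) = k z w • dbar Φ w (cauchy g w) := by
    intro w
    unfold cauchy
    rw [← ContinuousLinearMap.integral_comp_comm _ (hg.integrable w), ← integral_smul]
    refine integral_congr_ae (Filter.Eventually.of_forall fun u => ?_)
    simp only [k]
    rw [map_smul, smul_smul]
  have hΦg : ∃ R M, IsDensity (fun w => Φ w (g w)) R M := by
    refine ⟨R, N₁ * M, (isBoundedBilinearMap_apply (𝕜 := ℂ)).continuous.comp_aestronglyMeasurable
      (hΦ.continuous.aestronglyMeasurable.prodMk hg.meas), fun w => ?_, fun w hw => ?_⟩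
    · exact (ContinuousLinearMap.le_opNorm _ _).trans
        (mul_le_mul (hΦd.bound w) (hg.bound w) (norm_nonneg _) hΦd.nonneg)
    · rw [hg.supp w hw, map_zero]
  obtain ⟨R₂, N₂, hΦg⟩ := hΦg
  -- Partial fractions: `k(z,w) k(w,u) = k(z,u) (k(z,w) - k(u,w))`. The integral over `w` is then
  -- evaluated by `cauchy_dbar` at `z` and at `u`.
  have hright : ∀ᵐ u, ∫ w, (k z w * k w u) • dbar Φ w (g u) =
      k z u • Φ z (g u) - k z u • Φ u (g u) := by
    filter_upwards [(Set.countable_singleton z).ae_notMem volume] with u hu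
    rw [← smul_sub, ← hC z, ← hC u, ← integral_sub (hCi _ _) (hCi _ _), ← integral_smul]
    refine integral_congr_ae ?_
    filter_upwards [(Set.countable_singleton z).ae_notMem volume,
      (Set.countable_singleton u).ae_notMem volume] with w hwz hwu
    rw [← sub_smul, smul_smul]
    congr 1
    have h1 : z - w ≠ 0 := sub_ne_zero.2 fun h => hwz h.symm
    have h2 : u - w ≠ 0 := sub_ne_zero.2 fun h => hwu h.symm
    have h2' : w - u ≠ 0 := sub_ne_zero.2 fun h => hwu h
    have h3 : z - u ≠ 0 := sub_ne_zero.2 fun h => hu h.symm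
    have hpi : (Real.pi : ℂ) ≠ 0 := by exact_mod_cast Real.pi_ne_zero
    simp only [k]
    rw [show w - u = -(u - w) by ring]
    field_simp
    ring
  have hmain : cauchy (fun w => dbar Φ w (cauchy g w)) z =
      Φ z (cauchy g z) - cauchy (fun w => Φ w (g w)) z := by
    unfold cauchy at hleft ⊢
    rw [← integral_congr_ae (Filter.Eventually.of_forall hleft), hswap, integral_congr_ae hright,
      integral_sub, ← ContinuousLinearMap.integral_comp_comm _ (hg.integrable z)]
    · simp only [k, map_smul]
    · refine ((Φ z).integrable_comp (hg.integrable z)).congr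
        (Filter.Eventually.of_forall fun u => ?_)
      simp only [k, map_smul]
    · exact hΦg.integrable z
  have hDC : ∃ R M, IsDensity (fun w => dbar Φ w (cauchy g w)) R M := by
    obtain ⟨c', hc0', hc'⟩ := IsDensity.exists_norm_cauchy_le (V := V) R
    refine ⟨R', N * (c' * M), (hD.clm_apply hg.continuous_cauchy).aestronglyMeasurable,
      fun w => ?_, fun w hw => ?_⟩
    · exact (ContinuousLinearMap.le_opNorm _ _).trans
        (mul_le_mul (hDd.bound w) (hc' M g hg w) (norm_nonneg _) hDd.nonneg)
    · rw [hDd.supp w hw]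
      rfl
  obtain ⟨R₃, N₃, hDC⟩ := hDC
  have hadd : cauchy (fun w => dbar Φ w (cauchy g w) + Φ w (g w)) z =
      cauchy (fun w => dbar Φ w (cauchy g w)) z + cauchy (fun w => Φ w (g w)) z := by
    rw [cauchy, cauchy, cauchy, ← integral_add (hDC.integrable z) (hΦg.integrable z)]
    simp only [smul_add]
  rw [hadd, hmain, sub_add_cancel]

end Dbar

/-! ### Equations with an operator close to finite rank -/

section Fredholm

variable {X : Type*} [NormedAddCommGroup X] [NormedSpace ℂ X] [CompleteSpace X]

/-- If `K` is close to an operator of finite rank, then `y + K y = T v` has a solution with `v ≠ 0`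
for every linear map `T` from an infinite dimensional space. -/
lemma exists_add_apply_eq {K F : X →L[ℂ] X} (hKF : ‖K - F‖ < 1)
    (hF : FiniteDimensional ℂ (LinearMap.range (F : X →ₗ[ℂ] X))) {S : Type*} [AddCommGroup S]
    [Module ℂ S] (hS : ¬ FiniteDimensional ℂ S) (T : S →ₗ[ℂ] X) :
    ∃ v ≠ 0, ∃ y, y + K y = T v := by
  -- With `N = (1 + K - F)⁻¹`, the vector `y = N (T v)` satisfies `y + K y = T v + F y`. The
  -- requirement `F y = 0` is finitely many linear conditions on `v`, which have a nonzero solution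
  -- in an infinite dimensional space.
  have hu : IsUnit (1 - (F - K)) := isUnit_one_sub_of_norm_lt_one (by rwa [norm_sub_rev])
  obtain ⟨u, hu⟩ := hu
  let N : X →L[ℂ] X := ↑u⁻¹
  have hN : ∀ x, N x + K (N x) - F (N x) = x := fun x => by
    have h1 : (1 - (F - K)) * N = 1 := by rw [← hu]; exact u.mul_inv
    have h2 := DFunLike.congr_fun h1 x
    change N x - (F (N x) - K (N x)) = x at h2
    calc N x + K (N x) - F (N x) = N x - (F (N x) - K (N x)) := by abel
      _ = x := h2
  let L : S →ₗ[ℂ] LinearMap.range (F : X →ₗ[ℂ] X) :=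
    (LinearMap.rangeRestrict (F : X →ₗ[ℂ] X)) ∘ₗ (N : X →ₗ[ℂ] X) ∘ₗ T
  have hL : ¬ Function.Injective L := fun h => hS (FiniteDimensional.of_injective L h)
  rw [injective_iff_map_eq_zero] at hL
  push Not at hL
  obtain ⟨v, hv, hv0⟩ := hL
  refine ⟨v, hv0, N (T v), ?_⟩
  have h3 : F (N (T v)) = 0 := congrArg Subtype.val hv
  have h4 := hN (T v)
  rwa [h3, sub_zero] at h4

variable {Y V : Type*} [TopologicalSpace Y] [CompactSpace Y] [T2Space Y] [NormedAddCommGroup V]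
  [NormedSpace ℂ V] [FiniteDimensional ℂ V]

/-- An operator with equicontinuous image is close to an operator of finite rank. -/
lemma exists_finite_rank (K : C(Y, V) →L[ℂ] C(Y, V))
    (hK : ∀ x : Y, ∀ ε > 0, ∀ᶠ x' in 𝓝 x, ∀ y, ‖K y x' - K y x‖ ≤ ε * ‖y‖) :
    ∃ F : C(Y, V) →L[ℂ] C(Y, V), ‖K - F‖ < 1 ∧
      FiniteDimensional ℂ (LinearMap.range (F : C(Y, V) →ₗ[ℂ] C(Y, V))) := by
  have h1 : ∀ x : Y, ∃ N : Set Y, IsOpen N ∧ x ∈ N ∧ ∀ x' ∈ N, ∀ y,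
      ‖K y x' - K y x‖ ≤ (1 / 2 : ℝ) * ‖y‖ := fun x => by
    obtain ⟨N, hN, hNo, hx⟩ := eventually_nhds_iff.1 (hK x (1 / 2) (by norm_num))
    exact ⟨N, hNo, hx, hN⟩
  choose N hNo hxN hN using h1
  obtain ⟨t, ht⟩ := isCompact_univ.elim_finite_subcover N hNo
    fun x _ => Set.mem_iUnion.2 ⟨x, hxN x⟩
  obtain ⟨f, hf⟩ := PartitionOfUnity.exists_isSubordinate (isClosed_univ (X := Y))
    (fun i : t => N i) (fun i => hNo i) (by
      intro x hx
      obtain ⟨i, hi, hxi⟩ := Set.mem_iUnion₂.1 (ht hx)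
      exact Set.mem_iUnion.2 ⟨⟨i, hi⟩, hxi⟩)
  have hsum : ∀ x, ∑ i, f i x = 1 := fun x => by
    rw [← finsum_eq_sum_of_fintype]
    exact f.sum_eq_one (Set.mem_univ x)
  let G : (t → V) →ₗ[ℂ] C(Y, V) :=
    { toFun := fun b => ⟨fun x => ∑ i, (f i x : ℂ) • b i, by fun_prop⟩
      map_add' := fun b c => by
        ext x
        simp [Finset.sum_add_distrib]
      map_smul' := fun a b => by
        ext x
        simp only [ContinuousMap.coe_mk, Pi.smul_apply, RingHom.id_apply, ContinuousMap.coe_smul,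
          Finset.smul_sum]
        exact Finset.sum_congr rfl fun i _ => smul_comm _ _ _ }
  let H : C(Y, V) →L[ℂ] (t → V) := ContinuousLinearMap.pi fun i =>
    (ContinuousMap.evalCLM ℂ (i : Y)).comp K
  -- `F y` interpolates the values of `K y` at finitely many points by a partition of unity. Its
  -- error is a convex combination of oscillations of `K y`, each at most `‖y‖ / 2`.
  let F : C(Y, V) →L[ℂ] C(Y, V) := (LinearMap.toContinuousLinearMap G).comp H
  have hF : ∀ y x, F y x = ∑ i, (f i x : ℂ) • K y i := fun y x => rfl
  refine ⟨F, lt_of_le_of_lt (ContinuousLinearMap.opNorm_le_bound _ (by norm_num : (0 : ℝ) ≤ 1 / 2)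
    fun y => ?_) (by norm_num), ?_⟩
  · refine (ContinuousMap.norm_le _ (by positivity)).2 fun x => ?_
    have h2 : (K - F) y x = ∑ i, (f i x : ℂ) • (K y x - K y i) := by
      change K y x - F y x = _
      simp only [smul_sub, Finset.sum_sub_distrib, hF]
      congr 1
      rw [← Finset.sum_smul, ← Complex.ofReal_sum, hsum, Complex.ofReal_one, one_smul]
    rw [h2]
    calc _ ≤ ∑ i, f i x * ((1 / 2 : ℝ) * ‖y‖) := by
          refine norm_sum_le_of_le _ fun i _ => ?_
          rw [norm_smul, Complex.norm_real, Real.norm_of_nonneg (f.nonneg i x)]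
          by_cases hx : f i x = 0
          · simp [hx]
          · exact mul_le_mul_of_nonneg_left (hN i x (hf i (subset_tsupport _ hx)) y) (f.nonneg i x)
      _ = _ := by rw [← Finset.sum_mul, hsum, one_mul]
  · have h3 : LinearMap.range (F : C(Y, V) →ₗ[ℂ] C(Y, V)) ≤ LinearMap.range G := by
      rintro _ ⟨y, rfl⟩
      exact ⟨H y, rfl⟩
    exact Submodule.finiteDimensional_of_le h3

end Fredholm

/-! ### Cutting off maps that are holomorphic on an open set -/

section SmoothCutoff

variable {W : Type*} [NormedAddCommGroup W] [NormedSpace ℂ W]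

/-- Nothing is known about `A` outside `O`, but there the product vanishes in a neighbourhood of
each point. -/
lemma contDiff_smul_of_tsupport {f : ℂ → ℂ} {A : ℂ → W} {O : Set ℂ} [CompleteSpace W]
    (hf : ContDiff ℝ 1 f)
    (hO : IsOpen O) (hA : DifferentiableOn ℂ A O) (hs : tsupport f ⊆ O) :
    ContDiff ℝ 1 (fun z => f z • A z) := by
  rw [contDiff_iff_contDiffAt]
  intro z
  by_cases hz : z ∈ tsupport f
  · exact hf.contDiffAt.smul (((hA.contDiffOn hO).contDiffAt (hO.mem_nhds (hs hz))).restrict_scalars ℝ)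
  · refine (contDiffAt_const (c := (0 : W))).congr_of_eventuallyEq ?_
    filter_upwards [notMem_tsupport_iff_eventuallyEq.1 hz] with w hw
    rw [hw, Pi.zero_apply, zero_smul]

lemma dbar_smul_of_tsupport {f : ℂ → ℂ} {A : ℂ → W} {O : Set ℂ} (hf : ContDiff ℝ 1 f)
    (hO : IsOpen O) (hA : DifferentiableOn ℂ A O) (hs : tsupport f ⊆ O) (z : ℂ) :
    dbar (fun z => f z • A z) z = dbar f z • A z := by
  by_cases hz : z ∈ tsupport f
  · exact dbar_smul (hf.differentiable (by simp) z) (hA.differentiableAt (hO.mem_nhds (hs hz)))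
  · have h := notMem_tsupport_iff_eventuallyEq.1 hz
    rw [dbar_eq_zero h, zero_smul]
    refine dbar_eq_zero ?_
    filter_upwards [h] with w hw
    rw [hw, Pi.zero_apply, zero_smul]

end SmoothCutoff

/-! ### Sections of a holomorphic cocycle on the plane -/

section Cocycle

open Metric

/-- A holomorphic cocycle on a finite open cover of the plane, one of whose members `U o` contains
a neighbourhood of infinity, with a smooth partition of unity. -/
structure PlaneCocycle (κ V : Type*) [Fintype κ] [NormedAddCommGroup V] [NormedSpace ℂ V] where
  U : κ → Set ℂ
  isOpen : ∀ k, IsOpen (U k)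
  A : κ → κ → ℂ → V →L[ℂ] V
  hol : ∀ k j, DifferentiableOn ℂ (A k j) (U k ∩ U j)
  self_apply : ∀ k, ∀ z ∈ U k, ∀ v, A k k z v = v
  comp_apply : ∀ l k j z, z ∈ U l → z ∈ U k → z ∈ U j → ∀ v, A l k z (A k j z v) = A l j z v
  φ : κ → ℂ → ℂ
  smooth : ∀ k, ContDiff ℝ 1 (φ k)
  subordinate : ∀ k, tsupport (φ k) ⊆ U k
  sum_eq_one : ∀ z, ∑ k, φ k z = 1
  o : κ
  R : ℝ
  eq_zero : ∀ k, k ≠ o → ∀ z, R < ‖z‖ → φ k z = 0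

namespace PlaneCocycle

variable {κ V : Type*} [Fintype κ] [NormedAddCommGroup V] [NormedSpace ℂ V]
  (D : PlaneCocycle κ V)

lemma eq_one {z : ℂ} (hz : D.R < ‖z‖) : D.φ D.o z = 1 := by
  rw [← D.sum_eq_one z, eq_comm]
  exact Finset.sum_eq_single_of_mem D.o (Finset.mem_univ _) fun k _ hk => D.eq_zero k hk z hz

/-- Beyond radius `R` the partition of unity is locally constant. This confines the integral
equation to the compact sets `Q k`. -/
lemma dbar_eq_zero_of_lt (k : κ) {z : ℂ} (hz : D.R < ‖z‖) : dbar (D.φ k) z = 0 := by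
  have h : ∀ᶠ w in 𝓝 z, D.R < ‖w‖ := continuous_norm.continuousAt.eventually (lt_mem_nhds hz)
  by_cases hk : k = D.o
  · subst hk
    rw [dbar_congr (g := fun _ => 1) (h.mono fun w hw => D.eq_one hw)]
    simp [dbar]
  · exact dbar_eq_zero (h.mono fun w hw => D.eq_zero k hk w hw)

/-- The compact part of the support of a member of the partition of unity. -/
def Q (k : κ) : Set ℂ := tsupport (D.φ k) ∩ closedBall 0 D.R

lemma isCompact_Q (k : κ) : IsCompact (D.Q k) :=
  (isCompact_closedBall _ _).inter_left (isClosed_tsupport _)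

instance (k : κ) : CompactSpace (D.Q k) := isCompact_iff_compactSpace.1 (D.isCompact_Q k)

/-- The disjoint union of the compact sets `Q k`. -/
abbrev Dom : Type _ := Σ k, D.Q k

/-- The derivatives of the transition maps cut off by the partition of unity. -/
def a (k j : κ) (z : ℂ) : V →L[ℂ] V := dbar (D.φ j) z • D.A k j z

lemma continuousOn_a (k j : κ) : ContinuousOn (D.a k j) (D.U k) := by
  intro z hz
  refine ContinuousAt.continuousWithinAt ?_
  by_cases h : z ∈ tsupport (D.φ j)
  · exact (continuous_dbar (D.smooth j)).continuousAt.smul ((D.hol k j).continuousOn.continuousAt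
      (((D.isOpen k).inter (D.isOpen j)).mem_nhds ⟨hz, D.subordinate j h⟩))
  · refine (continuousAt_const (y := (0 : V →L[ℂ] V))).congr ?_
    filter_upwards [(isClosed_tsupport (D.φ j)).isOpen_compl.mem_nhds h] with w hw
    rw [a, dbar_eq_zero (notMem_tsupport_iff_eventuallyEq.1 hw), zero_smul]

/-- The cocycle relation is available only on `U j`; off the support of `φ j` both sides vanish. -/
lemma comp_a {l k j : κ} {z : ℂ} (hl : z ∈ D.U l) (hk : z ∈ D.U k) (v : V) :
    D.A l k z (D.a k j z v) = D.a l j z v := by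
  by_cases h : z ∈ tsupport (D.φ j)
  · change D.A l k z (dbar (D.φ j) z • D.A k j z v) = dbar (D.φ j) z • D.A l j z v
    rw [map_smul, D.comp_apply l k j z hl hk (D.subordinate j h)]
  · simp [a, dbar_eq_zero (notMem_tsupport_iff_eventuallyEq.1 h)]

open scoped Classical in
/-- The extension by zero of a continuous function on `Q j`. -/
def ext (j : κ) (y : C(D.Dom, V)) (w : ℂ) : V := if h : w ∈ D.Q j then y ⟨j, w, h⟩ else 0

lemma ext_of_mem {j : κ} {w : ℂ} (h : w ∈ D.Q j) (y : C(D.Dom, V)) :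
    D.ext j y w = y ⟨j, w, h⟩ := dif_pos h

lemma ext_of_notMem {j : κ} {w : ℂ} (h : w ∉ D.Q j) (y : C(D.Dom, V)) : D.ext j y w = 0 :=
  dif_neg h

lemma isDensity_ext (j : κ) (y : C(D.Dom, V)) : IsDensity (D.ext j y) D.R ‖y‖ where
  meas := by
    have h1 : ContinuousOn (D.ext j y) (D.Q j) := by
      rw [continuousOn_iff_continuous_domRestrict]
      have : (D.Q j).domRestrict (D.ext j y) = fun x => y ⟨j, x⟩ := by
        ext x
        exact D.ext_of_mem x.2 y
      rw [this]
      exact y.continuous.comp continuous_sigmaMk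
    have hm := (D.isCompact_Q j).isClosed.measurableSet
    have h2 := (aestronglyMeasurable_indicator_iff (μ := MeasureTheory.volume) hm).2 (h1.aestronglyMeasurable hm)
    have h3 : (D.Q j).indicator (D.ext j y) = D.ext j y :=
      Set.indicator_eq_self.2 (Function.support_subset_iff'.2 fun w h => D.ext_of_notMem h y)
    rwa [h3] at h2
  bound w := by
    by_cases h : w ∈ D.Q j
    · rw [D.ext_of_mem h]
      exact y.norm_coe_le_norm _
    · rw [D.ext_of_notMem h, norm_zero]
      exact norm_nonneg _
  supp w hw := D.ext_of_notMem (fun h => by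
    have := mem_closedBall_zero_iff.1 h.2
    linarith) y

lemma ext_add (j : κ) (y y' : C(D.Dom, V)) (w : ℂ) :
    D.ext j (y + y') w = D.ext j y w + D.ext j y' w := by
  unfold ext
  split_ifs <;> simp

lemma ext_smul (j : κ) (c : ℂ) (y : C(D.Dom, V)) (w : ℂ) :
    D.ext j (c • y) w = c • D.ext j y w := by
  unfold ext
  split_ifs <;> simp

lemma cauchy_ext_add (j : κ) (y y' : C(D.Dom, V)) (z : ℂ) :
    cauchy (D.ext j (y + y')) z = cauchy (D.ext j y) z + cauchy (D.ext j y') z := by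
  unfold cauchy
  rw [← MeasureTheory.integral_add ((D.isDensity_ext j y).integrable z)
    ((D.isDensity_ext j y').integrable z)]
  simp only [D.ext_add, smul_add]

lemma cauchy_ext_smul (j : κ) (c : ℂ) (y : C(D.Dom, V)) (z : ℂ) :
    cauchy (D.ext j (c • y)) z = c • cauchy (D.ext j y) z := by
  unfold cauchy
  rw [← MeasureTheory.integral_smul]
  simp only [D.ext_smul]
  exact MeasureTheory.integral_congr_ae (Filter.Eventually.of_forall fun w => smul_comm _ _ _)

lemma exists_bound_a : ∃ B : ℝ, 0 ≤ B ∧ ∀ k j, ∀ z ∈ D.Q k, ‖D.a k j z‖ ≤ B := by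
  have h1 : ∀ k j, ∃ B : ℝ, ∀ z ∈ D.Q k, ‖D.a k j z‖ ≤ B := fun k j =>
    (D.isCompact_Q k).exists_bound_of_continuousOn ((D.continuousOn_a k j).mono
      (Set.inter_subset_left.trans (D.subordinate k)))
  choose B hB using h1
  refine ⟨∑ k, ∑ j, |B k j|, by positivity, fun k j z hz => (hB k j z hz).trans ?_⟩
  calc B k j ≤ |B k j| := le_abs_self _
    _ ≤ ∑ j, |B k j| := Finset.single_le_sum (f := fun j => |B k j|) (fun _ _ => abs_nonneg _)
        (Finset.mem_univ j)
    _ ≤ _ := Finset.single_le_sum (f := fun k => ∑ j, |B k j|)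
        (fun _ _ => Finset.sum_nonneg fun _ _ => abs_nonneg _) (Finset.mem_univ k)

lemma continuous_a (k j : κ) : Continuous fun z : D.Q k => D.a k j z :=
  continuousOn_iff_continuous_domRestrict.1 ((D.continuousOn_a k j).mono
    (Set.inter_subset_left.trans (D.subordinate k)))

/-- The integral operator whose solutions give sections. -/
def opLin : C(D.Dom, V) →ₗ[ℂ] C(D.Dom, V) where
  toFun y := ⟨fun x => ∑ j, D.a x.1 j x.2 (cauchy (D.ext j y) x.2), by
    refine continuous_sigma fun k => ?_
    refine continuous_finsetSum _ fun j _ => ?_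
    exact (D.continuous_a k j).clm_apply
      ((D.isDensity_ext j y).continuous_cauchy.comp continuous_subtype_val)⟩
  map_add' y y' := by
    ext x
    simp [D.cauchy_ext_add, Finset.sum_add_distrib]
  map_smul' c y := by
    ext x
    simp [D.cauchy_ext_smul, Finset.smul_sum]

lemma opLin_apply (y : C(D.Dom, V)) (k : κ) (z : D.Q k) :
    D.opLin y ⟨k, z⟩ = ∑ j, D.a k j z (cauchy (D.ext j y) z) := rfl

lemma exists_norm_opLin_le : ∃ B : ℝ, ∀ y, ‖D.opLin y‖ ≤ B * ‖y‖ := by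
  obtain ⟨B, hB0, hB⟩ := D.exists_bound_a
  obtain ⟨c, hc0, hc⟩ := IsDensity.exists_norm_cauchy_le (V := V) D.R
  refine ⟨∑ _j : κ, B * c, fun y => (ContinuousMap.norm_le _ (by positivity)).2 ?_⟩
  rintro ⟨k, z⟩
  rw [opLin_apply, Finset.sum_mul]
  refine norm_sum_le_of_le _ fun j _ => (ContinuousLinearMap.le_opNorm _ _).trans ?_
  rw [mul_assoc]
  exact mul_le_mul (hB k j z z.2) (hc _ _ (D.isDensity_ext j y) z) (norm_nonneg _) hB0

/-- Compactness of the operator: Cauchy transforms are bounded and Hölder continuous with constants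
proportional to `‖y‖`, and the coefficients `a` are continuous. -/
lemma equicontinuous_opLin (x : D.Dom) {ε : ℝ} (hε : 0 < ε) :
    ∀ᶠ x' in 𝓝 x, ∀ y, ‖D.opLin y x' - D.opLin y x‖ ≤ ε * ‖y‖ := by
  obtain ⟨k, z⟩ := x
  obtain ⟨c, hc0, hc⟩ := IsDensity.exists_norm_cauchy_le (V := V) D.R
  obtain ⟨c', hc0', hc'⟩ := IsDensity.exists_norm_cauchy_sub_le (V := V) D.R
  rw [Sigma.nhds_mk, Filter.eventually_map]
  have h1 : Tendsto (fun z' : D.Q k => ∑ j, (‖D.a k j z' - D.a k j z‖ * c +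
      ‖D.a k j z‖ * (c' * ‖(z' : ℂ) - z‖ ^ (1 / 2 : ℝ)))) (𝓝 z) (𝓝 0) := by
    have hcont : Continuous (fun z' : D.Q k => ∑ j, (‖D.a k j z' - D.a k j z‖ * c +
        ‖D.a k j z‖ * (c' * ‖(z' : ℂ) - z‖ ^ (1 / 2 : ℝ)))) := by
      refine continuous_finsetSum _ fun j _ => ?_
      refine Continuous.add (((D.continuous_a k j).sub continuous_const).norm.mul continuous_const)
        (continuous_const.mul (continuous_const.mul
          (Continuous.rpow_const (by fun_prop) fun _ => Or.inr (by norm_num))))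
    simpa using hcont.tendsto z
  filter_upwards [h1.eventually (gt_mem_nhds hε)] with z' hz' y
  rw [opLin_apply, opLin_apply, ← Finset.sum_sub_distrib]
  refine (norm_sum_le_of_le _ fun j _ => ?_).trans
    ((Finset.sum_mul _ _ _).symm.le.trans (mul_le_mul_of_nonneg_right hz'.le (norm_nonneg y)))
  have h2 : D.a k j z' (cauchy (D.ext j y) z') - D.a k j z (cauchy (D.ext j y) z) =
      (D.a k j z' - D.a k j z) (cauchy (D.ext j y) z') +
        D.a k j z (cauchy (D.ext j y) z' - cauchy (D.ext j y) z) := by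
    rw [map_sub, sub_apply]
    abel
  rw [h2, add_mul]
  refine (norm_add_le _ _).trans (add_le_add ((ContinuousLinearMap.le_opNorm _ _).trans ?_)
    ((ContinuousLinearMap.le_opNorm _ _).trans ?_))
  · rw [mul_assoc]
    exact mul_le_mul_of_nonneg_left (hc _ _ (D.isDensity_ext j y) z') (norm_nonneg _)
  · rw [mul_assoc]
    refine mul_le_mul_of_nonneg_left ((hc' _ _ (D.isDensity_ext j y) z' z).trans (le_of_eq ?_))
      (norm_nonneg _)
    ring

/-- The data of sections given by multiples of `v` near infinity. -/
def source (v : V) : Polynomial ℂ →ₗ[ℂ] C(D.Dom, V) where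
  toFun p := ⟨fun x => D.a x.1 D.o x.2 (p.eval (x.2 : ℂ) • v), by
    refine continuous_sigma fun k => ?_
    exact (D.continuous_a k D.o).clm_apply
      ((p.continuous.comp continuous_subtype_val).smul continuous_const)⟩
  map_add' p p' := by
    ext x
    simp [add_smul]
  map_smul' c p := by
    ext x
    simp [mul_smul]

/-- The obstruction to solving the integral equation is finite dimensional, while the space of
polynomials is not. -/
lemma exists_opLin_eq [FiniteDimensional ℂ V] (v : V) :
    ∃ p ≠ 0, ∃ y, y + D.opLin y = D.source v p := by
  have : CompleteSpace V := FiniteDimensional.complete ℂ V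
  obtain ⟨B, hB⟩ := D.exists_norm_opLin_le
  obtain ⟨F, hF, hF'⟩ := exists_finite_rank (D.opLin.mkContinuous B hB)
    fun x ε hε => D.equicontinuous_opLin x hε
  refine exists_add_apply_eq hF hF' (fun h => ?_) (D.source v)
  exact Polynomial.not_finite (R := ℂ) h

section Solution

variable {D} {v : V} {p : Polynomial ℂ} {y : C(D.Dom, V)}

variable (D v p y) in
/-- The section given by a solution of the integral equation. -/
def sol (k : κ) (z : ℂ) : V :=
  -- With `C y_j` the Cauchy transform of `y_j`, formally `∂̄ (C y_j) = y_j`, so `∂̄` of this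
  -- expression is `a_{k o} (p v) - ∑ a_{k j} C y_j - ∑ φ_j A_{k j} y_j`. It vanishes by the
  -- integral equation, see `sum_ext_eq`.
  D.φ D.o z • D.A k D.o z (p.eval z • v) - ∑ j, D.φ j z • D.A k j z (cauchy (D.ext j y) z)

lemma comp_sol {l k : κ} {z : ℂ} (hl : z ∈ D.U l) (hk : z ∈ D.U k) :
    D.A l k z (D.sol v p y k z) = D.sol v p y l z := by
  have h : ∀ j u, D.A l k z (D.φ j z • D.A k j z u) = D.φ j z • D.A l j z u := fun j u => by
    by_cases h : z ∈ tsupport (D.φ j)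
    · rw [map_smul, D.comp_apply l k j z hl hk (D.subordinate j h)]
    · simp [image_eq_zero_of_notMem_tsupport h]
  unfold sol
  rw [map_sub, map_sum, h]
  simp only [h]

/-- Near infinity only the member `o` of the partition of unity survives, so the difference is minus
a Cauchy transform. -/
lemma tendsto_sol : Tendsto (fun z => D.sol v p y D.o z - p.eval z • v) (Bornology.cobounded ℂ)
    (𝓝 0) := by
  have h1 := (D.isDensity_ext D.o y).tendsto_cauchy.neg
  rw [neg_zero] at h1
  refine h1.congr' ?_
  filter_upwards [tendsto_norm_cobounded_atTop.eventually (eventually_gt_atTop D.R)] with z hz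
  have h2 := D.eq_one hz
  have h3 : z ∈ D.U D.o := D.subordinate D.o (subset_tsupport _ (by simp [h2]))
  unfold sol
  rw [Finset.sum_eq_single_of_mem D.o (Finset.mem_univ _) fun k _ hk => by
    rw [D.eq_zero k hk z hz, zero_smul], h2, one_smul, one_smul, D.self_apply _ z h3,
    D.self_apply _ z h3]
  abel

/-- On `Q j` the integral equation expresses `y` in terms of the index `j`. The map `A k j` turns
this into the same expression for the index `k`, so the weights `φ j` just add up to `1`. Beyond
radius `R` both sides vanish. -/
lemma sum_ext_eq (h : y + D.opLin y = D.source v p) {k : κ} {z : ℂ} (hz : z ∈ D.U k) :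
    ∑ j, D.φ j z • D.A k j z (D.ext j y z) =
      D.a k D.o z (p.eval z • v) - ∑ j, D.a k j z (cauchy (D.ext j y) z) := by
  by_cases hR : D.R < ‖z‖
  · have h1 : ∀ j, D.ext j y z = 0 := fun j => (D.isDensity_ext j y).supp z hR
    have h2 : ∀ j, D.a k j z = 0 := fun j => by rw [a, D.dbar_eq_zero_of_lt j hR, zero_smul]
    simp [h1, h2]
  · have h1 : ∀ j, D.φ j z • D.A k j z (D.ext j y z) = D.φ j z •
        (D.a k D.o z (p.eval z • v) - ∑ j, D.a k j z (cauchy (D.ext j y) z)) := fun j => by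
      by_cases hj : z ∈ tsupport (D.φ j)
      · have hQ : z ∈ D.Q j := ⟨hj, mem_closedBall_zero_iff.2 (not_lt.1 hR)⟩
        have hUj := D.subordinate j hj
        have h2 := DFunLike.congr_fun h ⟨j, z, hQ⟩
        change y ⟨j, z, hQ⟩ + ∑ i, D.a j i z (cauchy (D.ext i y) z) =
          D.a j D.o z (p.eval z • v) at h2
        rw [D.ext_of_mem hQ, eq_sub_of_add_eq h2, map_sub, map_sum, D.comp_a hz hUj]
        simp only [D.comp_a hz hUj]
      · simp [image_eq_zero_of_notMem_tsupport hj]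
    rw [Finset.sum_congr rfl fun j _ => h1 j, ← Finset.sum_smul, D.sum_eq_one, one_smul]

/-- The formal computation of `∂̄ sol` is made rigorous by localization: a cutoff `χ` near `z₀`
makes all factors compactly supported, and then `χ sol` is the Cauchy transform of a density that
vanishes near `z₀`. -/
lemma differentiableAt_sol [FiniteDimensional ℂ V] (h : y + D.opLin y = D.source v p) {k : κ} {z₀ : ℂ} (hz : z₀ ∈ D.U k) :
    DifferentiableAt ℂ (D.sol v p y k) z₀ := by
  have : CompleteSpace V := FiniteDimensional.complete ℂ V
  obtain ⟨ε, hε, hball⟩ := Metric.isOpen_iff.1 (D.isOpen k) z₀ hz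
  let b : ContDiffBump z₀ := ⟨ε / 4, ε / 2, by positivity, by linarith⟩
  let χ : ℂ → ℂ := fun z => (b z : ℂ)
  have hχs : ContDiff ℝ 1 χ := Complex.ofRealCLM.contDiff.comp b.contDiff
  have hχt : tsupport χ ⊆ closedBall z₀ (ε / 2) := by
    refine closure_minimal (fun z hz => ?_) isClosed_closedBall
    have : z ∈ Function.support b := fun h => hz (by simp [χ, h])
    rw [b.support_eq] at this
    exact ball_subset_closedBall this
  have hχc : HasCompactSupport χ :=
    (isCompact_closedBall z₀ (ε / 2)).of_isClosed_subset (isClosed_tsupport _) hχt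
  have hχU : tsupport χ ⊆ D.U k :=
    (hχt.trans (closedBall_subset_ball (by linarith))).trans hball
  have hχ1 : ∀ z ∈ ball z₀ (ε / 4), χ z = 1 := fun z hz => by
    simp only [χ]
    rw [b.one_of_mem_closedBall (ball_subset_closedBall hz), Complex.ofReal_one]
  have hf : ∀ j, ContDiff ℝ 1 fun z => χ z * D.φ j z := fun j => hχs.mul (D.smooth j)
  have hft : ∀ j, tsupport (fun z => χ z * D.φ j z) ⊆ D.U k ∩ D.U j := fun j =>
    Set.subset_inter ((tsupport_mul_subset_left (f := χ)).trans hχU)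
      ((tsupport_mul_subset_right (f := χ)).trans (D.subordinate j))
  have hfc : ∀ j, HasCompactSupport fun z => χ z * D.φ j z := fun j => hχc.mul_right
  have hO : ∀ j, IsOpen (D.U k ∩ D.U j) := fun j => (D.isOpen k).inter (D.isOpen j)
  let Φ : κ → ℂ → V →L[ℂ] V := fun j z => (χ z * D.φ j z) • D.A k j z
  have hΦ : ∀ j, ContDiff ℝ 1 (Φ j) := fun j =>
    contDiff_smul_of_tsupport (hf j) (hO j) (D.hol k j) (hft j)
  have hΦc : ∀ j, HasCompactSupport (Φ j) := fun j => (hfc j).smul_right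
  have hAv : DifferentiableOn ℂ (fun z => D.A k D.o z (p.eval z • v)) (D.U k ∩ D.U D.o) :=
    (D.hol k D.o).clm_apply (p.differentiable.differentiableOn.smul_const v)
  let Ψ : ℂ → V := fun z => (χ z * D.φ D.o z) • D.A k D.o z (p.eval z • v)
  have hΨ : ContDiff ℝ 1 Ψ := contDiff_smul_of_tsupport (hf D.o) (hO D.o) hAv (hft D.o)
  have hΨc : HasCompactSupport Ψ := (hfc D.o).smul_right
  -- By `apply_cauchy`, `H j` is the density whose Cauchy transform is `Φ j` applied to the
  -- transform of `y` on `Q j`.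
  let H : κ → ℂ → V := fun j w => dbar (Φ j) w (cauchy (D.ext j y) w) + Φ j w (D.ext j y w)
  have hH : ∀ j z, Φ j z (cauchy (D.ext j y) z) = cauchy (H j) z := fun j z =>
    apply_cauchy (hΦ j) (hΦc j) (D.isDensity_ext j y) z
  obtain ⟨c, hc0, hc⟩ := IsDensity.exists_norm_cauchy_le (V := V) D.R
  have hHd : ∀ j, ∃ R M, IsDensity (H j) R M := fun j => by
    obtain ⟨R, M, h1⟩ := (hΦc j).dbar.exists_isDensity (continuous_dbar (hΦ j))
    obtain ⟨R', M', h2⟩ := (hΦc j).exists_isDensity (hΦ j).continuous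
    refine ⟨max R R', M * (c * ‖y‖) + M' * ‖y‖, ?_, fun w => ?_, fun w hw => ?_⟩
    · exact ((continuous_dbar (hΦ j)).clm_apply
        (D.isDensity_ext j y).continuous_cauchy).aestronglyMeasurable.add
        ((isBoundedBilinearMap_apply (𝕜 := ℂ)).continuous.comp_aestronglyMeasurable
          ((hΦ j).continuous.aestronglyMeasurable.prodMk (D.isDensity_ext j y).meas))
    · refine (norm_add_le _ _).trans (add_le_add ((ContinuousLinearMap.le_opNorm _ _).trans ?_)
        ((ContinuousLinearMap.le_opNorm _ _).trans ?_))
      · exact mul_le_mul (h1.bound w) (hc _ _ (D.isDensity_ext j y) w) (norm_nonneg _) h1.nonneg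
      · exact mul_le_mul (h2.bound w) ((D.isDensity_ext j y).bound w) (norm_nonneg _) h2.nonneg
    · simp only [H]
      rw [h1.supp w ((le_max_left _ _).trans_lt hw), h2.supp w ((le_max_right _ _).trans_lt hw)]
      simp
  obtain ⟨R₀, M₀, hΨd⟩ := hΨc.dbar.exists_isDensity (continuous_dbar hΨ)
  choose R M hHd using hHd
  let g : ℂ → V := fun w => dbar Ψ w - ∑ j, H j w
  -- The radius dominates `R₀` and all `R j`, whatever their signs, because `R₀ + |R₀| ≥ 0`.
  have hg : IsDensity g (R₀ + ∑ j, |R j| + |R₀|) (M₀ + ∑ j, M j) := by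
    refine ⟨hΨd.meas.sub (Finset.aestronglyMeasurable_fun_sum _ fun j _ => (hHd j).meas), fun w => ?_, fun w hw => ?_⟩
    · refine (norm_sub_le _ _).trans (add_le_add (hΨd.bound w) ?_)
      exact norm_sum_le_of_le _ fun j _ => (hHd j).bound w
    · have h1 : ∀ j, R j < ‖w‖ := fun j => by
        have := Finset.single_le_sum (f := fun j => |R j|) (fun _ _ => abs_nonneg _)
          (Finset.mem_univ j)
        have := le_abs_self (R j)
        have := neg_abs_le R₀
        linarith
      have h2 : R₀ < ‖w‖ := by
        have := abs_nonneg R₀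
        have : 0 ≤ ∑ j, |R j| := by positivity
        linarith
      simp only [g]
      rw [hΨd.supp w h2, Finset.sum_eq_zero fun j _ => (hHd j).supp w (h1 j), sub_zero]
  have hcg : ∀ z, cauchy g z = Ψ z - ∑ j, Φ j z (cauchy (D.ext j y) z) := fun z => by
    have h1 : cauchy g z = cauchy (dbar Ψ) z - ∑ j, cauchy (H j) z := by
      simp only [cauchy, g, smul_sub, Finset.smul_sum]
      rw [MeasureTheory.integral_sub (hΨd.integrable z)
        (MeasureTheory.integrable_finsetSum _ fun j _ => (hHd j).integrable z),
        MeasureTheory.integral_finsetSum _ fun j _ => (hHd j).integrable z]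
    rw [h1, cauchy_dbar hΨ hΨc]
    simp only [hH]
  -- Where `χ = 1` the density is the formal `∂̄ sol`, which `sum_ext_eq` identifies as zero.
  have hzero : ∀ᶠ z in 𝓝 z₀, g z = 0 := by
    filter_upwards [ball_mem_nhds z₀ (by positivity : 0 < ε / 4)] with z hzb
    have hzU : z ∈ D.U k := hball (ball_subset_ball (by linarith) hzb)
    have h1 : ∀ j, dbar (fun z => χ z * D.φ j z) z = dbar (D.φ j) z := fun j => by
      refine dbar_congr ?_
      filter_upwards [isOpen_ball.mem_nhds hzb] with w hw
      rw [hχ1 w hw, one_mul]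
    have h2 : dbar Ψ z = D.a k D.o z (p.eval z • v) := by
      refine (dbar_smul_of_tsupport (hf D.o) (hO D.o) hAv (hft D.o) z).trans ?_
      rw [h1]
      rfl
    have h3 : ∀ j, H j z = D.a k j z (cauchy (D.ext j y) z) +
        D.φ j z • D.A k j z (D.ext j y z) := fun j => by
      have h4 : dbar (Φ j) z = D.a k j z := by
        refine (dbar_smul_of_tsupport (hf j) (hO j) (D.hol k j) (hft j) z).trans ?_
        rw [h1]
        rfl
      have h5 : Φ j z = D.φ j z • D.A k j z := by
        simp only [Φ]
        rw [hχ1 z hzb, one_mul]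
      simp only [H]
      rw [h4, h5]
      rfl
    simp only [g]
    rw [h2, Finset.sum_congr rfl fun j _ => h3 j, Finset.sum_add_distrib, sum_ext_eq h hzU]
    abel
  refine (hg.differentiableAt_cauchy hzero).congr_of_eventuallyEq ?_
  filter_upwards [ball_mem_nhds z₀ (by positivity : 0 < ε / 4)] with z hzb
  rw [hcg]
  simp only [sol, Ψ, Φ]
  rw [hχ1 z hzb]
  simp

end Solution

/-- A holomorphic cocycle on the plane has a section with prescribed direction at infinity. -/
theorem exists_section [FiniteDimensional ℂ V] (v : V) : ∃ p : Polynomial ℂ, p ≠ 0 ∧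
    ∃ s : κ → ℂ → V, (∀ k, ∀ z ∈ D.U k, DifferentiableAt ℂ (s k) z) ∧
      (∀ l k z, z ∈ D.U l → z ∈ D.U k → D.A l k z (s k z) = s l z) ∧
      Tendsto (fun z => s D.o z - p.eval z • v) (Bornology.cobounded ℂ) (𝓝 0) := by
  obtain ⟨p, hp, y, h⟩ := D.exists_opLin_eq v
  exact ⟨p, hp, D.sol v p y, fun k z hz => differentiableAt_sol h hz,
    fun l k z hl hk => comp_sol hl hk, tendsto_sol⟩

end PlaneCocycle

end Cocycle

/-! ### Meromorphic sections of holomorphic bundles -/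

namespace HolBundle

variable {r : ℕ}

lemma differentiableAt_comp_ofCoord {V : Type*} [NormedAddCommGroup V] [NormedSpace ℂ V]
    [CompleteSpace V] {f : CP1 → V} {z : ℂ} (hf : HolAt f (CP1.ofCoord 0 z)) :
    DifferentiableAt ℂ (fun z => f (CP1.ofCoord 0 z)) z :=
  ((CP1.holAt_ofCoord_iff 0 z).1 hf).differentiableAt

lemma exists_radius {O : Set CP1} (hO : IsOpen O) (h : CP1.infty ∈ O) :
    ∃ R : ℝ, 0 < R ∧ ∀ z : ℂ, R < ‖z‖ → CP1.ofCoord 0 z ∈ O := by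
  have h1 : ∀ᶠ w in 𝓝 (0 : ℂ), CP1.ofCoord 1 w ∈ O :=
    (CP1.continuous_ofCoord 1).continuousAt.eventually (hO.mem_nhds h)
  obtain ⟨ε, hε, hb⟩ := Metric.eventually_nhds_iff_ball.1 h1
  refine ⟨ε⁻¹, inv_pos.2 hε, fun z hz => ?_⟩
  have hz0 : 0 < ‖z‖ := (inv_pos.2 hε).trans hz
  have hz' : z ≠ 0 := norm_pos_iff.1 hz0
  have := hb z⁻¹ (by
    rw [mem_ball_zero_iff, norm_inv]
    exact inv_lt_of_inv_lt₀ hε hz)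
  rwa [CP1.ofCoord_one_eq (inv_ne_zero hz'), inv_inv] at this

/-- A holomorphic bundle is given by a cocycle on a finite cover of the plane. -/
lemma exists_planeCocycle (E : HolBundle r) : ∃ (κ : Type) (_ : Fintype κ)
    (D : PlaneCocycle κ (Fin r → ℂ)) (i : κ → E.ι), i D.o = E.idx CP1.infty ∧
      (∀ k, ∀ z ∈ D.U k, CP1.ofCoord 0 z ∈ E.base (i k)) ∧
      ∀ k j z, D.A k j z = E.core.coordChange (i j) (i k) (CP1.ofCoord 0 z) := by
  classical
  obtain ⟨R, hR0, hR⟩ := exists_radius (E.isOpen_base (E.idx CP1.infty)) (E.mem_base_idx _)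
  let N : ℂ → Set ℂ := fun x => CP1.ofCoord 0 ⁻¹' E.base (E.idx (CP1.ofCoord 0 x))
  have hN : ∀ x, IsOpen (N x) := fun x => (E.isOpen_base _).preimage (CP1.continuous_ofCoord 0)
  obtain ⟨t, ht⟩ := (isCompact_closedBall (0 : ℂ) R).elim_finite_subcover N hN
    fun x _ => Set.mem_iUnion.2 ⟨x, E.mem_base_idx _⟩
  let i : Option t → E.ι := fun k => k.elim (E.idx CP1.infty) fun x => E.idx (CP1.ofCoord 0 x)
  -- The member `none` covers everything beyond radius `R`. The others are cut to radius `R + 1`, so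
  -- that their partition functions vanish beyond `R + 1`.
  let U : Option t → Set ℂ := fun k => k.elim (CP1.ofCoord 0 ⁻¹' E.base (E.idx CP1.infty))
    fun x => N x ∩ Metric.ball 0 (R + 1)
  have hU : ∀ k, IsOpen (U k) := fun k => by
    cases k with
    | none => exact (E.isOpen_base _).preimage (CP1.continuous_ofCoord 0)
    | some x => exact (hN x).inter Metric.isOpen_ball
  have hUi : ∀ k, ∀ z ∈ U k, CP1.ofCoord 0 z ∈ E.base (i k) := fun k z hz => by
    cases k with
    | none => exact hz
    | some x => exact hz.1
  have hcov : (Set.univ : Set ℂ) ⊆ ⋃ k, U k := fun z _ => by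
    by_cases hz : ‖z‖ ≤ R
    · obtain ⟨x, hx, hzx⟩ := Set.mem_iUnion₂.1 (ht (mem_closedBall_zero_iff.2 hz))
      refine Set.mem_iUnion.2 ⟨some ⟨x, hx⟩, hzx, ?_⟩
      rw [mem_ball_zero_iff]
      linarith
    · exact Set.mem_iUnion.2 ⟨none, hR z (not_le.1 hz)⟩
  obtain ⟨f, hf⟩ := SmoothPartitionOfUnity.exists_isSubordinate 𝓘(ℝ, ℂ) isClosed_univ U hU hcov
  have hsupp : ∀ k, tsupport (fun z => (f k z : ℂ)) ⊆ U k := fun k => by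
    refine (closure_mono fun z hz => ?_).trans (hf k)
    intro h
    exact hz (by simp only [h, Complex.ofReal_zero])
  refine ⟨Option t, inferInstance,
    { U := U
      isOpen := hU
      A := fun k j z => E.core.coordChange (i j) (i k) (CP1.ofCoord 0 z)
      hol := fun k j z hz => (differentiableAt_comp_ofCoord
        (E.holAt_coordChange (hUi j z hz.2) (hUi k z hz.1))).differentiableWithinAt
      self_apply := fun k z hz v => E.core.coordChange_self (i k) _ (hUi k z hz) v
      comp_apply := fun l k j z hl hk hj v => E.core.coordChange_comp (i j) (i k) (i l) _
        ⟨⟨hUi j z hj, hUi k z hk⟩, hUi l z hl⟩ v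
      φ := fun k z => (f k z : ℂ)
      smooth := fun k => Complex.ofRealCLM.contDiff.comp ((f k).contMDiff.contDiff.of_le (by simp))
      subordinate := hsupp
      sum_eq_one := fun z => by
        rw [← Complex.ofReal_sum, ← finsum_eq_sum_of_fintype, f.sum_eq_one (Set.mem_univ z),
          Complex.ofReal_one]
      o := none
      R := R + 1
      eq_zero := fun k hk z hz => by
        cases k with
        | none => exact absurd rfl hk
        | some x =>
          refine image_eq_zero_of_notMem_tsupport (f := fun z => (f (some x) z : ℂ)) fun h => ?_
          have := mem_ball_zero_iff.1 (hsupp (some x) h).2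
          linarith }, i, rfl, hUi, fun k j z => rfl⟩

/-- Every holomorphic bundle has sections over the affine line with a pole at infinity in a given
direction. -/
theorem exists_section (E : HolBundle r) (v : Fin r → ℂ) : ∃ p : Polynomial ℂ, p ≠ 0 ∧
    ∃ σ : ∀ x, E.Fiber x, (∀ z, E.SecAt σ (CP1.ofCoord 0 z)) ∧
      Tendsto (fun z => E.toC (E.idx CP1.infty) (CP1.ofCoord 0 z) (σ (CP1.ofCoord 0 z)) -
        p.eval z • v) (Bornology.cobounded ℂ) (𝓝 0) := by
  obtain ⟨κ, hκ, D, i, hio, hi, hA⟩ := E.exists_planeCocycle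
  obtain ⟨p, hp, s, hs, hcomp, hlim⟩ := D.exists_section v
  have hcov : ∀ z, ∃ k, z ∈ D.U k := fun z => by
    by_contra h
    push Not at h
    have h1 := D.sum_eq_one z
    rw [Finset.sum_eq_zero fun k _ =>
      image_eq_zero_of_notMem_tsupport fun hk => h k (D.subordinate k hk)] at h1
    exact zero_ne_one h1
  choose k hk using hcov
  -- At each point any member of the cover may be used to define the section; the compatibility
  -- `hcomp` makes the choice immaterial.
  let σ : ∀ x, E.Fiber x := fun x => E.ofC (i (k (CP1.coord 0 x))) x
    (s (k (CP1.coord 0 x)) (CP1.coord 0 x))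
  have hσ : ∀ l, ∀ z ∈ D.U l, E.toC (i l) (CP1.ofCoord 0 z) (σ (CP1.ofCoord 0 z)) = s l z := by
    intro l z hz
    simp only [σ, CP1.coord_ofCoord]
    rw [E.toC_ofC' (hi _ _ (hk z)) (hi _ _ hz), ← hA]
    exact hcomp l (k z) z hz (hk z)
  refine ⟨p, hp, σ, fun z => ?_, hlim.congr' ?_⟩
  · rw [E.secAt_iff (hi _ _ (hk z)), CP1.holAt_ofCoord_iff]
    have h1 : AnalyticAt ℂ (s (k z)) z := by
      refine DifferentiableOn.analyticAt (s := D.U (k z)) (fun w hw =>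
        (hs (k z) w hw).differentiableWithinAt) ((D.isOpen _).mem_nhds (hk z))
    refine h1.congr ?_
    filter_upwards [(D.isOpen _).mem_nhds (hk z)] with w hw
    exact (hσ (k z) w hw).symm
  · filter_upwards [tendsto_norm_cobounded_atTop.eventually (eventually_gt_atTop D.R)] with z hz
    have h2 : z ∈ D.U D.o :=
      D.subordinate D.o (subset_tsupport _ (by simp [D.eq_one hz]))
    rw [← hσ D.o z h2, hio]

end HolBundle

/-! ### Determinants of pairs of sections and their order at infinity -/

/-- The determinant of two vectors in the plane. -/
def det₂ (u v : Fin 2 → ℂ) : ℂ := u 0 * v 1 - u 1 * v 0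

lemma det₂_map (A : (Fin 2 → ℂ) →ₗ[ℂ] (Fin 2 → ℂ)) (u v : Fin 2 → ℂ) :
    det₂ (A u) (A v) = LinearMap.det A * det₂ u v := by
  have h : ∀ u, A u = u 0 • A (Pi.single 0 1) + u 1 • A (Pi.single 1 1) := fun u => by
    conv_lhs => rw [pi_eq_sum_univ' u]
    simp
  rw [← LinearMap.det_toMatrix', Matrix.det_fin_two, h u, h v]
  simp only [LinearMap.toMatrix'_apply, det₂, Pi.add_apply, Pi.smul_apply, smul_eq_mul]
  ring

lemma det₂_smul_smul (a b : ℂ) (u v : Fin 2 → ℂ) : det₂ (a • u) (b • v) = a * b * det₂ u v := by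
  simp only [det₂, Pi.smul_apply, smul_eq_mul]
  ring

lemma det₂_swap (u v : Fin 2 → ℂ) : det₂ v u = -det₂ u v := by
  simp only [det₂]
  ring

lemma bijective_of_det₂_ne_zero (A : (Fin 2 → ℂ) →ₗ[ℂ] (Fin 2 → ℂ))
    (h : det₂ (A (Pi.single 0 1)) (A (Pi.single 1 1)) ≠ 0) : Function.Bijective A := by
  rw [det₂_map] at h
  exact (LinearMap.equivOfDetNeZero A (left_ne_zero_of_mul h)).bijective

/-- Dependent vectors in the plane satisfy a relation. -/
lemma exists_relation_of_det₂_eq_zero {u v : Fin 2 → ℂ} (h : det₂ u v = 0) :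
    (∃ c : ℂ, u + c • v = 0) ∨ v = 0 := by
  by_cases hv : v = 0
  · exact Or.inr hv
  refine Or.inl ?_
  obtain ⟨k, hk⟩ := Function.ne_iff.1 hv
  refine ⟨-(u k / v k), funext fun l => ?_⟩
  have hk' : v k ≠ 0 := hk
  simp only [det₂] at h
  simp only [Pi.add_apply, Pi.smul_apply, smul_eq_mul, Pi.zero_apply]
  field_simp
  fin_cases k <;> fin_cases l <;> simp at * <;>
    first | done | linear_combination h | linear_combination -h

namespace HolBundle

variable {r : ℕ}

lemma SecAt.add {E : HolBundle r} {σ τ : ∀ x, E.Fiber x} {x : CP1} (hσ : E.SecAt σ x)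
    (hτ : E.SecAt τ x) : E.SecAt (fun y => σ y + τ y) x := by
  rw [E.secAt_iff (E.mem_base_idx x)] at *
  refine HolAt.eventually_eq (hσ.add hτ) (Filter.Eventually.of_forall fun y => ?_)
  exact map_add (E.toC _ y) _ _

lemma SecAt.smul {E : HolBundle r} {f : CP1 → ℂ} {σ : ∀ x, E.Fiber x} {x : CP1} (hf : HolAt f x)
    (hσ : E.SecAt σ x) : E.SecAt (fun y => f y • σ y) x := by
  rw [E.secAt_iff (E.mem_base_idx x)] at *
  refine HolAt.eventually_eq (hf.smul hσ) (Filter.Eventually.of_forall fun y => ?_)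
  exact map_smul (E.toC _ y) _ _

lemma SecAt.eventually_eq {E : HolBundle r} {σ τ : ∀ x, E.Fiber x} {x : CP1} (hσ : E.SecAt σ x)
    (h : ∀ᶠ y in 𝓝 x, τ y = σ y) : E.SecAt τ x := by
  rw [E.secAt_iff (E.mem_base_idx x)] at *
  exact hσ.eventually_eq (h.mono fun y hy => congrArg _ hy)

/-- The determinant of two sections of a bundle of rank two. -/
def detSec {E : HolBundle 2} (σ τ : ∀ x, E.Fiber x) : ∀ x, E.det.Fiber x :=
  fun x => (fun _ => det₂ (σ x) (τ x) : Fin 1 → ℂ)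

lemma toC_detSec {E : HolBundle 2} (σ τ : ∀ x, E.Fiber x) (i : E.ι) (x : CP1) :
    E.det.toC i x (detSec σ τ x) = fun _ => det₂ (E.toC i x (σ x)) (E.toC i x (τ x)) :=
  funext fun _ => (det₂_map (E.toC i x) (σ x) (τ x)).symm

lemma secAt_detSec {E : HolBundle 2} {σ τ : ∀ x, E.Fiber x} {x : CP1} (hσ : E.SecAt σ x)
    (hτ : E.SecAt τ x) : E.det.SecAt (detSec σ τ) x := by
  refine (E.det.secAt_iff (i := E.idx x) (E.mem_base_idx x)).2 ?_
  rw [E.secAt_iff (E.mem_base_idx x)] at hσ hτ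
  have hc : ∀ {f : CP1 → Fin 2 → ℂ} (_ : HolAt f x) (k : Fin 2), HolAt (fun y => f y k) x :=
    fun hf k => hf.clm_comp (ContinuousLinearMap.proj (R := ℂ) (φ := fun _ : Fin 2 => ℂ) k)
  have h1 : HolAt (fun y => det₂ (E.toC (E.idx x) y (σ y)) (E.toC (E.idx x) y (τ y))) x :=
    ((hc hσ 0).mul (hc hτ 1)).sub ((hc hσ 1).mul (hc hτ 0))
  have h2 : HolAt (fun y => (fun _ => det₂ (E.toC (E.idx x) y (σ y)) (E.toC (E.idx x) y (τ y)) :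
      Fin 1 → ℂ)) x := contMDiffAt_pi_space.2 fun _ => h1
  exact h2.eventually_eq (Filter.Eventually.of_forall fun y => toC_detSec σ τ _ y)

/-- `σ` is a section over the affine line that is `w ^ a` times the section `t` near infinity, where
`w` is the coordinate at infinity. -/
structure IsPolar (E : HolBundle r) (a : ℤ) (σ t : ∀ x, E.Fiber x) : Prop where
  hol : ∀ x, x ≠ CP1.infty → E.SecAt σ x
  hol_infty : E.SecAt t CP1.infty
  eq : ∀ᶠ x in 𝓝[≠] CP1.infty, σ x = CP1.coord 1 x ^ a • t x

/-- The coordinate at infinity is holomorphic near infinity. -/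
lemma holAt_coord {i : Fin 2} {x : CP1} (hx : x ∈ CP1.chartSet i) : HolAt (CP1.coord i) x :=
  (contMDiffOn_of_mem_maximalAtlas (CP1.chart_mem_maximalAtlas i)).contMDiffAt
    ((CP1.isOpen_chartSet i).mem_nhds hx)

lemma eventually_coord_ne_zero : ∀ᶠ x in 𝓝[≠] CP1.infty, CP1.coord 1 x ≠ 0 ∧
    CP1.coord 0 x = (CP1.coord 1 x)⁻¹ := by
  filter_upwards [self_mem_nhdsWithin, nhdsWithin_le_nhds
    ((CP1.isOpen_chartSet 1).mem_nhds CP1.infty_mem)] with x hx hx1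
  have := CP1.coord_mul_coord (i := 0) (j := 1) (by decide) x (CP1.mem_chartSet_zero_iff.2 hx) hx1
  exact ⟨right_ne_zero_of_mul_eq_one this, eq_inv_of_mul_eq_one_left this⟩

/-- Every direction at infinity is the direction of a section with a pole. -/
lemma exists_isPolar (E : HolBundle r) (v : Fin r → ℂ) : ∃ (a : ℤ) (σ t : ∀ x, E.Fiber x),
    E.IsPolar a σ t ∧ ∃ c : ℂ, c ≠ 0 ∧ t CP1.infty = (c • v : Fin r → ℂ) := by
  obtain ⟨p, hp, σ, hσ, hlim⟩ := E.exists_section v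
  set j := E.idx CP1.infty
  set m := p.natDegree
  let S : ℂ → Fin r → ℂ := fun z => E.toC j (CP1.ofCoord 0 z) (σ (CP1.ofCoord 0 z))
  -- The error term tends to zero at infinity, so with the value `0` at `w = 0` it extends
  -- holomorphically by the removable singularity theorem.
  let e : ℂ → Fin r → ℂ := Function.update (fun w => S w⁻¹ - p.eval w⁻¹ • v) 0 0
  have he : ∀ w ≠ 0, e w = S w⁻¹ - p.eval w⁻¹ • v := fun w hw => Function.update_of_ne hw _ _
  have hlim' : Tendsto (fun w : ℂ => S w⁻¹ - p.eval w⁻¹ • v) (𝓝[≠] 0) (𝓝 0) :=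
    hlim.comp tendsto_inv₀_nhdsNE_zero
  obtain ⟨R, hR0, hR⟩ := exists_radius (E.isOpen_base j) (E.mem_base_idx _)
  have hSd : ∀ z : ℂ, R < ‖z‖ → DifferentiableAt ℂ S z := fun z hz =>
    differentiableAt_comp_ofCoord (f := fun x => E.toC j x (σ x))
      ((E.secAt_iff (hR z hz)).1 (hσ z))
  have hea : AnalyticAt ℂ e 0 := by
    refine Complex.analyticAt_of_differentiable_on_punctured_nhds_of_continuousAt ?_
      (continuousAt_update_same.2 hlim')
    have h1 : ∀ᶠ w : ℂ in 𝓝[≠] 0, R < ‖w⁻¹‖ :=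
      (tendsto_norm_cobounded_atTop.comp tendsto_inv₀_nhdsNE_zero).eventually
        (eventually_gt_atTop R)
    filter_upwards [h1, self_mem_nhdsWithin] with w hw hw0
    have hw0' : w ≠ 0 := hw0
    have h2 : DifferentiableAt ℂ (fun w : ℂ => S w⁻¹ - p.eval w⁻¹ • v) w := by
      have hi : DifferentiableAt ℂ (fun w : ℂ => w⁻¹) w := differentiableAt_inv hw0'
      exact ((hSd _ hw).comp w hi).sub
        (((p.differentiable _).comp w hi).smul_const v)
    refine h2.congr_of_eventuallyEq ?_
    filter_upwards [isOpen_compl_singleton.mem_nhds hw0] with y hy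
    exact he y hy
  -- `g w` is `w ^ m` times the section at `w⁻¹`, with `m` the degree of `p`. The reversed
  -- polynomial shows that `g 0` is the leading coefficient times `v`, so it is a nonzero multiple
  -- of `v` and the exponent is `-m`.
  let g : ℂ → Fin r → ℂ := fun w => p.reverse.eval w • v + w ^ m • e w
  have hga : AnalyticAt ℂ g 0 :=
    ((p.reverse.differentiable.analyticAt 0).smul analyticAt_const).add
      ((analyticAt_id.pow m).smul hea)
  have hg0 : g 0 = p.leadingCoeff • v := by
    simp only [g]
    rw [show e 0 = 0 from Function.update_self _ _ _, smul_zero, add_zero,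
      ← Polynomial.coeff_zero_eq_eval_zero, Polynomial.coeff_zero_reverse]
  have hg : ∀ w ≠ 0, w ^ (-(m : ℤ)) • g w = S w⁻¹ := fun w hw => by
    have h1 : p.reverse.eval w * (w⁻¹) ^ m = p.eval w⁻¹ := by
      let _ : Invertible w⁻¹ := invertibleOfNonzero (inv_ne_zero hw)
      have := Polynomial.eval₂_reverse_mul_pow (RingHom.id ℂ) w⁻¹ p
      rw [invOf_eq_inv, inv_inv] at this
      exact this
    have h2 : w ^ (-(m : ℤ)) = w⁻¹ ^ m := by rw [zpow_neg, zpow_natCast, inv_pow]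
    simp only [g]
    rw [he w hw, smul_add, smul_smul, h2, mul_comm, h1, smul_smul, ← mul_pow, inv_mul_cancel₀ hw,
      one_pow, one_smul]
    abel
  refine ⟨-(m : ℤ), σ, fun x => E.ofC j x (g (CP1.coord 1 x)), ⟨fun x hx => ?_, ?_, ?_⟩,
    p.leadingCoeff, Polynomial.leadingCoeff_ne_zero.2 hp, ?_⟩
  · rcases CP1.cases_point x with rfl | ⟨z, rfl⟩
    · exact absurd rfl hx
    · exact hσ z
  · refine E.secAt_ofC (E.mem_base_idx _) ?_
    rw [CP1.holAt_iff 1 CP1.infty_mem, CP1.coord_infty]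
    refine hga.congr (Filter.Eventually.of_forall fun w => ?_)
    simp only [Function.comp_apply, CP1.coord_ofCoord]
  · filter_upwards [eventually_coord_ne_zero, nhdsWithin_le_nhds
      ((CP1.isOpen_chartSet 1).mem_nhds CP1.infty_mem), nhdsWithin_le_nhds
      ((E.isOpen_base j).mem_nhds (E.mem_base_idx _))] with x hx hx1 hxj
    rw [← map_smul, hg _ hx.1]
    simp only [S]
    rw [← CP1.ofCoord_one_eq hx.1, CP1.ofCoord_coord 1 x hx1, E.ofC_toC hxj]
  · simp only [CP1.coord_infty, hg0]
    exact E.core.coordChange_self j _ (E.mem_base_idx _) _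

/-- The determinant of two sections of a bundle with trivial determinant, as an entire function. -/
lemma IsPolar.exists_det {E : HolBundle 2} (hE : E.HasTrivialDet) {a₀ a₁ : ℤ}
    {σ₀ σ₁ t₀ t₁ : ∀ x, E.Fiber x} (h₀ : E.IsPolar a₀ σ₀ t₀) (h₁ : E.IsPolar a₁ σ₁ t₁)
    (h : det₂ (t₀ CP1.infty) (t₁ CP1.infty) ≠ 0) : ∃ H : ℂ → ℂ, Differentiable ℂ H ∧
      (∀ z, H z = 0 ↔ det₂ (σ₀ (CP1.ofCoord 0 z)) (σ₁ (CP1.ofCoord 0 z)) = 0) ∧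
      ∃ G : ℂ → ℂ, ContinuousAt G 0 ∧ G 0 ≠ 0 ∧
        ∀ᶠ w in 𝓝[≠] 0, H w⁻¹ = w ^ (a₀ + a₁) * G w := by
  obtain ⟨φ⟩ := hE
  -- The trivialization `φ` of the determinant bundle turns determinants of sections into functions
  -- without changing their zeros.
  let δ : (∀ x, E.det.Fiber x) → CP1 → ℂ := fun s x => (φ.hom.app x (s x) : Fin 1 → ℂ) 0
  have hδ : ∀ s x, E.det.SecAt s x → HolAt (δ s) x := fun s x hs => by
    have h1 := φ.hom.secAt hs
    rw [(O 0).secAt_iff ((O 0).mem_base_idx x)] at h1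
    have h2 : HolAt (fun y => (φ.hom.app y (s y) : Fin 1 → ℂ)) x :=
      h1.eventually_eq (Filter.Eventually.of_forall fun y => (O_zero_toC _ y _).symm)
    exact h2.clm_comp (ContinuousLinearMap.proj (R := ℂ) (φ := fun _ : Fin 1 => ℂ) 0)
  have hδ0 : ∀ (σ τ : ∀ x, E.Fiber x) x, δ (detSec σ τ) x = 0 ↔ det₂ (σ x) (τ x) = 0 := by
    intro σ τ x
    constructor
    · intro h0
      have h1 : φ.hom.app x (detSec σ τ x) = 0 := funext fun k => by
        fin_cases k
        exact h0
      have h2 := φ.inv_hom_apply x (detSec σ τ x)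
      rw [h1, map_zero] at h2
      exact (congrFun h2 (0 : Fin 1)).symm
    · intro h0
      have h1 : detSec σ τ x = 0 := funext fun _ => h0
      simp only [δ]
      rw [h1, map_zero]
      rfl
  refine ⟨fun z => δ (detSec σ₀ σ₁) (CP1.ofCoord 0 z), fun z => ?_, fun z => hδ0 _ _ _,
    fun w => δ (detSec t₀ t₁) (CP1.ofCoord 1 w), ?_, ?_, ?_⟩
  · have hz := CP1.ofCoord_ne_infty z
    exact differentiableAt_comp_ofCoord (hδ _ _ (secAt_detSec (h₀.hol _ hz) (h₁.hol _ hz)))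
  · exact ((CP1.holAt_ofCoord_iff 1 0).1
      (hδ _ CP1.infty (secAt_detSec h₀.hol_infty h₁.hol_infty))).continuousAt
  · exact fun h0 => h ((hδ0 _ _ _).1 h0)
  · have h1 : ∀ᶠ x in 𝓝[≠] CP1.infty, δ (detSec σ₀ σ₁) x =
        CP1.coord 1 x ^ (a₀ + a₁) * δ (detSec t₀ t₁) x := by
      filter_upwards [h₀.eq, h₁.eq, eventually_coord_ne_zero] with x hx0 hx1 hw
      have h2 : detSec σ₀ σ₁ x = CP1.coord 1 x ^ (a₀ + a₁) • detSec t₀ t₁ x := funext fun _ => by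
        refine (congrArg₂ det₂ hx0 hx1).trans ((det₂_smul_smul _ _ (t₀ x) (t₁ x)).trans ?_)
        rw [← zpow_add₀ hw.1]
        rfl
      simp only [δ]
      rw [h2, map_smul]
      rfl
    rw [eventually_nhdsWithin_iff, CP1.ofCoord_eventually 1 CP1.infty_mem, CP1.coord_infty] at h1
    rw [eventually_nhdsWithin_iff]
    filter_upwards [h1] with w hw hw0
    have hw0' : w ≠ 0 := hw0
    have h2 := hw (by
      rw [CP1.ofCoord_one_eq hw0']
      exact CP1.ofCoord_ne_infty _)
    rw [CP1.coord_ofCoord] at h2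
    refine Eq.trans ?_ h2
    rw [CP1.ofCoord_one_eq hw0']

end HolBundle

/-! ### Entire functions of given order at infinity -/

section Liouville

variable {H G : ℂ → ℂ} {a : ℤ}

lemma tendsto_zpow_mul (hG : ContinuousAt G 0) (ha : 0 ≤ a) :
    Tendsto (fun w => w ^ a * G w) (𝓝[≠] 0) (𝓝 (0 ^ a * G 0)) :=
  ((continuousAt_zpow₀ 0 a (Or.inr ha)).mul hG).mono_left nhdsWithin_le_nhds

/-- An entire function with behaviour `z ^ (-a)` at infinity has `a ≤ 0`. -/
lemma Differentiable.order_nonpos (hH : Differentiable ℂ H) (hG : ContinuousAt G 0) (hG0 : G 0 ≠ 0)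
    (h : ∀ᶠ w in 𝓝[≠] 0, H w⁻¹ = w ^ a * G w) : a ≤ 0 := by
  by_contra ha
  push Not at ha
  have h1 := (tendsto_zpow_mul hG ha.le).congr' (h.mono fun _ h => h.symm)
  rw [zero_zpow _ ha.ne', zero_mul] at h1
  have h2 := hH.eq_of_tendsto_inv h1
  have h3 : ∀ᶠ w in 𝓝[≠] (0 : ℂ), G w ≠ 0 := nhdsWithin_le_nhds (hG.eventually_ne hG0)
  obtain ⟨w, hw, hw3, hw0⟩ := (h.and (h3.and self_mem_nhdsWithin)).exists
  rw [h2] at hw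
  exact mul_ne_zero (zpow_ne_zero a hw0) hw3 hw.symm

/-- Such a function is constant, equal to its nonzero limit at infinity. -/
lemma Differentiable.ne_zero_of_order_zero (hH : Differentiable ℂ H) (hG : ContinuousAt G 0)
    (hG0 : G 0 ≠ 0) (h : ∀ᶠ w in 𝓝[≠] 0, H w⁻¹ = w ^ a * G w) (ha : a = 0) (z : ℂ) : H z ≠ 0 := by
  have h1 := (tendsto_zpow_mul hG ha.ge).congr' (h.mono fun _ h => h.symm)
  rw [hH.eq_of_tendsto_inv h1, ha, zpow_zero, one_mul]
  exact hG0

/-- Without zeros, the inverse would be entire of order `-a > 0` at infinity, contrary to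
`Differentiable.order_nonpos`. -/
lemma Differentiable.exists_eq_zero_of_order_neg (hH : Differentiable ℂ H) (hG : ContinuousAt G 0)
    (hG0 : G 0 ≠ 0) (h : ∀ᶠ w in 𝓝[≠] 0, H w⁻¹ = w ^ a * G w) (ha : a < 0) : ∃ z, H z = 0 := by
  by_contra hne
  push Not at hne
  have := Differentiable.order_nonpos (H := fun z => (H z)⁻¹) (G := fun w => (G w)⁻¹) (a := -a)
    (hH.inv hne) (hG.inv₀ hG0) (inv_ne_zero hG0) (h.mono fun w hw => by
      rw [hw, mul_inv, zpow_neg])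
  omega

end Liouville

/-! ### The Birkhoff–Grothendieck theorem -/

namespace HolBundle

/-- If a combination of two sections vanishes at a point, it can be divided by a linear function. -/
lemma IsPolar.exists_div {r : ℕ} {E : HolBundle r} {a₀ a₁ : ℤ} {σ₀ σ₁ t₀ t₁ : ∀ x, E.Fiber x}
    (h₀ : E.IsPolar a₀ σ₀ t₀) (h₁ : E.IsPolar a₁ σ₁ t₁) {c : ℂ} (hc : c = 0 ∨ a₀ ≤ a₁) {x₀ : CP1}
    (hx₀ : x₀ ≠ CP1.infty) (h : σ₀ x₀ + c • σ₁ x₀ = 0) : ∃ σ t : ∀ x, E.Fiber x,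
      E.IsPolar (a₀ + 1) σ t ∧ ∃ b : ℂ, t CP1.infty = t₀ CP1.infty + b • t₁ CP1.infty := by
  classical
  let τ : ∀ x, E.Fiber x := fun x => σ₀ x + c • σ₁ x
  have hτ : ∀ x, x ≠ CP1.infty → E.SecAt τ x := fun x hx =>
    (h₀.hol x hx).add (SecAt.smul (f := fun _ => c) contMDiffAt_const (h₁.hol x hx))
  set z₀ := CP1.coord 0 x₀
  have hx₀c : x₀ ∈ CP1.chartSet 0 := CP1.mem_chartSet_zero_iff.2 hx₀
  have hi := E.mem_base_idx x₀
  set i := E.idx x₀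
  obtain ⟨κ, hκ, hκτ⟩ := exists_holAt_smul (CP1.chart_mem_maximalAtlas 0) hx₀c
    ((E.secAt_iff hi).1 (hτ x₀ hx₀)) (by
      change E.toC i x₀ (σ₀ x₀ + c • σ₁ x₀) = 0
      rw [h, map_zero])
  have hκτ' : ∀ᶠ y in 𝓝 x₀, E.toC i y (τ y) = (CP1.coord 0 y - z₀) • κ y := hκτ
  have hne : ∀ y, y ≠ CP1.infty → y ≠ x₀ → CP1.coord 0 y - z₀ ≠ 0 := fun y hy hyx h0 => by
    apply hyx
    rw [← CP1.ofCoord_coord 0 y (CP1.mem_chartSet_zero_iff.2 hy), sub_eq_zero.1 h0,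
      CP1.ofCoord_coord 0 x₀ hx₀c]
  let σ : ∀ x, E.Fiber x := fun x =>
    if x = x₀ then E.ofC i x (κ x) else (CP1.coord 0 x - z₀)⁻¹ • τ x
  have hσ : ∀ x, x ≠ x₀ → σ x = (CP1.coord 0 x - z₀)⁻¹ • τ x := fun x hx => if_neg hx
  -- For `a₀ ≤ a₁` the summand `c σ₁` is `w ^ a₀` times `c w ^ m t₁`, so the combination has order
  -- at least `a₀` at infinity. Division by `z - z₀ = w⁻¹ (1 - z₀ w)` raises the exponent by one.
  -- For `c = 0` the value of `m` plays no role.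
  let m : ℕ := (a₁ - a₀).toNat
  let t : ∀ x, E.Fiber x := fun x =>
    (1 - z₀ * CP1.coord 1 x)⁻¹ • (t₀ x + (c * CP1.coord 1 x ^ m) • t₁ x)
  have hw : HolAt (CP1.coord 1) CP1.infty := holAt_coord CP1.infty_mem
  have hw1 : HolAt (fun x => 1 - z₀ * CP1.coord 1 x) CP1.infty :=
    contMDiffAt_const.sub (contMDiffAt_const.mul hw)
  have hw10 : 1 - z₀ * CP1.coord 1 CP1.infty ≠ 0 := by simp [CP1.coord_infty]
  refine ⟨σ, t, ⟨fun x hx => ?_, ?_, ?_⟩, c * 0 ^ m, ?_⟩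
  · by_cases hxx : x = x₀
    · subst hxx
      refine SecAt.eventually_eq (E.secAt_ofC hi hκ) ?_
      filter_upwards [hκτ', (E.isOpen_base i).mem_nhds hi,
        isClosed_singleton.isOpen_compl.mem_nhds (show x ∈ ({CP1.infty} : Set CP1)ᶜ from hx)]
        with y hy hyi hy'
      by_cases hyx : y = x
      · exact if_pos hyx
      · rw [hσ y hyx]
        apply E.toC_injective hyi
        rw [map_smul, hy, E.toC_ofC hyi, inv_smul_smul₀ (hne y hy' hyx)]
    · refine SecAt.eventually_eq (SecAt.smul (f := fun y => (CP1.coord 0 y - z₀)⁻¹)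
        (HolAt.inv₀ ((holAt_coord (CP1.mem_chartSet_zero_iff.2 hx)).sub contMDiffAt_const)
          (hne x hx hxx)) (hτ x hx)) ?_
      filter_upwards [isClosed_singleton.isOpen_compl.mem_nhds
        (show x ∈ ({x₀} : Set CP1)ᶜ from hxx)] with y hy
      exact hσ y hy
  · exact SecAt.smul (f := fun x => (1 - z₀ * CP1.coord 1 x)⁻¹) (hw1.inv₀ hw10)
      (h₀.hol_infty.add (SecAt.smul (f := fun x => c * CP1.coord 1 x ^ m)
        (contMDiffAt_const.mul (hw.pow m)) h₁.hol_infty))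
  · filter_upwards [h₀.eq, h₁.eq, eventually_coord_ne_zero, nhdsWithin_le_nhds
      (isClosed_singleton.isOpen_compl.mem_nhds
        (show CP1.infty ∈ ({x₀} : Set CP1)ᶜ from fun h => hx₀ h.symm)),
      nhdsWithin_le_nhds (hw1.continuousAt.eventually_ne hw10)] with x hx0 hx1 hwx hxx hx10
    rw [hσ x hxx]
    simp only [τ, t]
    rw [hx0, hx1, hwx.2]
    set w := CP1.coord 1 x
    have hw0 : w ≠ 0 := hwx.1
    have e1 : (w⁻¹ - z₀)⁻¹ = w * (1 - z₀ * w)⁻¹ := by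
      rw [show w⁻¹ - z₀ = w⁻¹ * (1 - z₀ * w) by field_simp, mul_inv, inv_inv]
    have e2 : c * w ^ a₁ = c * (w ^ m * w ^ a₀) := by
      rcases hc with hc | hc
      · simp [hc]
      · rw [← zpow_natCast, ← zpow_add₀ hw0]
        congr 2
        omega
    rw [e1, zpow_add₀ hw0, zpow_one, smul_smul, e2]
    simp only [smul_add, smul_smul]
    congr 2 <;> ring
  · simp [t, CP1.coord_infty]

/-- A bundle with trivial determinant has a frame of sections of opposite order at infinity. -/
lemma exists_isPolar_frame {E : HolBundle 2} (hE : E.HasTrivialDet) (N : ℕ) : ∀ {a₀ a₁ : ℤ}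
    {σ₀ σ₁ t₀ t₁ : ∀ x, E.Fiber x}, E.IsPolar a₀ σ₀ t₀ → E.IsPolar a₁ σ₁ t₁ →
    det₂ (t₀ CP1.infty) (t₁ CP1.infty) ≠ 0 → a₀ + a₁ = -(N : ℤ) →
    ∃ (a₀ a₁ : ℤ) (σ₀ σ₁ t₀ t₁ : ∀ x, E.Fiber x), E.IsPolar a₀ σ₀ t₀ ∧ E.IsPolar a₁ σ₁ t₁ ∧
      det₂ (t₀ CP1.infty) (t₁ CP1.infty) ≠ 0 ∧ a₀ + a₁ = 0 := by
  induction N with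
  | zero => exact fun h₀ h₁ h ha => ⟨_, _, _, _, _, _, h₀, h₁, h, by simpa using ha⟩
  | succ N ih =>
    intro a₀ a₁ σ₀ σ₁ t₀ t₁ h₀ h₁ h ha
    obtain ⟨H, hH, hHz, G, hG, hG0, hHG⟩ := h₀.exists_det hE h₁ h
    -- A negative total exponent forces a zero of the determinant, where the two sections are
    -- dependent. Dividing a combination by a linear function raises the total exponent by one.
    obtain ⟨z, hz⟩ := hH.exists_eq_zero_of_order_neg hG hG0 hHG (by omega)
    have hx₀ := CP1.ofCoord_ne_infty z
    set x₀ := CP1.ofCoord 0 z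
    have hdet : ∀ (u v : Fin 2 → ℂ) (b : ℂ), det₂ (u + b • v) v = det₂ u v := fun u v b => by
      simp only [det₂, Pi.add_apply, Pi.smul_apply, smul_eq_mul]
      ring
    have hstep : ∀ {a₀ a₁ : ℤ} {σ₀ σ₁ t₀ t₁ : ∀ x, E.Fiber x}, E.IsPolar a₀ σ₀ t₀ →
        E.IsPolar a₁ σ₁ t₁ → det₂ (t₀ CP1.infty) (t₁ CP1.infty) ≠ 0 →
        a₀ + a₁ = -((N + 1 : ℕ) : ℤ) → ∀ c : ℂ, (c = 0 ∨ a₀ ≤ a₁) → σ₀ x₀ + c • σ₁ x₀ = 0 →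
        ∃ (a₀ a₁ : ℤ) (σ₀ σ₁ t₀ t₁ : ∀ x, E.Fiber x), E.IsPolar a₀ σ₀ t₀ ∧ E.IsPolar a₁ σ₁ t₁ ∧
          det₂ (t₀ CP1.infty) (t₁ CP1.infty) ≠ 0 ∧ a₀ + a₁ = 0 := by
      intro a₀ a₁ σ₀ σ₁ t₀ t₁ h₀ h₁ h ha c hc hx
      obtain ⟨σ, t, hσ, b, hb⟩ := h₀.exists_div h₁ hc hx₀ hx
      refine ih hσ h₁ ?_ (by push_cast at ha; omega)
      have h2 := hdet (t₀ CP1.infty) (t₁ CP1.infty) b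
      rw [hb]
      exact fun h3 => h (h2.symm.trans h3)
    have h' : det₂ (t₁ CP1.infty) (t₀ CP1.infty) ≠ 0 :=
      (det₂_swap (t₀ CP1.infty) (t₁ CP1.infty)).trans_ne (neg_ne_zero.2 h)
    have ha' : a₁ + a₀ = -((N + 1 : ℕ) : ℤ) := by omega
    rcases exists_relation_of_det₂_eq_zero ((hHz z).1 hz) with ⟨c, hc⟩ | hv
    · by_cases hca : c = 0 ∨ a₀ ≤ a₁
      · exact hstep h₀ h₁ h ha c hca hc
      · push Not at hca
        refine hstep h₁ h₀ h' ha' c⁻¹ (Or.inr hca.2.le) ?_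
        have hc' : σ₀ x₀ + c • σ₁ x₀ = 0 := hc
        rw [← inv_smul_smul₀ hca.1 (σ₁ x₀), ← smul_add, add_comm, hc', smul_zero]
    · refine hstep h₁ h₀ h' ha' 0 (Or.inl rfl) ?_
      rw [zero_smul, add_zero]
      exact hv

/-- A bundle with trivial determinant is a sum of two line bundles. -/
theorem exists_iso_split {E : HolBundle 2} (hE : E.HasTrivialDet) :
    ∃ (a : Fin 2 → ℤ), a 0 + a 1 = 0 ∧ Nonempty (Iso (split a) E) := by
  obtain ⟨b₀, σ₀', t₀', h₀', c₀, hc₀, ht₀⟩ := E.exists_isPolar (Pi.single 0 1)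
  obtain ⟨b₁, σ₁', t₁', h₁', c₁, hc₁, ht₁⟩ := E.exists_isPolar (Pi.single 1 1)
  have hdet : det₂ (t₀' CP1.infty) (t₁' CP1.infty) ≠ 0 := by
    rw [ht₀, ht₁]
    refine (det₂_smul_smul _ _ _ _).trans_ne ?_
    simp [det₂, hc₀, hc₁]
  obtain ⟨H, hH, -, G, hG, hG0, hHG⟩ := h₀'.exists_det hE h₁' hdet
  have hb := hH.order_nonpos hG hG0 hHG
  obtain ⟨a₀, a₁, σ₀, σ₁, t₀, t₁, h₀, h₁, h, ha⟩ :=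
    exists_isPolar_frame hE (-(b₀ + b₁)).toNat h₀' h₁' hdet (by omega)
  obtain ⟨H, hH, hHz, G, hG, hG0, hHG⟩ := h₀.exists_det hE h₁ h
  -- With total exponent zero the determinant has no zeros, so the two sections form a frame over
  -- the affine line, and `t₀`, `t₁` do so at infinity.
  have hHne := hH.ne_zero_of_order_zero hG hG0 hHG ha
  obtain ⟨f, hf, hf'⟩ := exists_hom_split (E := E) ![a₀, a₁] ![σ₀, σ₁] ![t₀, t₁]
    (Fin.forall_fin_two.2 ⟨h₀.hol, h₁.hol⟩) (Fin.forall_fin_two.2 ⟨h₀.hol_infty, h₁.hol_infty⟩)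
    (Fin.forall_fin_two.2 ⟨h₀.eq, h₁.eq⟩)
  have hbij : ∀ (x : CP1) (s₀ s₁ : E.Fiber x), (∀ v : Fin 2 → ℂ, f.app x v =
      ∑ k, v k • (![s₀, s₁] : Fin 2 → E.Fiber x) k) → det₂ s₀ s₁ ≠ 0 →
      Function.Bijective (f.app x) := by
    intro x s₀ s₁ hs hne
    refine bijective_of_det₂_ne_zero (f.app x) ?_
    have e0 : f.app x (Pi.single 0 1 : Fin 2 → ℂ) = s₀ := by
      rw [hs]
      simp
    have e1 : f.app x (Pi.single 1 1 : Fin 2 → ℂ) = s₁ := by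
      rw [hs]
      simp
    exact (congrArg₂ det₂ e0 e1).trans_ne hne
  obtain ⟨φ, -⟩ := f.exists_iso fun x => by
    rcases CP1.cases_point x with rfl | ⟨z, rfl⟩
    · refine hbij _ (t₀ CP1.infty) (t₁ CP1.infty) (fun v => (hf' v).trans ?_) h
      simp
    · refine hbij _ (σ₀ _) (σ₁ _) (fun v => (hf _ (CP1.ofCoord_ne_infty z) v).trans ?_)
        fun h0 => hHne z ((hHz z).2 h0)
      simp
  exact ⟨![a₀, a₁], ha, ⟨φ⟩⟩

end HolBundle

/-! ### Constant maps of trivial bundles and inclusions of summands -/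

namespace HolBundle

variable {r s : ℕ}

lemma O_zero_ofC (i : Fin 2) (x : CP1) (v : Fin 1 → ℂ) : (O 0).ofC i x v = v := by
  funext k
  refine (split_coordChange ![0] i _ x v k).trans ?_
  fin_cases k
  simp

/-- The inclusion of a summand of a sum of line bundles. -/
lemma exists_summand (a : Fin r → ℤ) (k : Fin r) :
    ∃ f : Hom (O (a k)) (split a), ∀ x, Function.Injective (f.app x) := by
  let S : (Fin 1 → ℂ) →ₗ[ℂ] (Fin r → ℂ) :=
    (LinearMap.single ℂ (fun _ : Fin r => ℂ) k) ∘ₗ LinearMap.proj 0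
  have hS : ∀ v, S v = Pi.single k (v 0) := fun v => rfl
  have hinj : Function.Injective S := fun v w h => by
    rw [hS, hS] at h
    have := congrFun h k
    simp only [Pi.single_eq_same] at this
    funext l
    fin_cases l
    exact this
  let A : ∀ x, (O (a k)).Fiber x →ₗ[ℂ] (split a).Fiber x := fun _ => S
  have hA : ∀ (i : Fin 2) (x : CP1) (u : (O (a k)).Fiber x),
      (split a).toC i x (A x u) = S ((O (a k)).toC i x u) := by
    intro i x u
    have hmul : ∀ (b : ℂ) (v w : Fin 1 → ℂ) (l : Fin r), (l = k → w 0 = b * v 0) →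
        b * S v l = S w l := fun b v w l hl => by
      rw [hS, hS]
      by_cases h : l = k
      · subst h
        rw [Pi.single_eq_same, Pi.single_eq_same, hl rfl]
      · rw [Pi.single_eq_of_ne h, Pi.single_eq_of_ne h, mul_zero]
    funext l
    refine (split_coordChange a _ i x (S u) l).trans (hmul _ u _ l fun hl => ?_)
    subst hl
    exact split_coordChange ![a l] _ i x u 0
  refine ⟨Hom.ofLocal A fun x => ?_, fun x => hinj⟩
  have hx := CP1.mem_chartSet_chartIndex x
  set i := CP1.chartIndex x
  refine ⟨i, i, hx, hx, HolAt.eventually_eq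
    (f := fun _ => LinearMap.toContinuousLinearMap S) contMDiffAt_const ?_⟩
  filter_upwards [(CP1.isOpen_chartSet i).mem_nhds hx] with y hy
  ext1 v
  refine (hA i y _).trans (congrArg S ?_)
  exact (O (a k)).toC_ofC (i := i) hy v

/-- A constant map between trivial bundles. -/
def constHom {E : HolBundle r} {F : HolBundle s} (hE : ∀ i x v, E.ofC i x v = v)
    (hF : ∀ i x v, F.toC i x v = v) (M : (Fin r → ℂ) →ₗ[ℂ] (Fin s → ℂ)) : Hom E F :=
  Hom.ofLocal (fun _ => M) fun x => ⟨E.idx x, F.idx x, E.mem_base_idx x, F.mem_base_idx x,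
    HolAt.eventually_eq (f := fun _ => LinearMap.toContinuousLinearMap M) contMDiffAt_const
      (Filter.Eventually.of_forall fun y => by
        ext1 v
        exact (hF _ y _).trans (congrArg M (hE _ y v)))⟩

/-- A linear automorphism of `ℂ²` as an automorphism of the trivial bundle. -/
def constIso (M : (Fin 2 → ℂ) ≃ₗ[ℂ] (Fin 2 → ℂ)) : Iso (OO 0 0) (OO 0 0) where
  hom := constHom OO_zero_ofC OO_zero_toC M
  inv := constHom OO_zero_ofC OO_zero_toC M.symm
  hom_inv := Hom.ext fun _ => LinearMap.ext fun v => M.apply_symm_apply v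
  inv_hom := Hom.ext fun _ => LinearMap.ext fun v => M.symm_apply_apply v

/-- Holomorphic functions on `CP1` are constant. -/
lemma eq_of_holAt {V : Type*} [NormedAddCommGroup V] [NormedSpace ℂ V] [CompleteSpace V]
    {f : CP1 → V} (hf : ∀ x, HolAt f x) (x : CP1) : f x = f CP1.infty := by
  rcases CP1.cases_point x with rfl | ⟨z, rfl⟩
  · rfl
  have hd : Differentiable ℂ fun z => f (CP1.ofCoord 0 z) := fun z =>
    differentiableAt_comp_ofCoord (hf _)
  refine hd.eq_of_tendsto_inv ?_ z
  have h1 : Tendsto (fun w => f (CP1.ofCoord 1 w)) (𝓝[≠] 0) (𝓝 (f CP1.infty)) :=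
    ((CP1.holAt_ofCoord_iff 1 0).1 (hf CP1.infty)).continuousAt.tendsto.mono_left nhdsWithin_le_nhds
  refine h1.congr' ?_
  filter_upwards [self_mem_nhdsWithin] with w hw
  rw [CP1.ofCoord_one_eq hw]

/-- Endomorphisms of the trivial bundle are constant. -/
lemma Hom.eq_const (f : Hom (OO 0 0) (OO 0 0)) (x : CP1) (v : Fin 2 → ℂ) :
    (f.app x v : Fin 2 → ℂ) = f.app CP1.infty v := by
  refine eq_of_holAt (f := fun x => (f.app x v : Fin 2 → ℂ)) (fun y => ?_) x
  have hc : (OO 0 0).SecAt (fun _ => v) y := by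
    refine ((OO 0 0).secAt_iff ((OO 0 0).mem_base_idx y)).2 ?_
    exact HolAt.eventually_eq (f := fun _ => v) contMDiffAt_const
      (Filter.Eventually.of_forall fun y => OO_zero_toC _ y v)
  have h1 := f.secAt hc
  rw [(OO 0 0).secAt_iff ((OO 0 0).mem_base_idx y)] at h1
  exact h1.eventually_eq (Filter.Eventually.of_forall fun y => (OO_zero_toC _ y _).symm)

/-! ### Stable parabolic structures are triples of distinct lines -/

section Stability

variable {μ : ℝ} {q : Fin 3 ↪ CP1}

/-- Stability bounds the degrees of subbundles of a bundle with trivial determinant. -/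
lemma exists_iso_OO_zero (hμ : 0 < μ) (hμ' : μ < 1 / 6) {E : HolBundle 2} (hE : E.HasTrivialDet)
    {ℓ : E.Parabolic q} (hℓ : IsStable μ E q ℓ) : Nonempty (Iso E (OO 0 0)) := by
  classical
  obtain ⟨a, ha, ⟨ψ⟩⟩ := exists_iso_split hE
  -- A summand of degree at least `1` has parabolic slope at least `1 - 3μ > 1/2`, while the slope
  -- of `E` is zero. As the two exponents add up to zero, both vanish.
  have hle : ∀ k, a k ≤ 0 := fun k => by
    by_contra hk
    push Not at hk
    obtain ⟨f, hf⟩ := exists_summand a k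
    have hψ : ∀ x, Function.Injective (ψ.hom.app x) := fun x v w h => by
      rw [← ψ.inv_hom_apply x v, h, ψ.inv_hom_apply]
    have h1 := hℓ _ (ψ.hom.comp f) (fun x => (hψ x).comp (hf x)) _ _ (isDegree_O (a k))
      (isDegree_zero_of_hasTrivialDet hE)
    have h2 : (-3 : ℝ) ≤ ∑ j, (if LinearMap.range ((ψ.hom.comp f).app (q j)) = (ℓ j).submodule
        then (1 : ℝ) else -1) := by
      rw [Fin.sum_univ_three]
      have h3 : ∀ j, (-1 : ℝ) ≤ (if LinearMap.range ((ψ.hom.comp f).app (q j)) = (ℓ j).submodule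
          then (1 : ℝ) else -1) := fun j => by split_ifs <;> norm_num
      linarith [h3 0, h3 1, h3 2]
    have h4 : (1 : ℝ) ≤ (a k : ℝ) := by exact_mod_cast hk
    have h5 := mul_le_mul_of_nonneg_left h2 hμ.le
    push_cast at h1
    linarith
  have h0 : a = ![0, 0] := by
    have h0 := hle 0
    have h1 := hle 1
    funext k
    fin_cases k <;> simp <;> omega
  subst h0
  exact ⟨ψ.symm⟩

/-- The lines of a stable parabolic structure on a trivial bundle are distinct. -/
lemma IsStable.det₂_ne_zero (hμ : 0 < μ) {E : HolBundle 2} (hE : E.HasTrivialDet)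
    {ℓ : E.Parabolic q} (hℓ : IsStable μ E q ℓ) (φ : Iso E (OO 0 0)) {i j : Fin 3} (hij : i ≠ j) :
    det₂ (φ.hom.app (q i) (ℓ i).rep) (φ.hom.app (q j) (ℓ j).rep) ≠ 0 := by
  classical
  intro h
  have hφ : ∀ x, Function.Injective (φ.hom.app x) := fun x v w h => by
    rw [← φ.inv_hom_apply x v, h, φ.inv_hom_apply]
  have hφ' : ∀ x, Function.Injective (φ.inv.app x) := fun x v w h => by
    rw [← φ.hom_inv_apply x v, h, φ.hom_inv_apply]
  have hne : ∀ k, φ.hom.app (q k) (ℓ k).rep ≠ 0 := fun k h =>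
    (ℓ k).rep_nonzero (hφ _ (h.trans (map_zero _).symm))
  rcases exists_relation_of_det₂_eq_zero h with ⟨c, hc⟩ | h0
  swap
  · exact hne j h0
  let v : Fin 2 → ℂ := φ.hom.app (q j) (ℓ j).rep
  have hv : v ≠ 0 := hne j
  have hc' : (φ.hom.app (q i) (ℓ i).rep : Fin 2 → ℂ) = (-c) • v := by
    rw [neg_smul]
    exact eq_neg_of_add_eq_zero_left hc
  have hc0 : -c ≠ 0 := fun h0 => hne i (hc'.trans (by rw [h0, zero_smul]; rfl))
  let S : (Fin 1 → ℂ) →ₗ[ℂ] (Fin 2 → ℂ) := (LinearMap.proj 0 : (Fin 1 → ℂ) →ₗ[ℂ] ℂ).smulRight v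
  have hS : Function.Injective S := fun a b hab => by
    have h1 : a 0 • v = b 0 • v := hab
    funext l
    fin_cases l
    exact smul_left_injective ℂ hv h1
  -- The common line spans a constant subbundle of degree zero. It passes through two of the
  -- parabolic lines, so its signs add up to at least `1 + 1 - 1 = 1`.
  let f : Hom (O 0) E := φ.inv.comp (constHom O_zero_ofC OO_zero_toC S)
  have hf : ∀ x, Function.Injective (f.app x) := fun x => (hφ' x).comp hS
  have hrange : ∀ x, LinearMap.range (f.app x) = Submodule.span ℂ {φ.inv.app x v} := by
    intro x
    apply le_antisymm
    · rintro _ ⟨u, rfl⟩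
      refine Submodule.mem_span_singleton.2 ⟨(u : Fin 1 → ℂ) 0, ?_⟩
      exact (map_smul (φ.inv.app x) ((u : Fin 1 → ℂ) 0) v).symm
    · rw [Submodule.span_singleton_le_iff_mem]
      refine ⟨(fun _ => 1 : Fin 1 → ℂ), ?_⟩
      exact congrArg (φ.inv.app x) (one_smul ℂ v)
  have hj : LinearMap.range (f.app (q j)) = (ℓ j).submodule := by
    rw [hrange, Projectivization.submodule_eq]
    congr 2
    exact φ.inv_hom_apply (q j) _
  have hi : LinearMap.range (f.app (q i)) = (ℓ i).submodule := by
    rw [hrange, Projectivization.submodule_eq]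
    have h1 : (-c) • φ.inv.app (q i) v = (ℓ i).rep := by
      rw [← φ.inv_hom_apply (q i) (ℓ i).rep]
      exact (map_smul (φ.inv.app (q i)) (-c) v).symm.trans (congrArg _ hc'.symm)
    rw [← h1, Submodule.span_singleton_smul_eq (IsUnit.mk0 _ hc0)]
  have h1 := hℓ _ f hf _ _ (isDegree_O 0) (isDegree_zero_of_hasTrivialDet hE)
  have h2 : (1 : ℝ) ≤ ∑ k, (if LinearMap.range (f.app (q k)) = (ℓ k).submodule
      then (1 : ℝ) else -1) := by
    have h3 : ∀ k, (-1 : ℝ) ≤ (if LinearMap.range (f.app (q k)) = (ℓ k).submodule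
        then (1 : ℝ) else -1) := fun k => by split_ifs <;> norm_num
    have h4 : ∀ k, LinearMap.range (f.app (q k)) = (ℓ k).submodule →
        (if LinearMap.range (f.app (q k)) = (ℓ k).submodule then (1 : ℝ) else -1) = 1 :=
      fun k hk => if_pos hk
    have e1 := h4 i hi
    have e2 := h4 j hj
    rw [Fin.sum_univ_three]
    have b0 := h3 0
    have b1 := h3 1
    have b2 := h3 2
    fin_cases i <;> fin_cases j <;> first | exact absurd rfl hij | skip
    all_goals
      simp only [Fin.zero_eta, Fin.mk_one, Fin.reduceFinMk] at e1 e2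
      linarith
  have h5 := mul_le_mul_of_nonneg_left h2 hμ.le
  push_cast at h1
  linarith

/-- Distinct lines are a stable parabolic structure on the trivial bundle. -/
lemma isStable_of_det₂_ne_zero (hμ : 0 < μ) (hμ' : μ < 1 / 6) {ℓ : (OO 0 0).Parabolic q}
    (h : ∀ i j, i ≠ j → det₂ (ℓ i).rep (ℓ j).rep ≠ 0) : IsStable μ (OO 0 0) q ℓ := by
  classical
  intro L f hf dL dE hL hE
  obtain ⟨hd, hd0⟩ := degree_subbundle_OO_zero f hf hL
  have hE0 : (0 : ℝ) ≤ (dE : ℝ) := by exact_mod_cast degree_OO_zero_nonneg hE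
  set P : Fin 3 → Prop := fun j => LinearMap.range (f.app (q j)) = (ℓ j).submodule with hP
  change (dL : ℝ) + μ * ∑ j, (if P j then (1 : ℝ) else -1) < (dE : ℝ) / 2
  have hle : ∑ j, (if P j then (1 : ℝ) else -1) ≤ 3 := by
    rw [Fin.sum_univ_three]
    have h3 : ∀ j, (if P j then (1 : ℝ) else -1) ≤ 1 := fun j => by split_ifs <;> norm_num
    linarith [h3 0, h3 1, h3 2]
  -- In negative degree the slope is at most `-1 + 3μ < 0`. In degree zero the subbundle is constant
  -- and meets at most one of the distinct lines, so the signs add up to at most `-1`.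
  rcases hd.lt_or_eq with hneg | h0
  · have h1 : (dL : ℝ) ≤ -1 := by exact_mod_cast Int.le_sub_one_of_lt hneg
    have h5 := mul_le_mul_of_nonneg_left hle hμ.le
    linarith
  · obtain ⟨v, hv⟩ := hd0 h0
    have hrep : ∀ j, P j → ∃ c : ℂ, ((ℓ j).rep : Fin 2 → ℂ) = c • v := fun j hj => by
      have h1 : (ℓ j).rep ∈ (ℓ j).submodule := by
        rw [Projectivization.submodule_eq]
        exact Submodule.mem_span_singleton_self _
      rw [← (hj : LinearMap.range (f.app (q j)) = (ℓ j).submodule)] at h1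
      obtain ⟨u, hu⟩ := h1
      obtain ⟨c, hc⟩ := hv (q j) u
      exact ⟨c, hu.symm.trans hc⟩
    have huniq : ∀ i j, P i → P j → i = j := fun i j hi hj => by
      by_contra hij
      obtain ⟨c, hc⟩ := hrep i hi
      obtain ⟨d, hd⟩ := hrep j hj
      refine h i j hij ((congrArg₂ det₂ hc hd).trans ((det₂_smul_smul c d v v).trans ?_))
      simp only [det₂]
      ring
    have hsum : ∑ j, (if P j then (1 : ℝ) else -1) ≤ -1 := by
      rw [Fin.sum_univ_three]
      by_cases h0 : P 0 <;> by_cases h1 : P 1 <;> by_cases h2 : P 2 <;>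
        simp only [h0, h1, h2, if_true, if_false] <;> norm_num
      · exact absurd (huniq _ _ h0 h1) (by decide)
      · exact absurd (huniq _ _ h0 h1) (by decide)
      · exact absurd (huniq _ _ h0 h2) (by decide)
      · exact absurd (huniq _ _ h1 h2) (by decide)
    have h5 := mul_le_mul_of_nonneg_left hsum hμ.le
    rw [h0]
    push_cast
    linarith

end Stability

end HolBundle

/-! ### Linear maps between triples of lines in the plane -/

section Mobius

/-- The vectors span pairwise distinct lines. -/
def PairwiseIndep (v : Fin 3 → Fin 2 → ℂ) : Prop := ∀ i j, i ≠ j → det₂ (v i) (v j) ≠ 0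

/-- The linear map that takes the lines spanned by three vectors to `[0 : 1]`, `[1 : 0]`,
`[1 : 1]`. -/
def mobius (v : Fin 3 → Fin 2 → ℂ) : (Fin 2 → ℂ) →ₗ[ℂ] (Fin 2 → ℂ) where
  -- The formula is polynomial in `v` as well, which is what makes the normal form holomorphic in
  -- the parabolic lines.
  toFun u := ![det₂ u (v 0) * det₂ (v 2) (v 1), det₂ u (v 1) * det₂ (v 2) (v 0)]
  map_add' u u' := by
    ext k
    fin_cases k <;> simp [det₂] <;> ring
  map_smul' c u := by
    ext k
    fin_cases k <;> simp [det₂] <;> ring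

lemma mobius_apply (v : Fin 3 → Fin 2 → ℂ) (u : Fin 2 → ℂ) : mobius v u =
    ![det₂ u (v 0) * det₂ (v 2) (v 1), det₂ u (v 1) * det₂ (v 2) (v 0)] := rfl

/-- Three vectors in general position. -/
def standardVec : Fin 3 → Fin 2 → ℂ := ![![0, 1], ![1, 0], ![1, 1]]

/-- The factors by which `mobius v` maps the vectors `v j` to the standard vectors. -/
def mobiusFactor (v : Fin 3 → Fin 2 → ℂ) : Fin 3 → ℂ :=
  ![det₂ (v 0) (v 1) * det₂ (v 2) (v 0), det₂ (v 1) (v 0) * det₂ (v 2) (v 1),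
    det₂ (v 2) (v 0) * det₂ (v 2) (v 1)]

lemma mobius_apply_self (v : Fin 3 → Fin 2 → ℂ) (j : Fin 3) :
    mobius v (v j) = mobiusFactor v j • standardVec j := by
  rw [mobius_apply]
  ext k
  fin_cases j <;> fin_cases k <;>
    simp only [mobiusFactor, standardVec, det₂, Fin.zero_eta, Fin.mk_one, Fin.reduceFinMk,
      Pi.smul_apply, smul_eq_mul, Matrix.cons_val] <;> ring

lemma mobiusFactor_ne_zero {v : Fin 3 → Fin 2 → ℂ} (hv : PairwiseIndep v) (j : Fin 3) :
    mobiusFactor v j ≠ 0 := by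
  have h01 := hv 0 1 (by decide)
  have h10 := hv 1 0 (by decide)
  have h20 := hv 2 0 (by decide)
  have h21 := hv 2 1 (by decide)
  fin_cases j
  · exact mul_ne_zero h01 h20
  · exact mul_ne_zero h10 h21
  · exact mul_ne_zero h20 h21

lemma det₂_mobius (v : Fin 3 → Fin 2 → ℂ) (u u' : Fin 2 → ℂ) : det₂ (mobius v u) (mobius v u') =
    det₂ (v 2) (v 1) * det₂ (v 2) (v 0) * det₂ (v 0) (v 1) * det₂ u u' := by
  rw [mobius_apply, mobius_apply]
  simp only [det₂, Matrix.cons_val_zero, Matrix.cons_val_one]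
  ring

lemma mobius_bijective {v : Fin 3 → Fin 2 → ℂ} (hv : PairwiseIndep v) :
    Function.Bijective (mobius v) := by
  refine bijective_of_det₂_ne_zero _ ?_
  rw [det₂_mobius]
  refine mul_ne_zero (mul_ne_zero (mul_ne_zero (hv 2 1 (by decide)) (hv 2 0 (by decide)))
    (hv 0 1 (by decide))) ?_
  simp [det₂]

/-- `mobius v` as an automorphism of the plane. -/
def mobiusEquiv {v : Fin 3 → Fin 2 → ℂ} (hv : PairwiseIndep v) : (Fin 2 → ℂ) ≃ₗ[ℂ] (Fin 2 → ℂ) :=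
  LinearEquiv.ofBijective (mobius v) (mobius_bijective hv)

/-- Both triples are compared with the standard one, so the composition takes the line of `v j` to
the line of `w j`. -/
lemma mobiusEquiv_symm_mobius {v w : Fin 3 → Fin 2 → ℂ} (hw : PairwiseIndep w) (j : Fin 3) :
    (mobiusEquiv hw).symm (mobius v (v j)) = (mobiusFactor v j / mobiusFactor w j) • w j := by
  rw [LinearEquiv.symm_apply_eq, map_smul]
  change _ = _ • mobius w (w j)
  rw [mobius_apply_self, mobius_apply_self, smul_smul,
    div_mul_cancel₀ _ (mobiusFactor_ne_zero hw j)]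

/-- A linear map that preserves three distinct lines is a scalar. -/
lemma exists_scalar_of_preserves {w : Fin 3 → Fin 2 → ℂ} (hw : PairwiseIndep w)
    {M : (Fin 2 → ℂ) →ₗ[ℂ] (Fin 2 → ℂ)} {c : Fin 3 → ℂ} (h : ∀ j, M (w j) = c j • w j) :
    ∃ b : ℂ, ∀ u, M u = b • u := by
  have h01 := hw 0 1 (by decide)
  have h12 := hw 1 2 (by decide)
  have h20 := hw 2 0 (by decide)
  -- Any three vectors of the plane satisfy this relation. For `w 0, w 1, w 2` it has nonzero
  -- coefficients, and applying `M` forces the three factors to be equal; for `w 0, w 1, u` it then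
  -- determines `M u`.
  have plucker : ∀ u v w : Fin 2 → ℂ, det₂ v w • u + det₂ w u • v + det₂ u v • w = 0 := by
    intro u v w
    ext k
    fin_cases k <;> simp [det₂] <;> ring
  have h1 := congrArg M (plucker (w 0) (w 1) (w 2))
  simp only [map_add, map_smul, h, map_zero] at h1
  have h2 := plucker (w 0) (w 1) (w 2)
  have e0 := congrFun h1 0
  have e1 := congrFun h1 1
  have f0 := congrFun h2 0
  have f1 := congrFun h2 1
  simp only [Pi.add_apply, Pi.smul_apply, smul_eq_mul, Pi.zero_apply] at e0 e1 f0 f1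
  have hc0 : c 0 = c 2 := by
    have : (c 0 - c 2) * (det₂ (w 1) (w 2) * det₂ (w 0) (w 1)) = 0 := by
      have : det₂ (w 0) (w 1) = w 0 0 * w 1 1 - w 0 1 * w 1 0 := rfl
      linear_combination (c 0 - c 2) * det₂ (w 1) (w 2) * this + w 1 1 * (e0 - c 2 * f0) -
        w 1 0 * (e1 - c 2 * f1)
    exact sub_eq_zero.1 ((mul_eq_zero.1 this).resolve_right (mul_ne_zero h12 h01))
  have hc1 : c 1 = c 2 := by
    have : (c 1 - c 2) * (det₂ (w 2) (w 0) * det₂ (w 0) (w 1)) = 0 := by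
      have : det₂ (w 0) (w 1) = w 0 0 * w 1 1 - w 0 1 * w 1 0 := rfl
      linear_combination (c 1 - c 2) * det₂ (w 2) (w 0) * this - w 0 1 * (e0 - c 2 * f0) +
        w 0 0 * (e1 - c 2 * f1)
    exact sub_eq_zero.1 ((mul_eq_zero.1 this).resolve_right (mul_ne_zero h20 h01))
  refine ⟨c 2, fun u => ?_⟩
  have h3 := congrArg M (plucker (w 0) (w 1) u)
  simp only [map_add, map_smul, h, map_zero, hc0, hc1] at h3
  have h4 : det₂ (w 0) (w 1) • M u = det₂ (w 0) (w 1) • c 2 • u := by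
    have h5 := congrArg (c 2 • ·) (plucker (w 0) (w 1) u)
    simp only [smul_add, smul_zero] at h5
    have h6 := h3.trans h5.symm
    rw [smul_comm (c 2) (det₂ (w 1) u), smul_comm (c 2) (det₂ u (w 0)),
      smul_comm (c 2) (det₂ (w 0) (w 1))] at h6
    exact add_left_cancel h6
  exact smul_right_injective _ h01 h4

end Mobius

/-! ### Normal forms on the trivial bundle -/

namespace HolBundle

variable {μ : ℝ} {q : Fin 3 ↪ CP1} {n : ℕ} {p : Fin n ↪ CP1} {ℓ : (OO 0 0).Parabolic q}

/-- Vectors spanning the lines of a parabolic structure on the trivial bundle. -/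
def spanningVec (ℓ : (OO 0 0).Parabolic q) (j : Fin 3) : Fin 2 → ℂ := (ℓ j).rep

lemma IsStable.pairwiseIndep (hμ : 0 < μ) (hℓ : IsStable μ (OO 0 0) q ℓ) :
    PairwiseIndep (spanningVec ℓ) := fun _ _ hij =>
  hℓ.det₂_ne_zero hμ hasTrivialDet_OO_zero (Iso.refl _) hij

lemma exists_isStable (hμ : 0 < μ) (hμ' : μ < 1 / 6) :
    ∃ ℓ : (OO 0 0).Parabolic q, IsStable μ (OO 0 0) q ℓ := by
  have h0 : ∀ j, standardVec j ≠ 0 := fun j h => by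
    have h1 := congrFun h 0
    have h2 := congrFun h 1
    fin_cases j <;> simp [standardVec] at h1 h2
  have hdet : PairwiseIndep standardVec := fun i j hij => by
    fin_cases i <;> fin_cases j <;> simp [standardVec, det₂] at hij ⊢
  let m : Fin 3 → ℙ ℂ (Fin 2 → ℂ) := fun j => Projectivization.mk ℂ (standardVec j) (h0 j)
  refine ⟨m, isStable_of_det₂_ne_zero hμ hμ' fun i j hij h => ?_⟩
  have hrep : ∀ j, ∃ a : ℂˣ, a • (m j).rep = standardVec j := fun j => by
    obtain ⟨a, ha⟩ := Projectivization.exists_smul_eq_mk_rep ℂ (standardVec j) (h0 j)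
    exact ⟨a⁻¹, by rw [← ha, inv_smul_smul]⟩
  obtain ⟨a, ha⟩ := hrep i
  obtain ⟨b, hb⟩ := hrep j
  refine hdet i j hij ?_
  rw [← ha, ← hb]
  refine (det₂_smul_smul (a : ℂ) (b : ℂ) _ _).trans ?_
  rw [show det₂ (m i).rep (m j).rep = 0 from h, mul_zero]

/-- Every sequence of Hecke modifications of a stable parabolic bundle is isomorphic to one of the
trivial bundle with a given stable parabolic structure, by an explicit transformation of lines. -/
lemma exists_normal_form (hμ : 0 < μ) (hℓ : IsStable μ (OO 0 0) q ℓ) {E : HolBundle 2}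
    (hE : E.HasTrivialDet) {ℓ' : E.Parabolic q} (hℓ' : IsStable μ E q ℓ') (φ : Iso E (OO 0 0))
    (y : ∀ j, E.Fiber (q j)) (hy : ∀ j, y j ≠ 0)
    (hℓy : ∀ j, ℓ' j = Projectivization.mk ℂ (y j) (hy j)) (x : Htot E p) :
    ∃ z : Htot (OO 0 0) p, Hptot.mk μ (OO 0 0) hasTrivialDet_OO_zero q p (⟨ℓ, hℓ⟩, z) =
        Hptot.mk μ E hE q p (⟨ℓ', hℓ'⟩, x) ∧
      PairwiseIndep (fun j => (φ.hom.app (q j) (y j) : Fin 2 → ℂ)) ∧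
      ∀ i (u : E.Fiber (p i)) (hu : u ≠ 0), x.direction i = Projectivization.mk ℂ u hu →
        ∃ h, z.direction i = Projectivization.mk ℂ
          ((mobiusEquiv (hℓ.pairwiseIndep hμ)).symm
            (mobius (fun j => (φ.hom.app (q j) (y j) : Fin 2 → ℂ)) (φ.hom.app (p i) u))) h := by
  set w := spanningVec ℓ
  have hw := hℓ.pairwiseIndep hμ
  let v : Fin 3 → Fin 2 → ℂ := fun j => φ.hom.app (q j) (y j)
  -- The spanning vectors `y j` are arbitrary rather than chosen representatives, so that the final
  -- formula holds in all homogeneous coordinates.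
  have hrep : ∀ j, ∃ a : ℂ, (ℓ' j).rep = a • y j := fun j => by
    obtain ⟨a, ha⟩ := Projectivization.exists_smul_eq_mk_rep ℂ (y j) (hy j)
    exact ⟨a, by rw [hℓy j, ← ha]; rfl⟩
  have hv : PairwiseIndep v := fun i j hij h0 => by
    obtain ⟨a, ha⟩ := hrep i
    obtain ⟨b, hb⟩ := hrep j
    refine hℓ'.det₂_ne_zero hμ hE φ hij ?_
    rw [ha, hb, map_smul, map_smul]
    refine (det₂_smul_smul a b (v i) (v j)).trans ?_
    rw [h0, mul_zero]
  -- `M` moves the images of the parabolic lines under `φ` to the lines of `ℓ`, so `θ` is an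
  -- isomorphism of parabolic bundles. The sequence and its lines are transported along it.
  let M : (Fin 2 → ℂ) ≃ₗ[ℂ] (Fin 2 → ℂ) := (mobiusEquiv hv).trans (mobiusEquiv hw).symm
  have hM : ∀ u, M u = (mobiusEquiv hw).symm (mobius v u) := fun u => rfl
  let θ : Iso E (OO 0 0) := φ.trans (constIso M)
  have hθ : ∀ (x : CP1) (u : E.Fiber x),
      θ.hom.app x u = (mobiusEquiv hw).symm (mobius v (φ.hom.app x u)) := fun x u => rfl
  have hpar : θ.IsParabolic ℓ' ℓ := fun j => by
    have h1 : (ℓ j).submodule = Submodule.span ℂ {(ℓ j).rep} := Projectivization.submodule_eq _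
    rw [hℓy j, Projectivization.submodule_mk, Submodule.map_span, Set.image_singleton, h1]
    have h2 : θ.hom.app (q j) (y j) = (mobiusFactor v j / mobiusFactor w j) • (ℓ j).rep :=
      (hθ _ _).trans (mobiusEquiv_symm_mobius (v := v) hw j)
    rw [h2, Submodule.span_singleton_smul_eq (IsUnit.mk0 _
      (div_ne_zero (mobiusFactor_ne_zero hv j) (mobiusFactor_ne_zero hw j)))]
  obtain ⟨s, rfl⟩ := Quotient.exists_rep x
  obtain ⟨s', hs'⟩ := HeckeSeq.exists_extends θ s
  have hrel : (StableHeckeSeq.setoid μ q p).r ⟨E, hE, ℓ', hℓ', s⟩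
      ⟨OO 0 0, hasTrivialDet_OO_zero, ℓ, hℓ, s'⟩ := ⟨θ, hpar, hs'⟩
  refine ⟨Quotient.mk _ s', Eq.symm (Quotient.sound hrel), hv, fun i u hu hiu => ?_⟩
  have hinj : θ.hom.app (p i) u ≠ 0 := fun h => hu (by
    rw [← θ.inv_hom_apply (p i) u, h, map_zero])
  refine ⟨hinj, Projectivization.submodule_injective ?_⟩
  have h1 := hs'.comp_range i.succ (p i)
  have h2 := s.submodule_direction i
  have h3 : s.direction i = Projectivization.mk ℂ u hu := hiu
  have h4 : (s'.direction i).submodule = (s.direction i).submodule.map (θ.hom.app (p i)) := by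
    rw [HeckeSeq.submodule_direction, HeckeSeq.submodule_direction, h1]
  rw [h3, Projectivization.submodule_mk, Submodule.map_span, Set.image_singleton] at h4
  exact h4.trans (Projectivization.submodule_mk (θ.hom.app (p i) u) hinj).symm

/-- An automorphism of the trivial bundle is constant. If it preserves three distinct lines it is a
scalar, which fixes every line, so the two sequences have the same lines. -/
lemma Hptot.mk_injective (hμ : 0 < μ) (hℓ : IsStable μ (OO 0 0) q ℓ) : Function.Injective
    fun x : Htot (OO 0 0) p => Hptot.mk μ (OO 0 0) hasTrivialDet_OO_zero q p (⟨ℓ, hℓ⟩, x) := by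
  rintro ⟨s⟩ ⟨s'⟩ h
  obtain ⟨φ, hpar, hext⟩ : ∃ φ : Iso (OO 0 0) (OO 0 0), φ.IsParabolic ℓ ℓ ∧
      HeckeSeq.Extends φ s s' := Quotient.exact h
  have hpres : ∀ j, ∃ c : ℂ, (φ.hom.app CP1.infty (spanningVec ℓ j) : Fin 2 → ℂ) =
      c • spanningVec ℓ j := fun j => by
    have h1 : φ.hom.app (q j) (ℓ j).rep ∈ (ℓ j).submodule := by
      have h2 := hpar j
      rw [← h2]
      refine Submodule.mem_map_of_mem ?_
      rw [Projectivization.submodule_eq]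
      exact Submodule.mem_span_singleton_self _
    rw [Projectivization.submodule_eq] at h1
    obtain ⟨c, hc⟩ := Submodule.mem_span_singleton.1 h1
    exact ⟨c, (φ.hom.eq_const (q j) _).symm.trans hc.symm⟩
  choose c hc using hpres
  obtain ⟨b, hb⟩ := exists_scalar_of_preserves (hℓ.pairwiseIndep hμ)
    (M := φ.hom.app CP1.infty) hc
  have hb' : ∀ x (u : (OO 0 0).Fiber x), φ.hom.app x u = b • u := fun x u =>
    (φ.hom.eq_const x u).trans (hb u)
  have hb0 : b ≠ 0 := fun h0 => by
    have h1 := φ.inv_hom_apply CP1.infty (fun _ => 1 : Fin 2 → ℂ)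
    have h2 : φ.hom.app CP1.infty (fun _ => 1 : Fin 2 → ℂ) = 0 :=
      (hb' _ _).trans (by rw [h0]; exact zero_smul ℂ _)
    have h3 := h1.symm.trans ((congrArg (φ.inv.app CP1.infty) h2).trans (map_zero _))
    exact one_ne_zero (congrFun h3 (0 : Fin 2))
  refine Quotient.sound (HeckeSeq.extends_of_direction _ s s' fun i => ?_)
  rw [HeckeSeq.submodule_direction, HeckeSeq.submodule_direction, hext.comp_range]
  have h3 : φ.hom.app (p i) = b • LinearMap.id := LinearMap.ext fun u => hb' _ u
  rw [h3, Submodule.map_smul _ _ _ hb0]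
  rfl

lemma Hptot.mk_surjective (hμ : 0 < μ) (hμ' : μ < 1 / 6) (hℓ : IsStable μ (OO 0 0) q ℓ) :
    Function.Surjective
    fun x : Htot (OO 0 0) p => Hptot.mk μ (OO 0 0) hasTrivialDet_OO_zero q p (⟨ℓ, hℓ⟩, x) := by
  rintro ⟨⟨E, hE, ℓ', hℓ', s⟩⟩
  obtain ⟨φ⟩ := exists_iso_OO_zero hμ hμ' hE hℓ'
  obtain ⟨z, hz, -⟩ := exists_normal_form hμ hℓ hE hℓ' φ (fun j => (ℓ' j).rep)
    (fun j => (ℓ' j).rep_nonzero) (fun j => (Projectivization.mk_rep _).symm)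
    (Quotient.mk _ s : Htot E p)
  exact ⟨z, hz⟩

end HolBundle

/-! ### Holomorphic functions and maps in homogeneous coordinates -/

namespace CP1

/-- The line spanned by a nonzero vector; the value at `0` plays no role. -/
def span (v : Fin 2 → ℂ) : CP1 := open scoped Classical in
  if h : v ≠ 0 then Projectivization.mk ℂ v h else infty

lemma span_of_ne_zero {v : Fin 2 → ℂ} (hv : v ≠ 0) : span v = Projectivization.mk ℂ v hv :=
  dif_pos hv

lemma continuousAt_span {v : Fin 2 → ℂ} (hv : v ≠ 0) : ContinuousAt span v := by
  have ho : IsOpen {v : Fin 2 → ℂ | v ≠ 0} := isOpen_ne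
  refine ContinuousOn.continuousAt ?_ (ho.mem_nhds hv)
  rw [continuousOn_iff_continuous_domRestrict]
  refine isQuotientMap_mk.continuous.congr fun w => ?_
  exact (span_of_ne_zero w.2).symm

variable {κ : Type}

/-- The tuple of lines spanned by a tuple of vectors. -/
def spans (v : κ → Fin 2 → ℂ) (k : κ) : CP1 := span (v k)

lemma spans_of_ne_zero {v : κ → Fin 2 → ℂ} (hv : ∀ k, v k ≠ 0) :
    spans v = fun k => Projectivization.mk ℂ (v k) (hv k) :=
  funext fun k => span_of_ne_zero (hv k)

lemma continuousAt_spans {v : κ → Fin 2 → ℂ} (hv : ∀ k, v k ≠ 0) : ContinuousAt spans v :=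
  continuousAt_pi.2 fun k =>
    ContinuousAt.comp (f := fun w : κ → Fin 2 → ℂ => w k) (continuousAt_span (hv k))
      (continuous_apply k).continuousAt

lemma eventually_ne_zero [Finite κ] {v : κ → Fin 2 → ℂ} (hv : ∀ k, v k ≠ 0) :
    ∀ᶠ w in 𝓝 v, ∀ k, w k ≠ 0 :=
  eventually_all.2 fun k => (continuous_apply k).continuousAt.eventually_ne (hv k)

/-- A function that is locally holomorphic is holomorphic. -/
lemma isHolOn_of_locally [Fintype κ] {U : Set (κ → CP1)} {f : (κ → CP1) → ℂ} (hU : IsOpen U)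
    (h : ∀ z ∈ U, ∃ (V : Set (κ → CP1)) (g : (κ → CP1) → ℂ), IsOpen V ∧ z ∈ V ∧
      HolSpace.IsHolOn V g ∧ ∀ y ∈ U, y ∈ V → f y = g y) : HolSpace.IsHolOn U f := by
  -- The pullback of `f` to homogeneous coordinates is a global witness, and its differentiability
  -- can be checked locally.
  refine ⟨fun v => f (spans v), fun v hv hvU => ⟨?_, congrArg f (spans_of_ne_zero hv)⟩⟩
  obtain ⟨V, g, hV, hvV, ⟨G, hG⟩, hfg⟩ := h _ hvU
  refine (hG v hv hvV).1.congr_of_eventuallyEq ?_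
  rw [← spans_of_ne_zero hv] at hvU hvV
  filter_upwards [eventually_ne_zero hv, (continuousAt_spans hv).eventually (hU.mem_nhds hvU),
    (continuousAt_spans hv).eventually (hV.mem_nhds hvV)] with w hw hwU hwV
  rw [hfg _ hwU hwV, spans_of_ne_zero hw]
  rw [spans_of_ne_zero hw] at hwV
  exact (hG w hw hwV).2.symm

/-- The vectors with an entry `1` that span the lines of a tuple. -/
def affineVecs (I : κ → Fin 2) (z : κ → CP1) (k : κ) : Fin 2 → ℂ :=
  affineVec (I k) (coord (I k) (z k))

lemma affineVecs_ne_zero (I : κ → Fin 2) (z : κ → CP1) (k : κ) : affineVecs I z k ≠ 0 :=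
  affineVec_ne_zero _ _

lemma mk_affineVecs {I : κ → Fin 2} {z : κ → CP1} (hz : ∀ k, z k ∈ chartSet (I k)) :
    (fun k => Projectivization.mk ℂ (affineVecs I z k) (affineVecs_ne_zero I z k)) = z :=
  funext fun k => ofCoord_coord (I k) (z k) (hz k)

lemma differentiable_affineVec (i : Fin 2) : Differentiable ℂ (affineVec i) :=
  differentiable_pi.2 fun k => by
    unfold affineVec
    split_ifs <;> fun_prop

lemma continuousAt_affineVecs {I : κ → Fin 2} {z : κ → CP1} (hz : ∀ k, z k ∈ chartSet (I k)) :
    ContinuousAt (affineVecs I) z :=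
  continuousAt_pi.2 fun k => (differentiable_affineVec (I k)).continuous.continuousAt.comp
    (ContinuousAt.comp (f := fun w : κ → CP1 => w k)
      ((continuousOn_coord (I k)).continuousAt ((isOpen_chartSet _).mem_nhds (hz k)))
      (continuous_apply k).continuousAt)

lemma eventually_mem_chartSet [Finite κ] {I : κ → Fin 2} {z : κ → CP1} (hz : ∀ k, z k ∈ chartSet (I k)) :
    ∀ᶠ w in 𝓝 z, ∀ k, w k ∈ chartSet (I k) :=
  eventually_all.2 fun k =>
    (continuous_apply k).continuousAt.eventually ((isOpen_chartSet _).mem_nhds (hz k))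

/-- In homogeneous coordinates, `affineVecs` is holomorphic. -/
lemma differentiableAt_affineVecs_spans [Fintype κ] {I : κ → Fin 2} {v : κ → Fin 2 → ℂ}
    (hI : ∀ k, v k (I k) ≠ 0) : DifferentiableAt ℂ (fun w : κ → Fin 2 → ℂ =>
      fun k => affineVec (I k) (w k (1 - I k) / w k (I k))) v := by
  refine differentiableAt_pi.2 fun k => ?_
  have h1 : DifferentiableAt ℂ (fun w : κ → Fin 2 → ℂ => w k (1 - I k)) v := by fun_prop
  have h2 : DifferentiableAt ℂ (fun w : κ → Fin 2 → ℂ => w k (I k)) v := by fun_prop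
  have h3 : DifferentiableAt ℂ (fun w : κ → Fin 2 → ℂ => w k (1 - I k) / w k (I k)) v :=
    by
    simpa only [div_eq_mul_inv] using h1.fun_mul (h2.fun_inv (hI k))
  exact DifferentiableAt.comp (g := affineVec (I k)) v (differentiable_affineVec (I k) _) h3

end CP1

/-- In homogeneous coordinates, the map `ψ` between sets with maps to powers of `CP1` is
given by `F`. -/
def IsLift {κ ι : Type} {A : Type*} (χ : A → κ → CP1) (ψ : A → ι → CP1)
    (F : (κ → Fin 2 → ℂ) → ι → Fin 2 → ℂ) : Prop :=
  ∀ (a : A) (v : κ → Fin 2 → ℂ) (hv : ∀ k, v k ≠ 0),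
    χ a = (fun k => Projectivization.mk ℂ (v k) (hv k)) →
      ∃ h : ∀ i, F v i ≠ 0, ψ a = fun i => Projectivization.mk ℂ (F v i) (h i)

namespace IsLift

open CP1

variable {κ ι : Type} [Fintype κ] [Fintype ι] {A : Type*} {χ : A → κ → CP1} {ψ : A → ι → CP1}
  {F : (κ → Fin 2 → ℂ) → ι → Fin 2 → ℂ}

/-- Near a given point, `ψ` is a function of `χ`. -/
lemma exists_local (h : IsLift χ ψ F) (hF : Continuous F) (a : A) :
    ∃ I : κ → Fin 2, ContinuousAt (fun z => spans (F (affineVecs I z))) (χ a) ∧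
      (∀ᶠ z in 𝓝 (χ a), (∀ k, z k ∈ chartSet (I k)) ∧ ∀ i, F (affineVecs I z) i ≠ 0) ∧
      ∀ b, (∀ k, χ b k ∈ chartSet (I k)) → ψ b = spans (F (affineVecs I (χ b))) := by
  have hI : ∀ k, χ a k ∈ chartSet (chartIndex (χ a k)) := fun k => mem_chartSet_chartIndex _
  set I : κ → Fin 2 := fun k => chartIndex (χ a k)
  have hψ : ∀ b, (∀ k, χ b k ∈ chartSet (I k)) → ∃ h : ∀ i, F (affineVecs I (χ b)) i ≠ 0,
      ψ b = fun i => Projectivization.mk ℂ _ (h i) := fun b hb =>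
    h b _ (affineVecs_ne_zero I (χ b)) (mk_affineVecs hb).symm
  obtain ⟨h0, -⟩ := hψ a hI
  have hc : ContinuousAt (fun z => F (affineVecs I z)) (χ a) :=
    hF.continuousAt.comp (continuousAt_affineVecs hI)
  refine ⟨I, ContinuousAt.comp (g := spans) (continuousAt_spans h0) hc,
    (eventually_mem_chartSet hI).and (hc.eventually (eventually_ne_zero h0)), fun b hb => ?_⟩
  obtain ⟨h1, h2⟩ := hψ b hb
  rw [h2, spans_of_ne_zero h1]

/-- The source filter is a comap because the sets of pairs carry the topology induced by `χ`. -/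
lemma continuousAt (h : IsLift χ ψ F) (hF : Continuous F) (a : A) :
    Tendsto ψ (comap χ (𝓝 (χ a))) (𝓝 (ψ a)) := by
  obtain ⟨I, hc, hI, hψ⟩ := h.exists_local hF a
  rw [hψ a fun k => hI.self_of_nhds.1 k]
  refine (Tendsto.comp hc tendsto_comap).congr' ?_
  filter_upwards [preimage_mem_comap hI] with b hb
  exact (hψ b hb.1).symm

/-- The pullback of a holomorphic function is locally induced by a holomorphic function. -/
lemma exists_isHolOn (h : IsLift χ ψ F) (hF : Differentiable ℂ F) {W : Set (ι → CP1)}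
    {g : (ι → CP1) → ℂ} (hW : IsOpen W) (hg : HolSpace.IsHolOn W g) {a : A} (ha : ψ a ∈ W) :
    ∃ (V : Set (κ → CP1)) (g' : (κ → CP1) → ℂ), IsOpen V ∧ χ a ∈ V ∧ HolSpace.IsHolOn V g' ∧
      ∀ b, χ b ∈ V → ψ b ∈ W ∧ g (ψ b) = g' (χ b) := by
  obtain ⟨I, hc, hI, hψ⟩ := h.exists_local hF.continuous a
  rw [hψ a fun k => hI.self_of_nhds.1 k] at ha
  obtain ⟨V, hV, hVo, haV⟩ := eventually_nhds_iff.1 (hI.and (hc.eventually (hW.mem_nhds ha)))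
  obtain ⟨G, hG⟩ := hg
  refine ⟨V, fun z => g (spans (F (affineVecs I z))), hVo, haV, ?_, fun b hb => ?_⟩
  -- Normalizing one entry of each vector to `1` makes the function depend only on the lines, and
  -- the normalization is holomorphic on the charts.
  · refine ⟨fun v => G (F fun k => affineVec (I k) (v k (1 - I k) / v k (I k))), fun v hv hvV => ?_⟩
    obtain ⟨⟨h1, h2⟩, h3⟩ := hV _ hvV
    rw [spans_of_ne_zero h2] at h3
    obtain ⟨h4, h5⟩ := hG _ h2 h3
    refine ⟨?_, ?_⟩
    · exact DifferentiableAt.comp (g := G) v h4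
        ((hF _).comp v (differentiableAt_affineVecs_spans h1))
    · exact h5.trans (congrArg g (spans_of_ne_zero h2).symm)
  · obtain ⟨⟨h1, h2⟩, h3⟩ := hV _ hb
    rw [hψ b h1]
    exact ⟨h3, rfl⟩

end IsLift

/-! ### Isomorphisms of spaces with holomorphic functions -/

namespace HolIso

variable {M N P : Type*} [TopologicalSpace M] [HolSpace M] [TopologicalSpace N] [HolSpace N]
  [TopologicalSpace P] [HolSpace P]

/-- The composition of isomorphisms. -/
def trans (Φ : HolIso M N) (Ψ : HolIso N P) : HolIso M P where
  toHomeomorph := Φ.toHomeomorph.trans Ψ.toHomeomorph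
  isHolOn_iff U f hU := (Ψ.isHolOn_iff U f hU).trans
    (Φ.isHolOn_iff _ _ (hU.preimage Ψ.continuous_toFun))

/-- An isomorphism restricts to an isomorphism of corresponding subspaces. -/
lemma exists_restrict (Φ : HolIso M N) {S : Set M} {T : Set N}
    (h : ∀ x, x ∈ S ↔ Φ.toHomeomorph x ∈ T) :
    ∃ Ψ : HolIso S T, ∀ y : S, (Ψ.toHomeomorph y).1 = Φ.toHomeomorph y.1 := by
  refine ⟨⟨Φ.toHomeomorph.subtype h, fun U f hU => ⟨fun H x hx => ?_, fun H y hy => ?_⟩⟩,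
    fun y => rfl⟩
  · obtain ⟨V, g, hV, hxV, hg, hfg⟩ := H _ hx
    exact ⟨Φ.toHomeomorph ⁻¹' V, g ∘ Φ.toHomeomorph, hV.preimage Φ.continuous_toFun, hxV,
      (Φ.isHolOn_iff V g hV).1 hg, fun y hy hyV => hfg _ hy hyV⟩
  · obtain ⟨x, rfl⟩ := (Φ.toHomeomorph.subtype h).surjective y
    obtain ⟨V, g, hV, hxV, hg, hfg⟩ := H x hy
    have hV' : Φ.toHomeomorph ⁻¹' (Φ.toHomeomorph.symm ⁻¹' V) = V := by
      ext z
      simp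
    have hg' : (g ∘ Φ.toHomeomorph.symm) ∘ Φ.toHomeomorph = g := by
      ext z
      simp
    have hVo := hV.preimage Φ.toHomeomorph.symm.continuous
    refine ⟨Φ.toHomeomorph.symm ⁻¹' V, g ∘ Φ.toHomeomorph.symm, hVo, ?_, ?_, fun y' hy' hyV => ?_⟩
    · rw [← hV'] at hxV
      exact hxV
    · refine (Φ.isHolOn_iff _ _ hVo).2 ?_
      change HolSpace.IsHolOn (Φ.toHomeomorph ⁻¹' (Φ.toHomeomorph.symm ⁻¹' V))
        ((g ∘ Φ.toHomeomorph.symm) ∘ Φ.toHomeomorph)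
      rwa [hV', hg']
    · obtain ⟨x', rfl⟩ := (Φ.toHomeomorph.subtype h).surjective y'
      have h1 : Φ.toHomeomorph.symm (Φ.toHomeomorph.subtype h x').1 = x'.1 :=
        Φ.toHomeomorph.symm_apply_apply _
      change f (Φ.toHomeomorph.subtype h x') =
        g (Φ.toHomeomorph.symm (Φ.toHomeomorph.subtype h x').1)
      rw [h1]
      refine hfg x' hy' ?_
      rw [← h1]
      exact hyV

end HolIso

/-! ### The isomorphisms of the theorem -/

namespace HolBundle

open CP1

/-- The space of sequences of Hecke modifications is the product of the projective lines. -/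
lemma Htot.exists_holIso {n : ℕ} (p : Fin n ↪ CP1) :
    ∃ h : HolIso (Htot (OO 0 0) p) (Fin n → CP1), ∀ x, h.toHomeomorph x = x.lines := by
  let e : Htot (OO 0 0) p ≃ (Fin n → CP1) := Equiv.ofBijective Htot.lines Htot.lines_bijective
  refine ⟨⟨e.toHomeomorphOfIsInducing ⟨rfl⟩, fun U f hU => ⟨fun hf x hx => ?_, fun hf => ?_⟩⟩,
    fun x => rfl⟩
  · exact ⟨U, f, hU, hx, hf, fun y _ _ => rfl⟩
  · refine isHolOn_of_locally hU fun z hz => ?_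
    obtain ⟨x, rfl⟩ := e.surjective z
    obtain ⟨V, g, hV, hxV, hg, hfg⟩ := hf x hz
    refine ⟨V, g, hV, hxV, hg, fun y hy hyV => ?_⟩
    obtain ⟨x', rfl⟩ := e.surjective y
    exact hfg x' hy hyV

variable {μ : ℝ} {q : Fin 3 ↪ CP1} {n : ℕ} {p : Fin n ↪ CP1} {ℓ : (OO 0 0).Parabolic q}

/-- The bijection between the sequences of Hecke modifications of stable parabolic bundles and those
of the trivial bundle. -/
def Hptot.equiv (hμ : 0 < μ) (hμ' : μ < 1 / 6) (hℓ : IsStable μ (OO 0 0) q ℓ) :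
    Hptot μ q p ≃ Htot (OO 0 0) p :=
  (Equiv.ofBijective
    (fun x => Hptot.mk μ (OO 0 0) hasTrivialDet_OO_zero q p (⟨ℓ, hℓ⟩, x))
    ⟨Hptot.mk_injective hμ hℓ, Hptot.mk_surjective hμ hμ' hℓ⟩).symm

lemma Hptot.equiv_mk (hμ : 0 < μ) (hμ' : μ < 1 / 6) (hℓ : IsStable μ (OO 0 0) q ℓ)
    (x : Htot (OO 0 0) p) : Hptot.equiv hμ hμ' hℓ
      (Hptot.mk μ (OO 0 0) hasTrivialDet_OO_zero q p (⟨ℓ, hℓ⟩, x)) = x :=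
  (Hptot.equiv hμ hμ' hℓ).apply_symm_apply x

/-- In homogeneous coordinates, the normal form of a sequence of Hecke modifications of a stable
parabolic bundle is polynomial. -/
lemma Hptot.exists_isLift (hμ : 0 < μ) (hμ' : μ < 1 / 6) (hℓ : IsStable μ (OO 0 0) q ℓ)
    {E : HolBundle 2} (hE : E.HasTrivialDet) (φ : Iso E (OO 0 0)) :
    ∃ F : (Fin 3 ⊕ Fin n → Fin 2 → ℂ) → Fin n → Fin 2 → ℂ, Differentiable ℂ F ∧
      IsLift (StablePairs.lines (μ := μ) (E := E) (q := q) (p := p))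
        (fun y => (Hptot.equiv hμ hμ' hℓ (Hptot.mk μ E hE q p y)).lines) F := by
  let A : ∀ x : CP1, (Fin 2 → ℂ) →ₗ[ℂ] (Fin 2 → ℂ) := fun x => φ.hom.app x
  have hA : ∀ x k, Differentiable ℂ fun u => A x u k := fun x k =>
    ((LinearMap.proj k ∘ₗ A x : (Fin 2 → ℂ) →ₗ[ℂ] ℂ).toContinuousLinearMap).differentiable
  -- This is the formula of `exists_normal_form`: the entries `Sum.inl` span the parabolic lines and
  -- the entries `Sum.inr` the Hecke lines.
  refine ⟨fun v i => (mobiusEquiv (hℓ.pairwiseIndep hμ)).symm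
    (mobius (fun j => A (q j) (v (Sum.inl j))) (A (p i) (v (Sum.inr i)))), ?_, ?_⟩
  · have hv : ∀ x k (s : Fin 3 ⊕ Fin n),
        Differentiable ℂ fun v : Fin 3 ⊕ Fin n → Fin 2 → ℂ => A x (v s) k := fun x k s =>
      (hA x k).comp (by fun_prop : Differentiable ℂ fun v : Fin 3 ⊕ Fin n → Fin 2 → ℂ => v s)
    refine differentiable_pi.2 fun i => ?_
    refine (((mobiusEquiv (hℓ.pairwiseIndep hμ)).symm.toLinearMap.toContinuousLinearMap
      ).differentiable).comp (differentiable_pi.2 fun k => ?_)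
    fin_cases k <;> simp only [mobius_apply, det₂] <;>
      exact ((((hv _ _ _).mul (hv _ _ _)).sub ((hv _ _ _).mul (hv _ _ _))).mul
        (((hv _ _ _).mul (hv _ _ _)).sub ((hv _ _ _).mul (hv _ _ _))))
  · intro y v hv hyv
    obtain ⟨z, hz, -, hdir⟩ := exists_normal_form hμ hℓ hE y.1.2 φ (fun j => v (Sum.inl j))
      (fun j => hv _) (fun j => congrFun hyv (Sum.inl j)) y.2
    have hz' : Hptot.equiv hμ hμ' hℓ (Hptot.mk μ E hE q p y) = z :=
      (congrArg (Hptot.equiv hμ hμ' hℓ) hz.symm).trans (Hptot.equiv_mk hμ hμ' hℓ z)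
    have h1 : ∀ i, ∃ h, z.lines i = Projectivization.mk ℂ
        ((mobiusEquiv (hℓ.pairwiseIndep hμ)).symm
          (mobius (fun j => A (q j) (v (Sum.inl j))) (A (p i) (v (Sum.inr i))))) h := fun i =>
      hdir i (v (Sum.inr i)) (hv _) (congrFun hyv (Sum.inr i))
    choose h2 h3 using h1
    exact ⟨h2, (congrArg Htot.lines hz').trans (funext h3)⟩

/-- The existence of one stable structure on `E` already provides the trivialization of `E` that the
lift requires. -/
lemma StablePairs.exists_isLift (hμ : 0 < μ) (hμ' : μ < 1 / 6) (hℓ : IsStable μ (OO 0 0) q ℓ)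
    {E : HolBundle 2} (hE : E.HasTrivialDet) (y : StablePairs μ E q p) :
    ∃ F : (Fin 3 ⊕ Fin n → Fin 2 → ℂ) → Fin n → Fin 2 → ℂ, Differentiable ℂ F ∧
      IsLift (StablePairs.lines (μ := μ) (E := E) (q := q) (p := p))
        (fun y => (Hptot.equiv hμ hμ' hℓ (Hptot.mk μ E hE q p y)).lines) F := by
  obtain ⟨φ⟩ := exists_iso_OO_zero hμ hμ' hE y.1.2
  exact Hptot.exists_isLift hμ hμ' hℓ hE φ

/-- For the quotient topology, continuity is tested on the pairs for each bundle `E`, where the map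
is polynomial in homogeneous coordinates. -/
lemma Hptot.continuous_equiv (hμ : 0 < μ) (hμ' : μ < 1 / 6) (hℓ : IsStable μ (OO 0 0) q ℓ) :
    Continuous (Hptot.equiv hμ hμ' hℓ : Hptot μ q p ≃ Htot (OO 0 0) p) := by
  refine continuous_induced_rng.2 (continuous_iSup_dom.2 fun E => continuous_iSup_dom.2 fun hE =>
    continuous_coinduced_dom.2 ?_)
  let _ : TopologicalSpace (StablePairs μ E q p) :=
    TopologicalSpace.induced StablePairs.lines inferInstance
  refine continuous_iff_continuousAt.2 fun y => ?_
  obtain ⟨F, hF, hlift⟩ := StablePairs.exists_isLift hμ hμ' hℓ hE y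
  have h1 := hlift.continuousAt hF.continuous y
  rw [← nhds_induced] at h1
  exact h1

/-- The lines of the pair of a fixed parabolic structure and a sequence. -/
lemma continuous_sum_elim {κ ι : Type} (w : κ → CP1) :
    Continuous fun z : ι → CP1 => (Sum.elim w z : κ ⊕ ι → CP1) := by
  refine continuous_pi fun k => ?_
  cases k with
  | inl k => exact continuous_const
  | inr i => exact continuous_apply i

lemma Hptot.continuous_mk (hℓ : IsStable μ (OO 0 0) q ℓ) :
    Continuous fun x : Htot (OO 0 0) p =>
      Hptot.mk μ (OO 0 0) hasTrivialDet_OO_zero q p (⟨ℓ, hℓ⟩, x) := by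
  refine continuous_iSup_rng (i := OO 0 0) (continuous_iSup_rng (i := hasTrivialDet_OO_zero) ?_)
  let t : TopologicalSpace (StablePairs μ (OO 0 0) q p) :=
    TopologicalSpace.induced StablePairs.lines inferInstance
  have h1 : Continuous fun x : Htot (OO 0 0) p => ((⟨ℓ, hℓ⟩, x) : StablePairs μ (OO 0 0) q p) :=
    continuous_induced_rng.2 ((continuous_sum_elim fun j => linePoint (ℓ j)).comp
      continuous_induced_dom)
  have h2 := continuous_coinduced_rng (f := Hptot.mk μ (OO 0 0) hasTrivialDet_OO_zero q p) (t := t)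
  exact @Continuous.comp _ _ _ _ t (TopologicalSpace.coinduced _ t) _ _ h2 h1

/-- Restricting a holomorphic function to constant first factors. -/
lemma isHolOn_sum_elim {κ ι : Type} [Fintype κ] [Fintype ι] {V : Set (κ ⊕ ι → CP1)}
    {g : (κ ⊕ ι → CP1) → ℂ} (hg : HolSpace.IsHolOn V g) (w : κ → CP1) :
    HolSpace.IsHolOn {z : ι → CP1 | Sum.elim w z ∈ V} fun z => g (Sum.elim w z) := by
  obtain ⟨G, hG⟩ := hg
  refine ⟨fun v => G (Sum.elim (fun k => (w k).rep) v), fun v hv hvV => ?_⟩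
  have hv' : ∀ k, (Sum.elim (fun k => (w k).rep) v : κ ⊕ ι → Fin 2 → ℂ) k ≠ 0 := by
    rintro (k | i)
    · exact (w k).rep_nonzero
    · exact hv i
  have heq : (fun k => Projectivization.mk ℂ _ (hv' k)) =
      (Sum.elim w fun i => Projectivization.mk ℂ (v i) (hv i) : κ ⊕ ι → CP1) := by
    funext k
    cases k with
    | inl k => exact Projectivization.mk_rep _
    | inr i => rfl
  obtain ⟨h1, h2⟩ := hG _ hv' (heq ▸ hvV)
  refine ⟨DifferentiableAt.comp (g := G) v h1 (differentiableAt_pi.2 ?_), h2.trans (congrArg g heq)⟩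
  rintro (k | i)
  · exact differentiableAt_const _
  · exact differentiableAt_apply i v

/-- The bijection `Hptot.equiv` is an isomorphism. -/
def Hptot.holIso (hμ : 0 < μ) (hμ' : μ < 1 / 6) (hℓ : IsStable μ (OO 0 0) q ℓ) :
    HolIso (Hptot μ q p) (Htot (OO 0 0) p) where
  toEquiv := Hptot.equiv hμ hμ' hℓ
  continuous_toFun := Hptot.continuous_equiv hμ hμ' hℓ
  continuous_invFun := Hptot.continuous_mk hℓ
  isHolOn_iff U f hU := by
    constructor
    · intro hf E hE y hy
      obtain ⟨V, g, hV, hyV, hg, hfg⟩ := hf _ hy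
      obtain ⟨F, hF, hlift⟩ := StablePairs.exists_isLift hμ hμ' hℓ hE y
      obtain ⟨V', g', hV', hyV', hg', hgg⟩ := hlift.exists_isHolOn hF hV hg (a := y) hyV
      exact ⟨V', g', hV', hyV', hg', fun b hb hbV =>
        (hfg _ hb (hgg b hbV).1).trans (hgg b hbV).2⟩
    · intro hf x hx
      have hmk := Hptot.equiv_mk hμ hμ' hℓ (p := p)
      have hx' : Hptot.equiv hμ hμ' hℓ
          (Hptot.mk μ (OO 0 0) hasTrivialDet_OO_zero q p (⟨ℓ, hℓ⟩, x)) ∈ U := by rwa [hmk]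
      -- For this direction the trivial bundle with the fixed structure `ℓ` suffices: a holomorphic
      -- function of pairs is restricted to constant parabolic lines.
      obtain ⟨V, g, hV, hyV, hg, hfg⟩ := hf (OO 0 0) hasTrivialDet_OO_zero (⟨ℓ, hℓ⟩, x) hx'
      refine ⟨{z | Sum.elim (fun j => linePoint (ℓ j)) z ∈ V}, _,
        hV.preimage (continuous_sum_elim _), hyV, isHolOn_sum_elim hg _, fun x' hx' hxV => ?_⟩
      have h1 : Hptot.equiv hμ hμ' hℓ
          (Hptot.mk μ (OO 0 0) hasTrivialDet_OO_zero q p (⟨ℓ, hℓ⟩, x')) ∈ U := by rwa [hmk]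
      exact (congrArg f (hmk x')).symm.trans (hfg (⟨ℓ, hℓ⟩, x') h1 hxV)

/-- The Hecke length depends only on the isomorphism class of the last bundle, and isomorphic
sequences have isomorphic last bundles. -/
lemma mem_Hpmin_iff (hμ : 0 < μ) (hμ' : μ < 1 / 6) (hℓ : IsStable μ (OO 0 0) q ℓ)
    (x : Hptot μ q p) : x ∈ Hpmin μ q p ↔ Hptot.equiv hμ hμ' hℓ x ∈ Hmin p := by
  obtain ⟨y, rfl⟩ := (Hptot.equiv hμ hμ' hℓ (p := p)).symm.surjective x
  rw [Equiv.apply_symm_apply]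
  constructor
  · rintro ⟨⟨E, hE, ℓ', hℓ', s⟩, hs, hlen⟩
    obtain ⟨s', rfl⟩ := Quotient.exists_rep y
    obtain ⟨θ, -, hext⟩ : ∃ θ : Iso E (OO 0 0), θ.IsParabolic ℓ' ℓ ∧ HeckeSeq.Extends θ s s' :=
      Quotient.exact hs
    exact ⟨s', rfl, hext.isHeckeLength hlen⟩
  · rintro ⟨s, rfl, hlen⟩
    exact ⟨⟨OO 0 0, hasTrivialDet_OO_zero, ℓ, hℓ, s⟩, rfl, hlen⟩

end HolBundle

end

theorem theorem1 (μ : ℝ) (hμ : 0 < μ) (hμ' : μ < 1 / 6) (n : ℕ)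
    (q : Fin 3 ↪ CP1) (p : Fin n ↪ CP1) (hqp : ∀ i j, q i ≠ p j) :
    (∃ ℓ : (HolBundle.OO 0 0).Parabolic q, HolBundle.IsStable μ (HolBundle.OO 0 0) q ℓ) ∧
    (∀ (ℓ : (HolBundle.OO 0 0).Parabolic q) (hℓ : HolBundle.IsStable μ (HolBundle.OO 0 0) q ℓ),
      ∃ Φ : HolIso (HolBundle.Hptot μ q p) (HolBundle.Htot (HolBundle.OO 0 0) p),
        (∀ x : HolBundle.Htot (HolBundle.OO 0 0) p,
          Φ.toHomeomorph.symm x = HolBundle.Hptot.mk μ (HolBundle.OO 0 0)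
            HolBundle.hasTrivialDet_OO_zero q p (⟨ℓ, hℓ⟩, x)) ∧
        ∃ Ψ : HolIso (HolBundle.Hpmin μ q p) (HolBundle.Hmin p),
          ∀ y : HolBundle.Hpmin μ q p, (Ψ.toHomeomorph y).1 = Φ.toHomeomorph y.1) ∧
    (∃ h : HolIso (HolBundle.Htot (HolBundle.OO 0 0) p) (Fin n → CP1),
      ∀ x : HolBundle.Htot (HolBundle.OO 0 0) p, h.toHomeomorph x = x.lines) ∧
    Nonempty (HolIso (HolBundle.Hptot μ q p) (Fin n → CP1)) := by
  obtain ⟨ℓ, hℓ⟩ := HolBundle.exists_isStable (q := q) hμ hμ'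
  obtain ⟨h, hh⟩ := HolBundle.Htot.exists_holIso p
  exact ⟨⟨ℓ, hℓ⟩, fun ℓ hℓ => ⟨HolBundle.Hptot.holIso hμ hμ' hℓ, fun _ => rfl,
    HolIso.exists_restrict _ (HolBundle.mem_Hpmin_iff hμ hμ' hℓ)⟩, ⟨h, hh⟩,
    ⟨(HolBundle.Hptot.holIso hμ hμ' hℓ).trans h⟩⟩
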